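/- Let $k\ge 1$ and $n\ge 2k+8$ be integers, let $B_1$ be the open unit ball of $\mathbb R^n$ and $B_{1/2}$ the concentric ball of radius $1/2$. For an $n\times n$ matrix $A=(a_{ij})$ let $S_k(A)$ be the sum of its principal minors of order $k$ and $S_k^{ij}(A)=\partial S_k(A)/\partial a_{ij}$. There are constants $D_{n,k}$ and $D'_{n,k}$, depending only on $n$ and $k$, with the following property. Let $g:\mathbb R\to\mathbb R$ be nonnegative and locally Lipschitz, and let $u\in W^{1,k+1}(B_1,|x|^{1-k})$, that is, $u\in L^{k+1}(B_1)$ has a weak gradient in $B_1$ with $\int_{B_1}|x|^{1-k}|\nabla u|^{k+1}<\infty$. Assume that $u$ is radially symmetric, has a weak Hessian $D^2u\in L^1_{loc}(B_1\setminus\{0\})$, and is a semistable weak solution of $S_k(D^2u)=g(u)$ in $B_1$. This means: $\int_{B_1}\sum_{i,j}u_iu_jS_k^{ij}(D^2u)$ converges absolutely, $g(u)\in L^1(B_1)$, $$\int_{B_1}\Big\{\frac1k\sum_{i,j}u_i\eta_jS_k^{ij}(D^2u)+g(u)\eta\Big\}=0\qquad\text{for all }\eta\in C_c^1(B_1),$$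 and $$\int_{B_1}\Big\{\sum_{i,j}\varphi_i\varphi_jS_k^{ij}(D^2u)+g'(u)\varphi^2\Big\}\ge 0\qquad\text{for all }\varphi\in C_c^1(B_1\setminus\{0\}),$$ where $g'(t)$ is read as $0$ at points $t$ at which $g$ is not differentiable, and the integrands in the last two displays are integrable on $B_1$. Then, after modification on a null set, $u(x)=u(|x|)$ for a function $u=u(r)$ that is $C^1$ on $(0,1]$ (derivatives at $r=1$ are one-sided), and the following holds. (i) For all $r\in(0,1/2]$, $$u'(r)\le D_{n,k}\,\|\nabla u\|_{L^{k+1}(B_1\setminus\overline{B_{1/2}},|x|^{1-k})}\;r^{\frac{-(k+1)n+2\sqrt{2(k+1)n-4k}+k^2+4k-1}{(k+1)^2}},$$ where $\|\nabla u\|_{L^{k+1}(B_1\setminus\overline{B_{1/2}},|x|^{1-k})}=\big(\int_{B_1\setminus\overline{B_{1/2}}}|x|^{1-k}|\nabla u|^{k+1}\big)^{1/(k+1)}$. (ii) If $g$ is moreover nonincreasing, then $u\in C^2(0,1]$ and, for $i\in\{1,2\}$ and all $r\in(0,1]$, $$|u^{(i)}(r)|\le D'_{n,k}\Big(\min_{t\in[1/2,1]}u'(t)\Big)\,r^{\frac{-(k+1)n+2\sqrt{2(k+1)n-4k}+(2-i)k^2+2(3-i)k-i}{(k+1)^2}}.$$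 (iii) If $g$ is moreover nonincreasing and convex, then $u'''(r)$ exists for all but countably many $r\in(0,1]$, and it exists at every $r\in(0,1]$ such that $g$ is differentiable at $u(r)$; and at every $r\in(0,1]$ at which $u'''(r)$ exists, $$|u'''(r)|\le D'_{n,k}\Big(\min_{t\in[1/2,1]}u'(t)\Big)\,r^{\frac{-(k+1)n+2\sqrt{2(k+1)n-4k}-k^2-3}{(k+1)^2}}.$$ -/

import Mathlib

open MeasureTheory Set
open scoped ContDiff ENNReal

noncomputable section

namespace KHessian

/-- The `k`-Hessian operator `S_k` as a function of a matrix: the sum of all principal minors of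
order `k`. For a symmetric matrix this is the `k`-th elementary symmetric function of the
eigenvalues. -/
def hessianSum {n : ℕ} (k : ℕ) (A : Matrix (Fin n) (Fin n) ℝ) : ℝ :=
  ∑ s ∈ (Finset.univ : Finset (Fin n)).powersetCard k,
    (A.submatrix (fun a : s => (a : Fin n)) (fun a : s => (a : Fin n))).det

/-- `S_k^{ij}(A) = ∂ S_k(A) / ∂ a_{ij}`, the entries of the matrix being independent variables. -/
def hessianSumDeriv {n : ℕ} (k : ℕ) (A : Matrix (Fin n) (Fin n) ℝ) (i j : Fin n) : ℝ :=
  deriv (fun t : ℝ => hessianSum k (A + t • Matrix.single i j (1 : ℝ))) 0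

/-- The classical partial derivative `∂φ/∂x_i`. -/
def partialDeriv {n : ℕ} (φ : EuclideanSpace ℝ (Fin n) → ℝ) (i : Fin n)
    (x : EuclideanSpace ℝ (Fin n)) : ℝ :=
  fderiv ℝ φ x (EuclideanSpace.single i 1)

/-- `φ ∈ C_c^m(Ω)`, extended by zero to the whole space. -/
def IsTestFunction {n : ℕ} (m : WithTop ℕ∞) (Ω : Set (EuclideanSpace ℝ (Fin n)))
    (φ : EuclideanSpace ℝ (Fin n) → ℝ) : Prop :=
  ContDiff ℝ m φ ∧ HasCompactSupport φ ∧ tsupport φ ⊆ Ω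

/-- `h ∈ L^1_loc(Ω)` is the weak partial derivative `∂f/∂x_i` of `f ∈ L^1_loc(Ω)` in the open
set `Ω`. -/
def HasWeakPartialDeriv {n : ℕ} (Ω : Set (EuclideanSpace ℝ (Fin n))) (i : Fin n)
    (f h : EuclideanSpace ℝ (Fin n) → ℝ) : Prop :=
  LocallyIntegrableOn f Ω ∧ LocallyIntegrableOn h Ω ∧
    ∀ φ : EuclideanSpace ℝ (Fin n) → ℝ, IsTestFunction ∞ Ω φ →
      ∫ x in Ω, f x * partialDeriv φ i x = -∫ x in Ω, h x * φ x

/-- `G` is the weak gradient of `u` in `Ω`. -/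
def HasWeakGradient {n : ℕ} (Ω : Set (EuclideanSpace ℝ (Fin n)))
    (u : EuclideanSpace ℝ (Fin n) → ℝ)
    (G : EuclideanSpace ℝ (Fin n) → EuclideanSpace ℝ (Fin n)) : Prop :=
  ∀ i : Fin n, HasWeakPartialDeriv Ω i u (fun x => G x i)

/-- `H` is the weak Hessian in `Ω` of a function whose weak gradient is `G`. -/
def HasWeakHessian {n : ℕ} (Ω : Set (EuclideanSpace ℝ (Fin n)))
    (G : EuclideanSpace ℝ (Fin n) → EuclideanSpace ℝ (Fin n))
    (H : EuclideanSpace ℝ (Fin n) → Matrix (Fin n) (Fin n) ℝ) : Prop :=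
  ∀ i j : Fin n, HasWeakPartialDeriv Ω j (fun x => G x i) (fun x => H x i j)

/-- The open unit ball `B_1` of `ℝ^n`. -/
def unitBall (n : ℕ) : Set (EuclideanSpace ℝ (Fin n)) := Metric.ball 0 1

/-- `u` belongs to `W^{1,k+1}(B_1, |x|^{1-k})` and has weak gradient `G`: `u ∈ L^{k+1}(B_1)` and
`∫_{B_1} |x|^{1-k} |∇u|^{k+1} < ∞`. -/
def MemWeightedSobolev {n : ℕ} (k : ℕ) (u : EuclideanSpace ℝ (Fin n) → ℝ)
    (G : EuclideanSpace ℝ (Fin n) → EuclideanSpace ℝ (Fin n)) : Prop :=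
  MemLp u ((k : ℝ≥0∞) + 1) (volume.restrict (unitBall n)) ∧
  HasWeakGradient (unitBall n) u G ∧
  IntegrableOn (fun x => ‖x‖ ^ (1 - (k : ℝ)) * ‖G x‖ ^ (k + 1)) (unitBall n)

/-- The norm `‖∇u‖` in `L^{k+1}(B_1 \ closure B_{1/2}, |x|^{1-k})`, where `G = ∇u`. -/
def annulusGradNorm {n : ℕ} (k : ℕ)
    (G : EuclideanSpace ℝ (Fin n) → EuclideanSpace ℝ (Fin n)) : ℝ :=
  (∫ x in unitBall n \ Metric.closedBall 0 (1 / 2),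
    ‖x‖ ^ (1 - (k : ℝ)) * ‖G x‖ ^ (k + 1)) ^ (1 / ((k : ℝ) + 1))

/-- `u` is (almost everywhere equal to) a radially symmetric function on `B_1`. -/
def IsRadial {n : ℕ} (u : EuclideanSpace ℝ (Fin n) → ℝ) : Prop :=
  ∃ w : ℝ → ℝ, ∀ᵐ x ∂(volume.restrict (unitBall n)), u x = w ‖x‖

/-- `u`, with gradient `G` and Hessian `H`, is a weak solution of `S_k(D²u) = g(u)` in `B_1`. -/
structure IsWeakSolution {n : ℕ} (k : ℕ) (g : ℝ → ℝ) (u : EuclideanSpace ℝ (Fin n) → ℝ)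
    (G : EuclideanSpace ℝ (Fin n) → EuclideanSpace ℝ (Fin n))
    (H : EuclideanSpace ℝ (Fin n) → Matrix (Fin n) (Fin n) ℝ) : Prop where
  memLp : MemLp u ((k : ℝ≥0∞) + 1) (volume.restrict (unitBall n))
  energy : IntegrableOn
    (fun x => ∑ i, ∑ j, G x i * G x j * hessianSumDeriv k (H x) i j) (unitBall n)
  integrable_rhs : IntegrableOn (fun x => g (u x)) (unitBall n)
  equation : ∀ η : EuclideanSpace ℝ (Fin n) → ℝ, IsTestFunction 1 (unitBall n) η →
    IntegrableOn (fun x => (1 / (k : ℝ)) *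
      (∑ i, ∑ j, G x i * partialDeriv η j x * hessianSumDeriv k (H x) i j)
        + g (u x) * η x) (unitBall n) ∧
    ∫ x in unitBall n, ((1 / (k : ℝ)) *
      (∑ i, ∑ j, G x i * partialDeriv η j x * hessianSumDeriv k (H x) i j)
        + g (u x) * η x) = 0

/-- Semistability: the second variation is nonnegative on `C_c^1(B_1 \ {0})`. -/
def IsSemistable {n : ℕ} (k : ℕ) (g : ℝ → ℝ) (u : EuclideanSpace ℝ (Fin n) → ℝ)
    (H : EuclideanSpace ℝ (Fin n) → Matrix (Fin n) (Fin n) ℝ) : Prop :=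
  ∀ φ : EuclideanSpace ℝ (Fin n) → ℝ, IsTestFunction 1 (unitBall n \ {0}) φ →
    IntegrableOn (fun x =>
      (∑ i, ∑ j, partialDeriv φ i x * partialDeriv φ j x * hessianSumDeriv k (H x) i j)
        + deriv g (u x) * φ x ^ 2) (unitBall n) ∧
    0 ≤ ∫ x in unitBall n,
      ((∑ i, ∑ j, partialDeriv φ i x * partialDeriv φ j x * hessianSumDeriv k (H x) i j)
        + deriv g (u x) * φ x ^ 2)

/-- The `i`-th derivative at `r` of a function `v` of the radial variable `r ∈ (0,1]` (one-sided
at `r = 1`). -/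
def radialDeriv (i : ℕ) (v : ℝ → ℝ) (r : ℝ) : ℝ := iteratedDerivWithin i v (Ioc 0 1) r

/-- `min_{t ∈ [1/2,1]} v'(t)`; the minimum is attained when `v` is `C^1` on `(0,1]`. -/
def minSlope (v : ℝ → ℝ) : ℝ := sInf (radialDeriv 1 v '' Icc (1 / 2) 1)

/-- The part `-(k+1)n + 2√(2(k+1)n - 4k)` common to the numerators of all the exponents. -/
def expBase (n k : ℕ) : ℝ :=
  -((k : ℝ) + 1) * n + 2 * Real.sqrt (2 * ((k : ℝ) + 1) * n - 4 * k)

end KHessian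

end

/-!
# Pointwise bounds for radial semistable solutions of the `k`-Hessian equation

*One-dimensional problem.* Write `c` for the binomial coefficient of `k - 1` in `n - 1`. A radial
function with weak gradient and weak Hessian has gradient `p(|x|) x / |x|` with a continuous profile
`p`, and Hessian `(p / r) I + q x xᵀ` (`exists_radial_profile`). Since `S_k` is affine in `t` along
`β I + t y yᵀ`, the form `S_k^{ij}(D²u) x_i x_j / |x|²` equals `c (p / r)^{k-1}` and does not involve
`q`. Radial test functions therefore turn the weak equation into
`r^{n-k} p^k = (k / c) ∫₀^r s^{n-1} g(v(s)) ds`, where `v` is the profile of `u` and `v' = p`, and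
turn semistability into a one-dimensional quadratic form with leading coefficient
`c r^{n-k} p^{k-1}` (`exists_isRadialProfile`). Test functions concentrating at a point show
`p^{k-1} ≥ 0`, and together with `g ≥ 0` this gives `p ≥ 0`, also for even `k`
(`IsRadialProfile.nonneg`). The flux `r^{n-k} p^k` is nondecreasing, which is a one-sided Harnack
inequality for `p` (`IsRadialSolution.harnack`).

*Elimination of `g`.* Where `p > 0`, test semistability with `p ξ` and subtract the derivative of
`r^{n-1} p ξ² g(v) - c μ r^{n-k-1} p^{k+1} ξ²` for a suitable constant `μ`. The equation removes
every occurrence of `g`, and what remains is the weighted Hardy-type inequality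
`0 ≤ ∫ r^{n-k} p^{k+1} (ξ'² + 2 b ξ ξ' / r - Λ ξ² / r²) dr` with `b = (k-1)/(k+1)` and
`Λ = (2n-k-1)/(k+1)` (`IsRadialSolution.energy_inequality`). Let `-σ` be the negative root of
`t² + 2 b t - Λ`. For `ξ = r (ρ² + r²)^{-(1+σ)/2}` the logarithmic derivative `t = r ξ' / ξ` lies in
`[-σ, 1]`, where the form `(t + σ) (t - (σ - 2 b))` is nonpositive, because the dimension is large
enough for `σ - 2 b > 1` (`one_lt_hardyRoot_sub`). On `(ρ, 2ρ)` it is bounded away from zero. Cutting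
`ξ` off inside `(1/2, 1)` and near the largest radius up to which `p` vanishes, or near the origin if
there is none, gives a bound of the energy of `(ρ, 2ρ)` by a power of `ρ` times the energy of
`(1/2, 1)`. The inner cutoff costs nothing in the limit (`IsRadialSolution.exists_small_cutoff_error`),
and the Harnack inequality passes from the energy to the value `p(ρ)` (`exists_slope_pow_le`). The
exponent `(2σ - n + k + 1) / (k + 1)` is the one of the theorem (`hardy_exponent`).

*Monotone and convex `g`.* If `g` is nonincreasing, then so is `g(v)`, hence the mean of `g(v)` over
balls, hence `p / r`. All slopes on `[1/2, 1]` are therefore comparable, `g(v)` is at most a multiple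
of `(p / r)^k`, and the equation gives `|p'| ≤ n p / r`. If `g` is also convex, the derivative of
`g(v)` at `r` is controlled by the secant slope of `g` over `[v(r/2), v(r)]`, that is, by a multiple
of `(p / r)^k / r` (`IsRadialSolution.exists_abs_deriv_rhs_le`), and the differentiated equation
bounds `p''` by a multiple of `p / r²`. Each further derivative thus costs one power of `r`.
-/

namespace KHessian

/-! ### Weak derivatives on the unit interval -/

theorem intervalIntegrable_of_locallyIntegrableOn_Ioo {q : ℝ → ℝ}
    (hq : LocallyIntegrableOn q (Ioo 0 1)) {a b : ℝ} (ha : a ∈ Ioo (0 : ℝ) 1)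
    (hb : b ∈ Ioo (0 : ℝ) 1) : IntervalIntegrable q volume a b := by
  rw [intervalIntegrable_iff']
  exact hq.integrableOn_compact_subset ((ordConnected_Ioo).uIcc_subset ha hb) isCompact_uIcc

/-- A compact subset of `(0,1)` lies in some `[a,b] ⊆ (0,1)` with `1/2` inside. -/
theorem exists_Icc_of_isCompact {K : Set ℝ} (hK : IsCompact K) (hK' : K ⊆ Ioo 0 1) :
    ∃ a b : ℝ, 0 < a ∧ a < 1 / 2 ∧ 1 / 2 < b ∧ b < 1 ∧ K ⊆ Ioo a b := by
  rcases K.eq_empty_or_nonempty with rfl | hne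
  · exact ⟨1 / 4, 3 / 4, by norm_num, by norm_num, by norm_num, by norm_num, by simp⟩
  obtain ⟨x, hx, hx'⟩ := hK.exists_isLeast hne
  obtain ⟨y, hy, hy'⟩ := hK.exists_isGreatest hne
  have h1 := hK' hx
  have h2 := hK' hy
  refine ⟨min (x / 2) (1 / 4), max ((1 + y) / 2) (3 / 4), ?_, ?_, ?_, ?_, ?_⟩
  · exact lt_min (by linarith [h1.1]) (by norm_num)
  · exact (min_le_right _ _).trans_lt (by norm_num)
  · exact lt_of_lt_of_le (by norm_num) (le_max_right _ _)
  · exact max_lt (by linarith [h2.2]) (by norm_num)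
  · intro z hz
    have := hx' hz
    have := hy' hz
    exact ⟨(min_le_left _ _).trans_lt (by linarith [h1.1]),
      lt_of_lt_of_le (by linarith [h2.2]) (le_max_left _ _)⟩

theorem setIntegral_Ioo_eq_intervalIntegral {f : ℝ → ℝ} {a b : ℝ} (ha : 0 < a) (hab : a ≤ b)
    (hb : b < 1) (hf : ∀ x, x ∉ Ioo a b → f x = 0) :
    ∫ x in Ioo (0 : ℝ) 1, f x = ∫ x in a..b, f x := by
  rw [intervalIntegral.integral_of_le hab, ← integral_Ioc_eq_integral_Ioo]
  have h1 : Ioc a b ⊆ Ioc (0 : ℝ) 1 := fun x hx => ⟨ha.trans hx.1, hx.2.trans hb.le⟩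
  have h2 : ∀ x ∈ Ioc (0 : ℝ) 1 \ Ioc a b, f x = 0 := fun x hx =>
    hf x fun h => hx.2 ⟨h.1, h.2.le⟩
  exact setIntegral_eq_of_subset_of_forall_sdiff_eq_zero measurableSet_Ioc h1 h2

/-- The primitive of a locally integrable function is absolutely continuous on compact
subintervals, so it can be integrated by parts against a test function of `(0,1)`. -/
theorem integral_primitive_mul_deriv {q : ℝ → ℝ} (hq : LocallyIntegrableOn q (Ioo 0 1))
    {ψ : ℝ → ℝ} (hψ : ContDiff ℝ 1 ψ) (hc : HasCompactSupport ψ) (hs : tsupport ψ ⊆ Ioo 0 1) :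
    ∫ r in Ioo (0 : ℝ) 1, (∫ s in (1 / 2)..r, q s) * deriv ψ r =
      -∫ r in Ioo (0 : ℝ) 1, q r * ψ r := by
  obtain ⟨a, b, ha, ha', hb', hb, hK⟩ := exists_Icc_of_isCompact hc hs
  have hab : a < b := by linarith
  have hz : ∀ x, x ∉ Ioo a b → ψ x = 0 := fun x hx =>
    image_eq_zero_of_notMem_tsupport fun h => hx (hK h)
  have hz' : ∀ x, x ∉ Ioo a b → deriv ψ x = 0 := fun x hx =>
    image_eq_zero_of_notMem_tsupport fun h => hx (hK (tsupport_deriv_subset (𝕜 := ℝ) h))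
  rw [setIntegral_Ioo_eq_intervalIntegral ha hab.le hb (fun x hx => by rw [hz' x hx, mul_zero]),
    setIntegral_Ioo_eq_intervalIntegral ha hab.le hb (fun x hx => by rw [hz x hx, mul_zero])]
  have hqi : IntervalIntegrable q volume a b :=
    intervalIntegrable_of_locallyIntegrableOn_Ioo hq ⟨ha, by linarith⟩ ⟨by linarith, hb⟩
  have hm : (1 / 2 : ℝ) ∈ uIcc a b := by
    rw [uIcc_of_le hab.le]; exact ⟨ha'.le, hb'.le⟩
  have hF := hqi.absolutelyContinuousOnInterval_intervalIntegral hm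
  have hψ' : AbsolutelyContinuousOnInterval ψ a b :=
    hψ.contDiffOn.absolutelyContinuousOnInterval
  rw [hF.integral_mul_deriv_eq_deriv_mul hψ', hz a (by simp), hz b (by simp)]
  simp only [mul_zero, sub_zero, zero_sub, neg_inj]
  apply intervalIntegral.integral_congr_ae
  filter_upwards [hqi.ae_hasDerivAt_integral] with x hx hx'
  rw [(hx (uIoc_subset_uIcc hx') _ hm).deriv]

/-- A test function of `(0,1)` with zero mean is the derivative of a test function of `(0,1)`. -/
theorem exists_contDiff_primitive {φ : ℝ → ℝ} (hφ : ContDiff ℝ ∞ φ)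
    (hc : HasCompactSupport φ) (hs : tsupport φ ⊆ Ioo 0 1)
    (h0 : ∫ r in Ioo (0 : ℝ) 1, φ r = 0) :
    ∃ ψ : ℝ → ℝ, ContDiff ℝ ∞ ψ ∧ HasCompactSupport ψ ∧ tsupport ψ ⊆ Ioo 0 1 ∧
      deriv ψ = φ := by
  obtain ⟨a, b, ha, ha', hb', hb, hK⟩ := exists_Icc_of_isCompact hc hs
  have hab : a < b := by linarith
  have hz : ∀ x, x ∉ Ioo a b → φ x = 0 := fun x hx =>
    image_eq_zero_of_notMem_tsupport fun h => hx (hK h)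
  have hd : ∀ x, HasDerivAt (fun r => ∫ s in a..r, φ s) (φ x) x := fun x =>
    intervalIntegral.integral_hasDerivAt_right (hφ.continuous.intervalIntegrable _ _)
      (hφ.continuous.stronglyMeasurableAtFilter _ _) hφ.continuous.continuousAt
  have hder : deriv (fun r => ∫ s in a..r, φ s) = φ := funext fun x => (hd x).deriv
  have hsup : Function.support (fun r => ∫ s in a..r, φ s) ⊆ Icc a b := by
    intro x hx
    by_contra hx'
    apply hx
    simp only
    rcases lt_or_ge x a with h | h
    · rw [intervalIntegral.integral_zero_ae]
      refine Filter.Eventually.of_forall fun y hy => hz y ?_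
      rw [uIoc_of_ge h.le] at hy
      exact fun h' => absurd hy.2 (not_le.2 h'.1)
    · have hbx : b ≤ x := by
        by_contra h'
        exact hx' ⟨h, (not_le.1 h').le⟩
      rw [← intervalIntegral.integral_add_adjacent_intervals (b := b)
        (hφ.continuous.intervalIntegrable _ _) (hφ.continuous.intervalIntegrable _ _),
        ← setIntegral_Ioo_eq_intervalIntegral ha hab.le hb hz, h0, zero_add,
        intervalIntegral.integral_zero_ae]
      refine Filter.Eventually.of_forall fun y hy => hz y ?_
      rw [uIoc_of_le hbx] at hy
      exact fun h' => absurd hy.1 (not_lt.2 h'.2.le)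
  have hts : tsupport (fun r => ∫ s in a..r, φ s) ⊆ Icc a b :=
    closure_minimal hsup isClosed_Icc
  refine ⟨_, ?_, HasCompactSupport.of_support_subset_isCompact isCompact_Icc hsup,
    fun x hx => ⟨ha.trans_le (hts hx).1, (hts hx).2.trans_lt hb⟩, hder⟩
  rw [contDiff_infty_iff_deriv, hder]
  exact ⟨fun x => (hd x).differentiableAt, hφ⟩

theorem exists_unit_mass_bump : ∃ φ : ℝ → ℝ, ContDiff ℝ ∞ φ ∧ HasCompactSupport φ ∧
    tsupport φ ⊆ Ioo 0 1 ∧ ∫ r in Ioo (0 : ℝ) 1, φ r = 1 := by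
  let b : ContDiffBump (1 / 2 : ℝ) := ⟨1 / 8, 1 / 4, by norm_num, by norm_num⟩
  have hts : tsupport (b.normed volume) ⊆ Ioo 0 1 := by
    rw [b.tsupport_normed_eq]
    intro x hx
    rw [Metric.mem_closedBall, Real.dist_eq, abs_le] at hx
    have : b.rOut = 1 / 4 := rfl
    constructor <;> linarith [hx.1, hx.2]
  refine ⟨b.normed volume, b.contDiff_normed, b.hasCompactSupport_normed, hts, ?_⟩
  rw [setIntegral_eq_integral_of_forall_compl_eq_zero, b.integral_normed]
  intro x hx
  exact image_eq_zero_of_notMem_tsupport fun h => hx (hts h)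

theorem LocallyIntegrableOn.integrableOn_mul_compactSupport {f ψ : ℝ → ℝ}
    (hf : LocallyIntegrableOn f (Ioo 0 1)) (hψ : Continuous ψ) (hc : HasCompactSupport ψ)
    (hs : tsupport ψ ⊆ Ioo 0 1) : IntegrableOn (fun r => f r * ψ r) (Ioo 0 1) := by
  have h1 : IntegrableOn (fun r => f r * ψ r) (tsupport ψ) :=
    (hf.integrableOn_compact_subset hs hc).mul_continuousOn hψ.continuousOn hc
  refine h1.of_forall_sdiff_eq_zero measurableSet_Ioo ?_
  intro x hx
  rw [image_eq_zero_of_notMem_tsupport hx.2, mul_zero]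

/-- The lemma of du Bois-Reymond on `(0,1)`. -/
theorem exists_ae_eq_const_of_integral_mul_deriv_eq_zero {f : ℝ → ℝ}
    (hf : LocallyIntegrableOn f (Ioo 0 1))
    (h : ∀ ψ : ℝ → ℝ, ContDiff ℝ ∞ ψ → HasCompactSupport ψ → tsupport ψ ⊆ Ioo 0 1 →
      ∫ r in Ioo (0 : ℝ) 1, f r * deriv ψ r = 0) :
    ∃ c : ℝ, ∀ᵐ r ∂(volume.restrict (Ioo (0 : ℝ) 1)), f r = c := by
  obtain ⟨φ₀, hφ₀, hc₀, hs₀, hi₀⟩ := exists_unit_mass_bump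
  set c := ∫ r in Ioo (0 : ℝ) 1, f r * φ₀ r with hcdef
  refine ⟨c, ?_⟩
  have hloc : LocallyIntegrableOn (fun r => f r - c) (Ioo 0 1) :=
    hf.sub (continuous_const.locallyIntegrable.locallyIntegrableOn _)
  have key := isOpen_Ioo.ae_eq_zero_of_integral_contDiff_smul_eq_zero hloc ?_
  · rw [ae_restrict_iff' measurableSet_Ioo]
    filter_upwards [key] with x hx hx'
    linarith [hx hx']
  intro φ hφ hc hs
  have hz : ∀ x, x ∉ Ioo (0 : ℝ) 1 → φ x = 0 := fun x hx =>
    image_eq_zero_of_notMem_tsupport fun h => hx (hs h)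
  rw [← setIntegral_eq_integral_of_forall_compl_eq_zero (s := Ioo (0 : ℝ) 1)
    (fun x hx => by rw [hz x hx, zero_smul])]
  set m := ∫ r in Ioo (0 : ℝ) 1, φ r with hm
  have hφi : IntegrableOn φ (Ioo 0 1) := (hφ.continuous.integrable_of_hasCompactSupport hc).integrableOn
  have hφ₀i : IntegrableOn φ₀ (Ioo 0 1) :=
    (hφ₀.continuous.integrable_of_hasCompactSupport hc₀).integrableOn
  have hcs : HasCompactSupport (fun r => φ r - m * φ₀ r) := hc.sub hc₀.mul_left
  have hss : tsupport (fun r => φ r - m * φ₀ r) ⊆ Ioo 0 1 := by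
    refine (tsupport_sub φ (fun r => m * φ₀ r)).trans (union_subset hs ?_)
    exact (tsupport_mul_subset_right).trans hs₀
  obtain ⟨ψ, h1, h2, h3, h4⟩ := exists_contDiff_primitive (φ := fun r => φ r - m * φ₀ r)
    (hφ.sub (contDiff_const.mul hφ₀)) hcs hss (by
      rw [integral_sub hφi (hφ₀i.const_mul m), integral_const_mul, hi₀, ← hm]; ring)
  have := h ψ h1 h2 h3
  rw [h4] at this
  have e1 := LocallyIntegrableOn.integrableOn_mul_compactSupport hf hφ.continuous hc hs
  have e2 := LocallyIntegrableOn.integrableOn_mul_compactSupport hf hφ₀.continuous hc₀ hs₀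
  have e3 : ∫ r in Ioo (0 : ℝ) 1, f r * (φ r - m * φ₀ r) =
      (∫ r in Ioo (0 : ℝ) 1, f r * φ r) - m * c := by
    rw [hcdef, ← integral_const_mul, ← integral_sub e1 (e2.const_mul m)]
    congr 1; ext r; ring
  have e4 : ∫ r in Ioo (0 : ℝ) 1, φ r • (f r - c) =
      (∫ r in Ioo (0 : ℝ) 1, f r * φ r) - c * m := by
    rw [hm, ← integral_const_mul, ← integral_sub e1 (hφi.const_mul c)]
    congr 1; ext r; simp only [smul_eq_mul]; ring
  rw [e4]
  linarith

theorem continuousOn_primitive_Ioo {q : ℝ → ℝ} (hq : LocallyIntegrableOn q (Ioo 0 1)) :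
    ContinuousOn (fun r => ∫ s in (1 / 2)..r, q s) (Ioo 0 1) := by
  intro x hx
  obtain ⟨a, b, ha, ha', hb', hb, hK⟩ := exists_Icc_of_isCompact (isCompact_singleton (x := x))
    (singleton_subset_iff.2 hx)
  have hab : a < b := by linarith
  have hqi : IntervalIntegrable q volume a b :=
    intervalIntegrable_of_locallyIntegrableOn_Ioo hq ⟨ha, by linarith⟩ ⟨by linarith, hb⟩
  have hm : (1 / 2 : ℝ) ∈ uIcc a b := by
    rw [uIcc_of_le hab.le]; exact ⟨ha'.le, hb'.le⟩
  have h := (hqi.absolutelyContinuousOnInterval_intervalIntegral hm).continuousOn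
  rw [uIcc_of_le hab.le] at h
  have hx' : x ∈ Ioo a b := hK rfl
  exact (h.continuousAt (Icc_mem_nhds hx'.1 hx'.2)).continuousWithinAt

/-- A locally integrable function on `(0,1)` with locally integrable weak derivative `q` is,
up to a null set, a primitive of `q`. -/
theorem exists_ae_eq_primitive {f q : ℝ → ℝ}
    (hf : LocallyIntegrableOn f (Ioo 0 1)) (hq : LocallyIntegrableOn q (Ioo 0 1))
    (h : ∀ ψ : ℝ → ℝ, ContDiff ℝ ∞ ψ → HasCompactSupport ψ → tsupport ψ ⊆ Ioo 0 1 →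
      ∫ r in Ioo (0 : ℝ) 1, f r * deriv ψ r = -∫ r in Ioo (0 : ℝ) 1, q r * ψ r) :
    ∃ c : ℝ, ∀ᵐ r ∂(volume.restrict (Ioo (0 : ℝ) 1)), f r = c + ∫ s in (1 / 2)..r, q s := by
  have hF : LocallyIntegrableOn (fun r => ∫ s in (1 / 2)..r, q s) (Ioo 0 1) :=
    (continuousOn_primitive_Ioo hq).locallyIntegrableOn measurableSet_Ioo
  obtain ⟨c, hc⟩ := exists_ae_eq_const_of_integral_mul_deriv_eq_zero
    (f := fun r => f r - ∫ s in (1 / 2)..r, q s) (hf.sub hF) (by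
    intro ψ h1 h2 h3
    have hd : Continuous (deriv ψ) := h1.continuous_deriv (by simp)
    have h3' : tsupport (deriv ψ) ⊆ Ioo 0 1 := (tsupport_deriv_subset (𝕜 := ℝ)).trans h3
    have e1 := LocallyIntegrableOn.integrableOn_mul_compactSupport hf hd h2.deriv h3'
    have e2 := LocallyIntegrableOn.integrableOn_mul_compactSupport hF hd h2.deriv h3'
    have e3 := integral_sub e1 e2
    rw [h ψ h1 h2 h3, integral_primitive_mul_deriv hq (h1.of_le (by simp)) h2 h3, sub_self] at e3
    simpa only [sub_mul] using e3)
  refine ⟨c, ?_⟩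
  filter_upwards [hc] with r hr
  linarith [show f r - (∫ s in (1 / 2)..r, q s) = c from hr]

end KHessian

namespace KHessian

/-! ### Integration in polar coordinates -/

variable {n : ℕ}

/-- The integral of `F` over the sphere of radius `r`, with respect to the surface measure of the
unit sphere. -/
noncomputable def sphereIntegral (F : EuclideanSpace ℝ (Fin n) → ℝ) (r : ℝ) : ℝ :=
  ∫ θ : Metric.sphere (0 : EuclideanSpace ℝ (Fin n)) 1, F (r • (θ : EuclideanSpace ℝ (Fin n)))
    ∂(volume : Measure (EuclideanSpace ℝ (Fin n))).toSphere

/-- The surface area of the unit sphere. -/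
noncomputable def sphereArea (n : ℕ) : ℝ :=
  (volume : Measure (EuclideanSpace ℝ (Fin n))).toSphere.real univ

theorem sphereArea_eq : sphereArea n =
    n * (volume : Measure (EuclideanSpace ℝ (Fin n))).real (Metric.ball 0 1) := by
  simp [sphereArea]

theorem sphereArea_pos [NeZero n] : 0 < sphereArea n := by
  rw [sphereArea_eq]
  have h1 : 0 < (volume : Measure (EuclideanSpace ℝ (Fin n))).real (Metric.ball 0 1) :=
    ENNReal.toReal_pos (Metric.measure_ball_pos _ _ one_pos).ne' measure_ball_lt_top.ne
  have h2 : (0 : ℝ) < n := Nat.cast_pos.2 (Nat.pos_of_ne_zero (NeZero.ne n))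
  positivity

theorem norm_smul_sphere {r : ℝ} (hr : 0 < r)
    (θ : Metric.sphere (0 : EuclideanSpace ℝ (Fin n)) 1) :
    ‖r • (θ : EuclideanSpace ℝ (Fin n))‖ = r := by
  have := θ.2
  rw [mem_sphere_zero_iff_norm] at this
  rw [norm_smul, this, mul_one, Real.norm_of_nonneg hr.le]

theorem sphereIntegral_mul_radial (F : EuclideanSpace ℝ (Fin n) → ℝ) (ψ : ℝ → ℝ) {r : ℝ}
    (hr : 0 < r) : sphereIntegral (fun x => F x * ψ ‖x‖) r = sphereIntegral F r * ψ r := by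
  simp only [sphereIntegral, norm_smul_sphere hr, integral_mul_const]

theorem sphereIntegral_radial (f : ℝ → ℝ) {r : ℝ} (hr : 0 < r) :
    sphereIntegral (fun x : EuclideanSpace ℝ (Fin n) => f ‖x‖) r = sphereArea n * f r := by
  simp [sphereIntegral, norm_smul_sphere hr, sphereArea]

theorem ae_subtype_comap_iff {α : Type*} [MeasurableSpace α] {μ : Measure α} {s : Set α}
    (hs : MeasurableSet s) {P : α → Prop} :
    (∀ᵐ x : s ∂(μ.comap (↑)), P x.1) ↔ ∀ᵐ x ∂(μ.restrict s), P x := by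
  rw [← map_comap_subtype_coe hs, (MeasurableEmbedding.subtype_coe hs).ae_map_iff]

theorem ae_volumeIoiPow_iff {m : ℕ} {P : ℝ → Prop} :
    (∀ᵐ r : Ioi (0 : ℝ) ∂(Measure.volumeIoiPow m), P r.1) ↔
      ∀ᵐ r ∂(volume.restrict (Ioi (0 : ℝ))), P r := by
  have hm : Measurable fun r : Ioi (0 : ℝ) => ENNReal.ofReal ((r : ℝ) ^ m) := by fun_prop
  rw [Measure.volumeIoiPow, ae_withDensity_iff hm, ← ae_subtype_comap_iff measurableSet_Ioi]
  refine ⟨fun h => ?_, fun h => ?_⟩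
  · filter_upwards [h] with r hr
    exact hr (ENNReal.ofReal_pos.2 (pow_pos r.2 _)).ne'
  · filter_upwards [h] with r hr _ using hr

/-- Polar coordinates, by transport along the homeomorphism of `ℝⁿ \ {0}` with the product of the
unit sphere and `(0, ∞)`. -/
theorem integrable_polar {F : EuclideanSpace ℝ (Fin n) → ℝ} (hF : Integrable F) :
    IntegrableOn (fun r => r ^ (n - 1) * sphereIntegral F r) (Ioi 0) ∧
    ((∫ x in {0}ᶜ, F x) = ∫ r in Ioi (0 : ℝ), r ^ (n - 1) * sphereIntegral F r) := by
  have hmp := (volume : Measure (EuclideanSpace ℝ (Fin n))).measurePreserving_homeomorphUnitSphereProd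
  have h0 : MeasurableSet ({0}ᶜ : Set (EuclideanSpace ℝ (Fin n))) :=
    (measurableSet_singleton _).compl
  let Φ : Metric.sphere (0 : EuclideanSpace ℝ (Fin n)) 1 × Ioi (0 : ℝ) → ℝ :=
    fun q => F (q.2.1 • q.1.1)
  have hΦ : ∀ x : ({0}ᶜ : Set (EuclideanSpace ℝ (Fin n))),
      Φ (homeomorphUnitSphereProd _ x) = F x.1 := by
    intro x
    have hx : ‖x.1‖ ≠ 0 := norm_ne_zero_iff.2 x.2
    simp [Φ, smul_smul, hx]
  have hemb := (homeomorphUnitSphereProd (EuclideanSpace ℝ (Fin n))).measurableEmbedding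
  have hΦi : Integrable Φ ((volume : Measure (EuclideanSpace ℝ (Fin n))).toSphere.prod
      (Measure.volumeIoiPow (Module.finrank ℝ (EuclideanSpace ℝ (Fin n)) - 1))) := by
    rw [← hmp.integrable_comp_emb hemb]
    have : Φ ∘ homeomorphUnitSphereProd (EuclideanSpace ℝ (Fin n)) = F ∘ Subtype.val :=
      funext hΦ
    rw [this, ← integrableOn_iff_comap_subtypeVal h0]
    exact hF.integrableOn
  have hint : ∫ x in {0}ᶜ, F x = ∫ r : Ioi (0 : ℝ), sphereIntegral F r.1
      ∂(Measure.volumeIoiPow (Module.finrank ℝ (EuclideanSpace ℝ (Fin n)) - 1)) := by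
    rw [← integral_subtype_comap h0]
    simp_rw [← hΦ]
    rw [hmp.integral_comp hemb, integral_prod_symm _ hΦi]
    rfl
  have hr := hΦi.integral_prod_right
  rw [finrank_euclideanSpace_fin] at hint hr
  have hm : Measurable fun r : Ioi (0 : ℝ) => ENNReal.ofReal ((r : ℝ) ^ (n - 1)) := by fun_prop
  have hpos : ∀ r : Ioi (0 : ℝ), 0 ≤ r.1 ^ (n - 1) := fun r => pow_nonneg r.2.le _
  constructor
  · rw [integrableOn_iff_comap_subtypeVal measurableSet_Ioi]
    rw [Measure.volumeIoiPow, integrable_withDensity_iff_integrable_smul' hm (by simp)] at hr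
    refine hr.congr (.of_forall fun r => ?_)
    simp [ENNReal.toReal_ofReal (hpos r), sphereIntegral, Φ]
  · rw [hint, Measure.volumeIoiPow, integral_withDensity_eq_integral_toReal_smul hm (by simp),
      ← integral_subtype_comap measurableSet_Ioi]
    congr 1
    ext r
    simp [ENNReal.toReal_ofReal (hpos r)]

theorem integral_polar [NeZero n] {F : EuclideanSpace ℝ (Fin n) → ℝ} (hF : Integrable F) :
    ∫ x, F x = ∫ r in Ioi (0 : ℝ), r ^ (n - 1) * sphereIntegral F r := by
  rw [← (integrable_polar hF).2, restrict_compl_singleton]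

/-! ### Functions on the punctured ball -/

theorem isOpen_unitBall : IsOpen (unitBall n) := Metric.isOpen_ball

theorem isOpen_puncturedBall : IsOpen (unitBall n \ {0}) :=
  Metric.isOpen_ball.sdiff isClosed_singleton

theorem restrict_puncturedBall [NeZero n] :
    (volume : Measure (EuclideanSpace ℝ (Fin n))).restrict (unitBall n \ {0}) =
      volume.restrict (unitBall n) := by
  refine Measure.restrict_congr_set ?_
  exact sdiff_null_ae_eq_self (measure_singleton _)

/-- A property of almost every radius holds at the norm of almost every point of the ball. -/
theorem ae_norm_of_ae [NeZero n] {P : ℝ → Prop}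
    (h : ∀ᵐ r ∂(volume.restrict (Ioo (0 : ℝ) 1)), P r) :
    ∀ᵐ x : EuclideanSpace ℝ (Fin n) ∂(volume.restrict (unitBall n)), P ‖x‖ := by
  have hmp := (volume : Measure (EuclideanSpace ℝ (Fin n))).measurePreserving_homeomorphUnitSphereProd
  have h0 : MeasurableSet ({0}ᶜ : Set (EuclideanSpace ℝ (Fin n))) :=
    (measurableSet_singleton _).compl
  have h1 : ∀ᵐ r ∂(volume.restrict (Ioi (0 : ℝ))), r < 1 → P r := by
    rw [ae_restrict_iff' measurableSet_Ioo] at h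
    rw [ae_restrict_iff' measurableSet_Ioi]
    filter_upwards [h] with r hr h0 h1 using hr ⟨h0, h1⟩
  have h2 := (Measure.quasiMeasurePreserving_snd
    (μ := (volume : Measure (EuclideanSpace ℝ (Fin n))).toSphere)).ae
    ((ae_volumeIoiPow_iff (m := Module.finrank ℝ (EuclideanSpace ℝ (Fin n)) - 1)).2 h1)
  have h3 := hmp.quasiMeasurePreserving.ae h2
  have h4 : ∀ᵐ x : EuclideanSpace ℝ (Fin n), ‖x‖ < 1 → P ‖x‖ := by
    rw [← restrict_compl_singleton (μ := volume) (0 : EuclideanSpace ℝ (Fin n)),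
      ← ae_subtype_comap_iff h0]
    filter_upwards [h3] with x hx
    simpa using hx
  rw [ae_restrict_iff' isOpen_unitBall.measurableSet]
  filter_upwards [h4] with x hx hx'
  exact hx (by simpa [unitBall] using hx')

end KHessian

namespace KHessian

variable {n : ℕ}

/-! ### Calculus of weak derivatives -/

theorem IsTestFunction.eq_zero {m : WithTop ℕ∞} {Ω : Set (EuclideanSpace ℝ (Fin n))}
    {φ : EuclideanSpace ℝ (Fin n) → ℝ} (h : IsTestFunction m Ω φ) {x : EuclideanSpace ℝ (Fin n)}
    (hx : x ∉ Ω) : φ x = 0 :=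
  image_eq_zero_of_notMem_tsupport fun h' => hx (h.2.2 h')

theorem tsupport_partialDeriv_subset (φ : EuclideanSpace ℝ (Fin n) → ℝ) (i : Fin n) :
    tsupport (partialDeriv φ i) ⊆ tsupport φ :=
  closure_minimal (fun x hx => support_fderiv_subset ℝ (f := φ) fun h => hx (by
    simp only [partialDeriv, h, zero_apply])) (isClosed_tsupport φ)

theorem IsTestFunction.partialDeriv_eq_zero {m : WithTop ℕ∞}
    {Ω : Set (EuclideanSpace ℝ (Fin n))}
    {φ : EuclideanSpace ℝ (Fin n) → ℝ} (h : IsTestFunction m Ω φ) (i : Fin n)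
    {x : EuclideanSpace ℝ (Fin n)} (hx : x ∉ Ω) : partialDeriv φ i x = 0 :=
  image_eq_zero_of_notMem_tsupport fun h' => hx (h.2.2 (tsupport_partialDeriv_subset φ i h'))

theorem continuousOn_partialDeriv {Ω : Set (EuclideanSpace ℝ (Fin n))} (hΩ : IsOpen Ω)
    {m : EuclideanSpace ℝ (Fin n) → ℝ} (hm : ContDiffOn ℝ 1 m Ω) (i : Fin n) :
    ContinuousOn (partialDeriv m i) Ω :=
  (hm.continuousOn_fderiv_of_isOpen hΩ (by simp)).clm_apply continuousOn_const

theorem continuous_partialDeriv {m : EuclideanSpace ℝ (Fin n) → ℝ} (hm : ContDiff ℝ 1 m)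
    (i : Fin n) : Continuous (partialDeriv m i) :=
  (hm.continuous_fderiv (by simp)).clm_apply continuous_const

theorem partialDeriv_mul {f g : EuclideanSpace ℝ (Fin n) → ℝ} {x : EuclideanSpace ℝ (Fin n)}
    (hf : DifferentiableAt ℝ f x) (hg : DifferentiableAt ℝ g x) (i : Fin n) :
    partialDeriv (fun y => f y * g y) i x = f x * partialDeriv g i x + partialDeriv f i x * g x := by
  have := fderiv_fun_mul hf hg
  simp only [partialDeriv, this, add_apply, smul_apply,
    smul_eq_mul]
  ring

theorem integrable_mul_of_compactSupport {Ω : Set (EuclideanSpace ℝ (Fin n))}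
    {F φ : EuclideanSpace ℝ (Fin n) → ℝ}
    (hF : LocallyIntegrableOn F Ω) (hφ : Continuous φ) (hc : HasCompactSupport φ)
    (hs : tsupport φ ⊆ Ω) : Integrable (fun x => F x * φ x) := by
  have h1 : IntegrableOn (fun r => F r * φ r) (tsupport φ) :=
    (hF.integrableOn_compact_subset hs hc).mul_continuousOn hφ.continuousOn hc
  exact h1.integrable_of_forall_notMem_eq_zero fun x hx => by
    rw [image_eq_zero_of_notMem_tsupport hx, mul_zero]

theorem contDiff_mul_of_tsupport_subset {E : Type*} [NormedAddCommGroup E] [NormedSpace ℝ E]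
    {Ω : Set E} (hΩ : IsOpen Ω) {k : WithTop ℕ∞} {m φ : E → ℝ} (hm : ContDiffOn ℝ k m Ω)
    (hφ : ContDiff ℝ k φ) (hs : tsupport φ ⊆ Ω) : ContDiff ℝ k (fun x => m x * φ x) := by
  rw [contDiff_iff_contDiffAt]
  intro x
  by_cases hx : x ∈ tsupport φ
  · exact (hm.contDiffAt (hΩ.mem_nhds (hs hx))).mul hφ.contDiffAt
  · have h0 : (fun x => m x * φ x) =ᶠ[nhds x] fun _ => 0 := by
      filter_upwards [(isClosed_tsupport φ).isOpen_compl.mem_nhds hx] with y hy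
      rw [image_eq_zero_of_notMem_tsupport hy, mul_zero]
    exact contDiffAt_const.congr_of_eventuallyEq h0

theorem IsTestFunction.mul_left {Ω : Set (EuclideanSpace ℝ (Fin n))} (hΩ : IsOpen Ω)
    {k : WithTop ℕ∞} {m φ : EuclideanSpace ℝ (Fin n) → ℝ} (hm : ContDiffOn ℝ k m Ω)
    (hφ : IsTestFunction k Ω φ) : IsTestFunction k Ω (fun x => m x * φ x) :=
  ⟨contDiff_mul_of_tsupport_subset hΩ hm hφ.1 hφ.2.2, hφ.2.1.mul_left,
    (tsupport_mul_subset_right).trans hφ.2.2⟩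

/-- The product rule for a weak derivative and a smooth factor. -/
theorem HasWeakPartialDeriv.mul_smooth {Ω : Set (EuclideanSpace ℝ (Fin n))} (hΩ : IsOpen Ω)
    {i : Fin n} {f h m : EuclideanSpace ℝ (Fin n) → ℝ} (hm : ContDiffOn ℝ ∞ m Ω)
    (hf : HasWeakPartialDeriv Ω i f h) :
    HasWeakPartialDeriv Ω i (fun x => f x * m x)
      (fun x => h x * m x + f x * partialDeriv m i x) := by
  have hm' := continuousOn_partialDeriv hΩ (hm.of_le (by simp)) i
  have l1 : LocallyIntegrableOn (fun x => f x * m x) Ω :=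
    hf.1.mul_continuousOn hm.continuousOn hΩ.isLocallyClosed
  have l2 : LocallyIntegrableOn (fun x => h x * m x) Ω :=
    hf.2.1.mul_continuousOn hm.continuousOn hΩ.isLocallyClosed
  have l3 : LocallyIntegrableOn (fun x => f x * partialDeriv m i x) Ω :=
    hf.1.mul_continuousOn hm' hΩ.isLocallyClosed
  refine ⟨l1, l2.add l3, fun φ hφ => ?_⟩
  have hd := continuous_partialDeriv (hφ.1.of_le (by simp)) i
  have hds : tsupport (partialDeriv φ i) ⊆ Ω := (tsupport_partialDeriv_subset φ i).trans hφ.2.2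
  have hdc : HasCompactSupport (partialDeriv φ i) :=
    hφ.2.1.of_isClosed_subset (isClosed_tsupport _) (tsupport_partialDeriv_subset φ i)
  have key := hf.2.2 _ (hφ.mul_left hΩ hm)
  have e1 : ∫ x in Ω, f x * partialDeriv (fun x => m x * φ x) i x =
      ∫ x in Ω, (f x * m x * partialDeriv φ i x + f x * partialDeriv m i x * φ x) := by
    refine setIntegral_congr_fun hΩ.measurableSet fun x hx => ?_
    have hmx : DifferentiableAt ℝ m x :=
      (hm.contDiffAt (hΩ.mem_nhds hx)).differentiableAt (by simp)
    rw [partialDeriv_mul hmx ((hφ.1.differentiable (by simp)) x)]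
    ring
  have i1 := (integrable_mul_of_compactSupport l1 hd hdc hds).integrableOn (s := Ω)
  have i2 := (integrable_mul_of_compactSupport l2 hφ.1.continuous hφ.2.1 hφ.2.2).integrableOn (s := Ω)
  have i3 := (integrable_mul_of_compactSupport l3 hφ.1.continuous hφ.2.1 hφ.2.2).integrableOn (s := Ω)
  rw [e1, integral_add i1 i3] at key
  have e2 : ∫ x in Ω, (h x * m x + f x * partialDeriv m i x) * φ x =
      (∫ x in Ω, h x * m x * φ x) + ∫ x in Ω, f x * partialDeriv m i x * φ x := by
    rw [← integral_add i2 i3]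
    simp only [add_mul]
  simp only [← mul_assoc] at key
  rw [e2]
  linarith

/-- Uniqueness of the weak derivative. -/
theorem HasWeakPartialDeriv.ae_eq {Ω : Set (EuclideanSpace ℝ (Fin n))} (hΩ : IsOpen Ω)
    {i : Fin n} {f h h' : EuclideanSpace ℝ (Fin n) → ℝ}
    (h1 : HasWeakPartialDeriv Ω i f h) (h2 : HasWeakPartialDeriv Ω i f h') :
    ∀ᵐ x ∂(volume.restrict Ω), h x = h' x := by
  have hl : LocallyIntegrableOn (fun x => h x - h' x) Ω := h1.2.1.sub h2.2.1
  rw [ae_restrict_iff' hΩ.measurableSet]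
  have key := hΩ.ae_eq_zero_of_integral_contDiff_smul_eq_zero hl ?_
  · filter_upwards [key] with x hx hx'
    linarith [hx hx']
  · intro φ hφ hc hs
    have hφ' : IsTestFunction ∞ Ω φ := ⟨hφ, hc, hs⟩
    rw [← setIntegral_eq_integral_of_forall_compl_eq_zero (s := Ω)
      (fun x hx => by rw [hφ'.eq_zero hx, zero_smul])]
    have i1 := (integrable_mul_of_compactSupport h1.2.1 hφ.continuous hc hs).integrableOn (s := Ω)
    have i2 := (integrable_mul_of_compactSupport h2.2.1 hφ.continuous hc hs).integrableOn (s := Ω)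
    have e1 := h1.2.2 φ hφ'
    have e2 := h2.2.2 φ hφ'
    have e3 := integral_sub i1 i2
    calc ∫ x in Ω, φ x • (h x - h' x) = ∫ x in Ω, (h x * φ x - h' x * φ x) := by
          congr 1; ext x; simp only [smul_eq_mul]; ring
      _ = 0 := by rw [e3]; linarith

theorem HasWeakPartialDeriv.congr {Ω : Set (EuclideanSpace ℝ (Fin n))}
    {i : Fin n} {f f' h h' : EuclideanSpace ℝ (Fin n) → ℝ}
    (hw : HasWeakPartialDeriv Ω i f h) (h1 : ∀ᵐ x ∂(volume.restrict Ω), f x = f' x)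
    (h2 : ∀ᵐ x ∂(volume.restrict Ω), h x = h' x) : HasWeakPartialDeriv Ω i f' h' := by
  refine ⟨hw.1.congr h1, hw.2.1.congr h2, fun φ hφ => ?_⟩
  have e1 : ∫ x in Ω, f' x * partialDeriv φ i x = ∫ x in Ω, f x * partialDeriv φ i x :=
    integral_congr_ae (by filter_upwards [h1] with x hx; rw [hx])
  have e2 : ∫ x in Ω, h' x * φ x = ∫ x in Ω, h x * φ x :=
    integral_congr_ae (by filter_upwards [h2] with x hx; rw [hx])
  rw [e1, e2]
  exact hw.2.2 φ hφ

theorem HasWeakPartialDeriv.mono {Ω Ω' : Set (EuclideanSpace ℝ (Fin n))} (hs : Ω' ⊆ Ω)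
    {i : Fin n} {f h : EuclideanSpace ℝ (Fin n) → ℝ}
    (hw : HasWeakPartialDeriv Ω i f h) : HasWeakPartialDeriv Ω' i f h := by
  refine ⟨hw.1.mono_set hs, hw.2.1.mono_set hs, fun φ hφ => ?_⟩
  have h1 := hw.2.2 φ ⟨hφ.1, hφ.2.1, hφ.2.2.trans hs⟩
  rw [setIntegral_eq_integral_of_forall_compl_eq_zero (fun x hx => by
      rw [hφ.partialDeriv_eq_zero i hx, mul_zero]),
    setIntegral_eq_integral_of_forall_compl_eq_zero (fun x hx => by rw [hφ.eq_zero hx, mul_zero])]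
  rwa [setIntegral_eq_integral_of_forall_compl_eq_zero (fun x hx => by
      rw [hφ.partialDeriv_eq_zero i fun h => hx (hs h), mul_zero]),
    setIntegral_eq_integral_of_forall_compl_eq_zero (fun x hx => by
      rw [hφ.eq_zero fun h => hx (hs h), mul_zero])] at h1

theorem HasWeakPartialDeriv.sum {Ω : Set (EuclideanSpace ℝ (Fin n))} {j : Fin n}
    {ι : Type*} (s : Finset ι) {f h : ι → EuclideanSpace ℝ (Fin n) → ℝ}
    (hw : ∀ i ∈ s, HasWeakPartialDeriv Ω j (f i) (h i)) :
    HasWeakPartialDeriv Ω j (fun x => ∑ i ∈ s, f i x) (fun x => ∑ i ∈ s, h i x) := by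
  classical
  induction s using Finset.induction_on with
  | empty =>
    refine ⟨by simpa using locallyIntegrableOn_zero, by simpa using locallyIntegrableOn_zero, ?_⟩
    simp
  | insert a s ha ih =>
    have h1 := hw a (Finset.mem_insert_self _ _)
    have h2 := ih fun i hi => hw i (Finset.mem_insert_of_mem hi)
    simp only [Finset.sum_insert ha]
    refine ⟨h1.1.add h2.1, h1.2.1.add h2.2.1, fun φ hφ => ?_⟩
    have hd := continuous_partialDeriv (hφ.1.of_le (by simp)) j
    have hds : tsupport (partialDeriv φ j) ⊆ Ω := (tsupport_partialDeriv_subset φ j).trans hφ.2.2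
    have hdc : HasCompactSupport (partialDeriv φ j) :=
      hφ.2.1.of_isClosed_subset (isClosed_tsupport _) (tsupport_partialDeriv_subset φ j)
    simp only [add_mul]
    rw [integral_add (integrable_mul_of_compactSupport h1.1 hd hdc hds).integrableOn
        (integrable_mul_of_compactSupport h2.1 hd hdc hds).integrableOn,
      integral_add
        (integrable_mul_of_compactSupport h1.2.1 hφ.1.continuous hφ.2.1 hφ.2.2).integrableOn
        (integrable_mul_of_compactSupport h2.2.1 hφ.1.continuous hφ.2.1 hφ.2.2).integrableOn,
      h1.2.2 φ hφ, h2.2.2 φ hφ]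
    ring

/-! ### Radial functions -/

theorem partialDeriv_norm {x : EuclideanSpace ℝ (Fin n)} (hx : x ≠ 0) (i : Fin n) :
    partialDeriv (fun y => ‖y‖) i x = x i / ‖x‖ := by
  have h := (hasStrictFDerivAt_norm_sq x).hasFDerivAt.sqrt (by positivity)
  have h2 : (fun y : EuclideanSpace ℝ (Fin n) => √(‖y‖ ^ 2)) = fun y => ‖y‖ := by
    ext y; exact Real.sqrt_sq (norm_nonneg _)
  rw [h2] at h
  rw [partialDeriv, h.fderiv, Real.sqrt_sq (norm_nonneg _)]
  simp [EuclideanSpace.inner_single_right]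
  field_simp

theorem partialDeriv_comp_norm {ψ : ℝ → ℝ} {x : EuclideanSpace ℝ (Fin n)} (hx : x ≠ 0)
    (hψ : DifferentiableAt ℝ ψ ‖x‖) (i : Fin n) :
    partialDeriv (fun y => ψ ‖y‖) i x = deriv ψ ‖x‖ * (x i / ‖x‖) := by
  rw [← partialDeriv_norm hx]
  have hn : DifferentiableAt ℝ (fun y : EuclideanSpace ℝ (Fin n) => ‖y‖) x :=
    (contDiffAt_norm (n := 1) ℝ hx).differentiableAt (by simp)
  have := (hψ.hasDerivAt.comp_hasFDerivAt x hn.hasFDerivAt).fderiv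
  simp only [Function.comp_def] at this
  simp [partialDeriv, this]

/-- The condition at the origin is needed because the norm is not differentiable there. -/
theorem contDiff_comp_norm {k : WithTop ℕ∞} {ψ : ℝ → ℝ} (hψ : ContDiff ℝ k ψ)
    (h0 : ψ =ᶠ[nhds 0] fun _ => ψ 0) :
    ContDiff ℝ k (fun x : EuclideanSpace ℝ (Fin n) => ψ ‖x‖) := by
  rw [contDiff_iff_contDiffAt]
  intro x
  by_cases hx : x = 0
  · subst hx
    have : Filter.Tendsto (fun x : EuclideanSpace ℝ (Fin n) => ‖x‖) (nhds 0) (nhds 0) := by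
      simpa using (continuous_norm (E := EuclideanSpace ℝ (Fin n))).tendsto 0
    exact contDiffAt_const.congr_of_eventuallyEq (this.eventually h0)
  · exact hψ.contDiffAt.comp x (contDiffAt_norm ℝ hx)

theorem isCompact_annulus (a b : ℝ) :
    IsCompact {x : EuclideanSpace ℝ (Fin n) | ‖x‖ ∈ Icc a b} := by
  refine (isCompact_closedBall (0 : EuclideanSpace ℝ (Fin n)) b).of_isClosed_subset
    (isClosed_Icc.preimage continuous_norm) fun x hx => ?_
  simpa using hx.2

theorem annulus_subset {a b : ℝ} (ha : 0 < a) (hb : b < 1) :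
    {x : EuclideanSpace ℝ (Fin n) | ‖x‖ ∈ Icc a b} ⊆ unitBall n \ {0} := by
  intro x hx
  refine ⟨?_, ?_⟩
  · rw [unitBall, mem_ball_zero_iff]; exact hx.2.trans_lt hb
  · rintro rfl
    have := hx.1
    simp at this
    linarith

theorem norm_mem_Ioo {x : EuclideanSpace ℝ (Fin n)} (hx : x ∈ unitBall n \ {0}) :
    ‖x‖ ∈ Ioo (0 : ℝ) 1 :=
  ⟨norm_pos_iff.2 hx.2, by simpa [unitBall] using hx.1⟩

theorem tsupport_comp_norm_subset {ψ : ℝ → ℝ} {a b : ℝ} (h : tsupport ψ ⊆ Icc a b) :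
    tsupport (fun x : EuclideanSpace ℝ (Fin n) => ψ ‖x‖) ⊆ {x | ‖x‖ ∈ Icc a b} :=
  closure_minimal (fun _ hx => h (subset_tsupport _ hx)) (isClosed_Icc.preimage continuous_norm)

/-- A test function of the radial variable on `(0,1)` gives a radial test function on the
punctured ball. -/
theorem isTestFunction_comp_norm {k : WithTop ℕ∞} {ψ : ℝ → ℝ} (hψ : ContDiff ℝ k ψ)
    (hc : HasCompactSupport ψ) (hs : tsupport ψ ⊆ Ioo 0 1) :
    IsTestFunction k (unitBall n \ {0}) (fun x => ψ ‖x‖) := by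
  obtain ⟨a, b, ha, ha', hb', hb, hK⟩ := exists_Icc_of_isCompact hc hs
  have hts := tsupport_comp_norm_subset (n := n) (hK.trans Ioo_subset_Icc_self)
  refine ⟨contDiff_comp_norm hψ ?_, (isCompact_annulus a b).of_isClosed_subset
    (isClosed_tsupport _) hts, hts.trans (annulus_subset ha hb)⟩
  have hz : ∀ y < a, ψ y = 0 := fun y hy =>
    image_eq_zero_of_notMem_tsupport fun h => absurd (hK h).1 (not_lt.2 hy.le)
  filter_upwards [Iio_mem_nhds ha] with y hy
  rw [hz y hy, hz 0 ha]

/-- Spherical means of a locally integrable function on the punctured ball are locally integrable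
in the radius: integrate in polar coordinates over annuli. -/
theorem locallyIntegrableOn_sphereIntegral {F : EuclideanSpace ℝ (Fin n) → ℝ}
    (hF : LocallyIntegrableOn F (unitBall n \ {0})) :
    LocallyIntegrableOn (sphereIntegral F) (Ioo 0 1) := by
  rw [locallyIntegrableOn_iff isOpen_Ioo.isLocallyClosed]
  intro K hK hKc
  obtain ⟨a, b, ha, ha', hb', hb, hKs⟩ := exists_Icc_of_isCompact hKc hK
  refine IntegrableOn.mono_set ?_ (hKs.trans Ioo_subset_Icc_self)
  have h1 := hF.integrableOn_compact_subset (annulus_subset ha hb) (isCompact_annulus (n := n) a b)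
  rw [← integrable_indicator_iff (isCompact_annulus a b).measurableSet] at h1
  have h2 := (integrable_polar h1).1.mono_set (s := Icc a b) fun x hx => ha.trans_le hx.1
  have h3 : IntegrableOn (fun r => r ^ (n - 1) * sphereIntegral F r) (Icc a b) := by
    refine h2.congr_fun (fun r hr => ?_) measurableSet_Icc
    have hr0 : 0 < r := ha.trans_le hr.1
    have : ∀ θ : Metric.sphere (0 : EuclideanSpace ℝ (Fin n)) 1,
        {x : EuclideanSpace ℝ (Fin n) | ‖x‖ ∈ Icc a b}.indicator F (r • θ.1) = F (r • θ.1) :=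
      fun θ => indicator_of_mem (by
        simp only [mem_ofPred_eq, norm_smul_sphere hr0]; exact hr) _
    simp only [sphereIntegral, this]
  have h4 : ContinuousOn (fun r : ℝ => (r ^ (n - 1))⁻¹) (Icc a b) :=
    (continuousOn_pow _).inv₀ fun r hr => pow_ne_zero _ (ha.trans_le hr.1).ne'
  refine (h3.continuousOn_mul h4 isCompact_Icc).congr_fun (fun r hr => ?_) measurableSet_Icc
  have : r ^ (n - 1) ≠ 0 := pow_ne_zero _ (ha.trans_le hr.1).ne'
  simp only
  field_simp

/-- A radial test function sees `F` only through its spherical integrals. -/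
theorem setIntegral_mul_comp_norm [NeZero n] {F : EuclideanSpace ℝ (Fin n) → ℝ}
    (hF : LocallyIntegrableOn F (unitBall n \ {0})) {ψ : ℝ → ℝ} (hψ : Continuous ψ)
    (hc : HasCompactSupport ψ) (hs : tsupport ψ ⊆ Ioo 0 1) :
    ∫ x in unitBall n \ {0}, F x * ψ ‖x‖ =
      ∫ r in Ioo (0 : ℝ) 1, r ^ (n - 1) * sphereIntegral F r * ψ r := by
  obtain ⟨h1, h2, h3⟩ := isTestFunction_comp_norm (n := n) (k := 0) (contDiff_zero.2 hψ) hc hs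
  have hi := integrable_mul_of_compactSupport hF h1.continuous h2 h3
  rw [setIntegral_eq_integral_of_forall_compl_eq_zero (fun x hx => by
    rw [image_eq_zero_of_notMem_tsupport (f := fun x => ψ ‖x‖) fun h => hx (h3 h), mul_zero]),
    integral_polar hi]
  have : ∀ r ∈ Ioi (0 : ℝ), r ^ (n - 1) * sphereIntegral (fun x => F x * ψ ‖x‖) r =
      r ^ (n - 1) * sphereIntegral F r * ψ r := fun r hr => by
    rw [sphereIntegral_mul_radial _ _ hr, mul_assoc]
  rw [setIntegral_congr_fun measurableSet_Ioi this]
  refine setIntegral_eq_of_subset_of_forall_sdiff_eq_zero measurableSet_Ioi Ioo_subset_Ioi_self ?_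
  intro r hr
  rw [image_eq_zero_of_notMem_tsupport fun h => hr.2 (hs h), mul_zero]

end KHessian

namespace KHessian

variable {n : ℕ}

theorem nontrivial_euclidean [NeZero n] : Nontrivial (EuclideanSpace ℝ (Fin n)) :=
  Module.nontrivial_of_finrank_pos (R := ℝ) (by
    rw [finrank_euclideanSpace_fin]; exact Nat.pos_of_ne_zero (NeZero.ne n))

theorem integrableOn_unitBall_comp_norm [NeZero n] {f : ℝ → ℝ} :
    IntegrableOn (fun x : EuclideanSpace ℝ (Fin n) => f ‖x‖) (unitBall n) ↔
      IntegrableOn (fun r => r ^ (n - 1) * f r) (Ioo 0 1) := by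
  have := nontrivial_euclidean (n := n)
  have h := integrableOn_fun_norm_addHaar (volume : Measure (EuclideanSpace ℝ (Fin n))) (f := f)
    (r := 1)
  simp only [finrank_euclideanSpace_fin, smul_eq_mul] at h
  exact h

theorem setIntegral_unitBall_comp_norm [NeZero n] (f : ℝ → ℝ) :
    ∫ x in unitBall n, f ‖x‖ = sphereArea n * ∫ r in Ioo (0 : ℝ) 1, r ^ (n - 1) * f r := by
  have := nontrivial_euclidean (n := n)
  have h := integral_fun_norm_addHaar (volume : Measure (EuclideanSpace ℝ (Fin n)))
    ((Iio 1).indicator f)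
  have e1 : ∀ x : EuclideanSpace ℝ (Fin n),
      (Iio 1).indicator f ‖x‖ = (unitBall n).indicator (fun x => f ‖x‖) x := by
    intro x; simp [indicator, unitBall]
  simp only [e1] at h
  rw [integral_indicator isOpen_unitBall.measurableSet, finrank_euclideanSpace_fin] at h
  rw [h, sphereArea_eq, nsmul_eq_mul, smul_eq_mul, ← mul_assoc]
  congr 1
  have e2 : ∀ r : ℝ, r ^ (n - 1) • (Iio 1).indicator f r =
      (Iio 1).indicator (fun r => r ^ (n - 1) * f r) r := by
    intro r; simp [indicator]
  simp only [e2]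
  rw [setIntegral_indicator measurableSet_Iio, Ioi_inter_Iio]

theorem locallyIntegrableOn_comp_norm [NeZero n] {q : ℝ → ℝ}
    (hq : LocallyIntegrableOn q (Ioo 0 1)) :
    LocallyIntegrableOn (fun x : EuclideanSpace ℝ (Fin n) => q ‖x‖) (unitBall n \ {0}) := by
  rw [locallyIntegrableOn_iff isOpen_puncturedBall.isLocallyClosed]
  intro K hK hKc
  have h1 : IsCompact ((fun x : EuclideanSpace ℝ (Fin n) => ‖x‖) '' K) :=
    hKc.image continuous_norm
  obtain ⟨a, b, ha, ha', hb', hb, hKs⟩ := exists_Icc_of_isCompact h1 (by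
    rintro _ ⟨x, hx, rfl⟩; exact norm_mem_Ioo (hK hx))
  have h2 : IntegrableOn q (Icc a b) :=
    hq.integrableOn_compact_subset (fun r hr => ⟨ha.trans_le hr.1, hr.2.trans_lt hb⟩) isCompact_Icc
  have h3 : IntegrableOn (fun r => r ^ (n - 1) * (Icc a b).indicator q r) (Ioo 0 1) := by
    have h4 : Integrable ((Icc a b).indicator fun r => r ^ (n - 1) * q r) := by
      rw [integrable_indicator_iff measurableSet_Icc]
      exact h2.continuousOn_mul (continuousOn_pow _) isCompact_Icc
    refine h4.integrableOn.congr_fun (fun r _ => ?_) measurableSet_Ioo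
    simp [indicator]
  have h5 := integrableOn_unitBall_comp_norm.2 h3
  have hKm : MeasurableSet K := hKc.measurableSet
  refine (h5.mono_set (s := K) fun x hx => (hK hx).1).congr_fun (fun x hx => ?_) hKm
  exact indicator_of_mem (Ioo_subset_Icc_self (hKs ⟨x, hx, rfl⟩)) q

theorem contDiffOn_norm : ContDiffOn ℝ ∞ (fun x : EuclideanSpace ℝ (Fin n) => ‖x‖)
    (unitBall n \ {0}) := fun _ hx => (contDiffAt_norm ℝ hx.2).contDiffWithinAt

theorem contDiff_coord (i : Fin n) {k : WithTop ℕ∞} :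
    ContDiff ℝ k (fun x : EuclideanSpace ℝ (Fin n) => x i) :=
  (EuclideanSpace.proj i : EuclideanSpace ℝ (Fin n) →L[ℝ] ℝ).contDiff

theorem contDiffOn_coord_mul_norm_zpow (i : Fin n) (m : ℤ) :
    ContDiffOn ℝ ∞ (fun x : EuclideanSpace ℝ (Fin n) => x i * ‖x‖ ^ m) (unitBall n \ {0}) := by
  intro x hx
  have hx' : ‖x‖ ≠ 0 := norm_ne_zero_iff.2 hx.2
  refine ContDiffAt.contDiffWithinAt ((contDiff_coord i).contDiffAt.mul ?_)
  have h1 : ContDiffAt ℝ ∞ (fun r : ℝ => r ^ m) ‖x‖ := by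
    cases m with
    | ofNat k => simpa using (contDiff_id.pow k).contDiffAt
    | negSucc k =>
      simp only [zpow_negSucc]
      exact ((contDiff_id.pow (k + 1)).contDiffAt).inv (pow_ne_zero _ hx')
  exact h1.comp x (contDiffAt_norm ℝ hx.2)

theorem partialDeriv_coord (i j : Fin n) (x : EuclideanSpace ℝ (Fin n)) :
    partialDeriv (fun y => y i) j x = if i = j then 1 else 0 := by
  have h : fderiv ℝ (fun y : EuclideanSpace ℝ (Fin n) => y i) x =
      (EuclideanSpace.proj i : EuclideanSpace ℝ (Fin n) →L[ℝ] ℝ) :=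
    (EuclideanSpace.proj i : EuclideanSpace ℝ (Fin n) →L[ℝ] ℝ).fderiv
  simp [partialDeriv, h]

theorem partialDeriv_coord_mul_norm_zpow (i j : Fin n) (m : ℤ) {x : EuclideanSpace ℝ (Fin n)}
    (hx : x ≠ 0) : partialDeriv (fun y => y i * ‖y‖ ^ m) j x =
      (if i = j then ‖x‖ ^ m else 0) + m * ‖x‖ ^ (m - 2) * (x i * x j) := by
  have hx' : ‖x‖ ≠ 0 := norm_ne_zero_iff.2 hx
  have hd : DifferentiableAt ℝ (fun r : ℝ => r ^ m) ‖x‖ := differentiableAt_zpow.2 (Or.inl hx')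
  have hn : DifferentiableAt ℝ (fun y : EuclideanSpace ℝ (Fin n) => ‖y‖) x :=
    (contDiffAt_norm (n := 1) ℝ hx).differentiableAt (by simp)
  have hg : DifferentiableAt ℝ (fun y : EuclideanSpace ℝ (Fin n) => ‖y‖ ^ m) x := hd.comp x hn
  rw [partialDeriv_mul ((contDiff_coord (k := 1) i).differentiable (by simp) x) hg,
    partialDeriv_comp_norm hx hd, partialDeriv_coord, deriv_zpow, show m - 1 = m - 2 + 1 by ring,
    zpow_add_one₀ hx']
  split_ifs <;> field_simp <;> ring

/-- Integration by parts for a radial `C^1` profile against a test function on the punctured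
ball. -/
theorem integral_radial_primitive_mul_partialDeriv {q : ℝ → ℝ} (hq : Continuous q)
    (c : ℝ) (i : Fin n) {φ : EuclideanSpace ℝ (Fin n) → ℝ}
    (hφ : IsTestFunction ∞ (unitBall n \ {0}) φ) :
    ∫ x in unitBall n \ {0}, (c + ∫ s in (1 / 2)..‖x‖, q s) * partialDeriv φ i x =
      -∫ x in unitBall n \ {0}, q ‖x‖ * (x i / ‖x‖) * φ x := by
  set Q : ℝ → ℝ := fun r => c + ∫ s in (1 / 2)..r, q s with hQ
  have hQd : ∀ r, HasDerivAt Q (q r) r := fun r =>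
    (intervalIntegral.integral_hasDerivAt_right (hq.intervalIntegrable _ _)
      (hq.stronglyMeasurableAtFilter _ _) hq.continuousAt).const_add c
  have hQ1 : ContDiff ℝ 1 Q := by
    rw [contDiff_one_iff_deriv]
    refine ⟨fun r => (hQd r).differentiableAt, ?_⟩
    rwa [show deriv Q = q from funext fun r => (hQd r).deriv]
  have hΩ := isOpen_puncturedBall (n := n)
  have hQc : ContDiffOn ℝ 1 (fun x : EuclideanSpace ℝ (Fin n) => Q ‖x‖) (unitBall n \ {0}) :=
    hQ1.comp_contDiffOn (contDiffOn_norm.of_le (by simp))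
  have hQp : ∀ x : EuclideanSpace ℝ (Fin n), x ≠ 0 →
      partialDeriv (fun y => Q ‖y‖) i x = q ‖x‖ * (x i / ‖x‖) := fun x hx => by
    rw [partialDeriv_comp_norm hx (hQd _).differentiableAt, (hQd _).deriv]
  have hd := continuous_partialDeriv (hφ.1.of_le (by simp)) i
  have hdc : HasCompactSupport (partialDeriv φ i) :=
    hφ.2.1.of_isClosed_subset (isClosed_tsupport _) (tsupport_partialDeriv_subset φ i)
  have i1 := integrable_mul_of_compactSupport (hQc.continuousOn.locallyIntegrableOn
    hΩ.measurableSet) hd hdc ((tsupport_partialDeriv_subset φ i).trans hφ.2.2)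
  have i2 := integrable_mul_of_compactSupport (hQc.continuousOn.locallyIntegrableOn
    hΩ.measurableSet) hφ.1.continuous hφ.2.1 hφ.2.2
  have i3 := integrable_mul_of_compactSupport ((continuousOn_partialDeriv hΩ hQc i
    ).locallyIntegrableOn hΩ.measurableSet) hφ.1.continuous hφ.2.1 hφ.2.2
  have key := integral_mul_fderiv_eq_neg_fderiv_mul_of_integrable
    (f := fun x : EuclideanSpace ℝ (Fin n) => Q ‖x‖) (g := φ) (μ := volume)
    (v := EuclideanSpace.single i 1) i3 i1 i2
    (fun x hx => (hQc.contDiffAt (hΩ.mem_nhds (hφ.2.2 hx))).differentiableAt (by simp))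
    (fun x _ => hφ.1.differentiable (by simp) x)
  rw [setIntegral_eq_integral_of_forall_compl_eq_zero (fun x hx => by
      rw [hφ.partialDeriv_eq_zero i hx, mul_zero]),
    setIntegral_eq_integral_of_forall_compl_eq_zero (fun x hx => by rw [hφ.eq_zero hx, mul_zero])]
  refine key.trans ?_
  congr 2
  ext x
  by_cases hx : x = 0
  · rw [hφ.eq_zero (fun h => h.2 hx), mul_zero, mul_zero]
  · rw [← hQp x hx, partialDeriv]

/-- A radial function whose profile is a primitive of a locally integrable function has the
expected weak gradient on the punctured ball. -/
theorem hasWeakPartialDeriv_radial_primitive [NeZero n] {q : ℝ → ℝ}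
    (hq : LocallyIntegrableOn q (Ioo 0 1)) (c : ℝ) (i : Fin n) :
    HasWeakPartialDeriv (unitBall n \ {0}) i
      (fun x => c + ∫ s in (1 / 2)..‖x‖, q s) (fun x => q ‖x‖ * (x i / ‖x‖)) := by
  have hΩ := isOpen_puncturedBall (n := n)
  have hcont : ContinuousOn (fun x : EuclideanSpace ℝ (Fin n) => c + ∫ s in (1 / 2)..‖x‖, q s)
      (unitBall n \ {0}) :=
    continuousOn_const.add ((continuousOn_primitive_Ioo hq).comp continuous_norm.continuousOn
      fun x hx => norm_mem_Ioo hx)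
  have l1 := hcont.locallyIntegrableOn (μ := volume) hΩ.measurableSet
  have hxc : ContinuousOn (fun x : EuclideanSpace ℝ (Fin n) => x i / ‖x‖) (unitBall n \ {0}) :=
    (contDiff_coord (k := 0) i).continuous.continuousOn.div continuous_norm.continuousOn
      fun x hx => norm_ne_zero_iff.2 hx.2
  have l2 := (locallyIntegrableOn_comp_norm (n := n) hq).mul_continuousOn hxc hΩ.isLocallyClosed
  refine ⟨l1, l2, fun φ hφ => ?_⟩
  have hd := continuous_partialDeriv (hφ.1.of_le (by simp)) i
  have hds := (tsupport_partialDeriv_subset φ i).trans hφ.2.2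
  have hdc : HasCompactSupport (partialDeriv φ i) :=
    hφ.2.1.of_isClosed_subset (isClosed_tsupport _) (tsupport_partialDeriv_subset φ i)
  have i1 := (integrable_mul_of_compactSupport l1 hd hdc hds).integrableOn (s := unitBall n \ {0})
  have i2 := (integrable_mul_of_compactSupport l2 hφ.1.continuous hφ.2.1 hφ.2.2).integrableOn
    (s := unitBall n \ {0})
  obtain ⟨M, hM⟩ := hφ.1.continuous.bounded_above_of_compact_support hφ.2.1
  have hM0 : 0 ≤ M := (norm_nonneg _).trans (hM 0)
  -- the profile only matters on a compact subinterval `[a,b]` of `(0,1)`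
  obtain ⟨a, b, ha, ha', hb', hb, hK⟩ := exists_Icc_of_isCompact (hφ.2.1.image continuous_norm) (by
    rintro _ ⟨x, hx, rfl⟩; exact norm_mem_Ioo (hφ.2.2 hx))
  have hz : ∀ x, ‖x‖ ∉ Ioo a b → φ x = 0 ∧ partialDeriv φ i x = 0 := fun x hx =>
    ⟨image_eq_zero_of_notMem_tsupport fun h => hx (hK ⟨x, h, rfl⟩),
      image_eq_zero_of_notMem_tsupport fun h =>
        hx (hK ⟨x, tsupport_partialDeriv_subset φ i h, rfl⟩)⟩
  have hqi : Integrable ((Icc a b).indicator q) := by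
    rw [integrable_indicator_iff measurableSet_Icc]
    exact hq.integrableOn_compact_subset (fun r hr => ⟨ha.trans_le hr.1, hr.2.trans_lt hb⟩)
      isCompact_Icc
  set D := ∫ x in unitBall n \ {0}, |partialDeriv φ i x| with hD
  have hD0 : 0 ≤ D := integral_nonneg fun _ => abs_nonneg _
  have hA := sphereArea_pos (n := n)
  -- it suffices to bound the defect by an arbitrarily small multiple of a constant
  have main : ∀ δ > 0, |(∫ x in unitBall n \ {0}, (c + ∫ s in (1 / 2)..‖x‖, q s) *
      partialDeriv φ i x) + ∫ x in unitBall n \ {0}, q ‖x‖ * (x i / ‖x‖) * φ x| ≤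
      δ * (D + M * sphereArea n) := by
    intro δ hδ
    obtain ⟨P, -, hPδ, hPc, hPi⟩ := hqi.exists_hasCompactSupport_integral_sub_le hδ
    set h : ℝ → ℝ := fun r => ‖(Icc a b).indicator q r - P r‖ with hh
    have hhi : Integrable h := (hqi.sub hPi).norm
    have hsub : ∀ r ∈ Ioo a b, |(∫ s in (1 / 2)..r, q s) - ∫ s in (1 / 2)..r, P s| ≤ δ := by
      intro r hr
      have hm : uIcc (1 / 2) r ⊆ Icc a b :=
        ordConnected_Icc.uIcc_subset ⟨ha'.le, hb'.le⟩ ⟨hr.1.le, hr.2.le⟩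
      have e1 : ∫ s in (1 / 2)..r, q s = ∫ s in (1 / 2)..r, (Icc a b).indicator q s :=
        intervalIntegral.integral_congr fun s hs => (indicator_of_mem (hm hs) q).symm
      rw [e1, ← intervalIntegral.integral_sub hqi.intervalIntegrable hPi.intervalIntegrable]
      refine (intervalIntegral.norm_integral_le_integral_norm_uIoc (μ := volume) (a := 1 / 2)
        (b := r) (f := fun s => (Icc a b).indicator q s - P s)).trans (le_trans ?_ hPδ)
      exact setIntegral_le_integral hhi (.of_forall fun _ => norm_nonneg _)
    have hP := integral_radial_primitive_mul_partialDeriv (n := n) hPc c i hφ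
    have hcontP : Continuous fun r => ∫ s in (1 / 2)..r, P s :=
      intervalIntegral.continuous_primitive (fun _ _ => hPc.intervalIntegrable _ _) _
    have l3 : LocallyIntegrableOn (fun x : EuclideanSpace ℝ (Fin n) =>
        c + ∫ s in (1 / 2)..‖x‖, P s) (unitBall n \ {0}) :=
      (continuous_const.add (hcontP.comp continuous_norm)).continuousOn.locallyIntegrableOn
        hΩ.measurableSet
    have l4 : LocallyIntegrableOn (fun x : EuclideanSpace ℝ (Fin n) => P ‖x‖ * (x i / ‖x‖))
        (unitBall n \ {0}) :=
      ((hPc.comp continuous_norm).continuousOn.mul hxc).locallyIntegrableOn hΩ.measurableSet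
    have i3 := (integrable_mul_of_compactSupport l3 hd hdc hds).integrableOn
      (s := unitBall n \ {0})
    have i4 := (integrable_mul_of_compactSupport l4 hφ.1.continuous hφ.2.1 hφ.2.2).integrableOn
      (s := unitBall n \ {0})
    have e : (∫ x in unitBall n \ {0}, (c + ∫ s in (1 / 2)..‖x‖, q s) * partialDeriv φ i x) +
        ∫ x in unitBall n \ {0}, q ‖x‖ * (x i / ‖x‖) * φ x =
        ∫ x in unitBall n \ {0}, (((c + ∫ s in (1 / 2)..‖x‖, q s) * partialDeriv φ i x +
          q ‖x‖ * (x i / ‖x‖) * φ x) - ((c + ∫ s in (1 / 2)..‖x‖, P s) * partialDeriv φ i x +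
          P ‖x‖ * (x i / ‖x‖) * φ x)) := by
      refine Eq.trans ?_ (integral_sub (i1.add i2) (i3.add i4)).symm
      rw [integral_add' i1 i2, integral_add' i3 i4, hP]
      ring
    have hhr : IntegrableOn (fun r => r ^ (n - 1) * h r) (Ioo 0 1) :=
      ((hhi.integrableOn (s := Icc 0 1)).continuousOn_mul (continuousOn_pow _)
        isCompact_Icc).mono_set Ioo_subset_Icc_self
    have hhb := (integrableOn_unitBall_comp_norm (n := n)).2 hhr
    have hDi : IntegrableOn (fun x => |partialDeriv φ i x|) (unitBall n \ {0}) :=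
      (hd.integrable_of_hasCompactSupport hdc).abs.integrableOn
    rw [e, ← Real.norm_eq_abs]
    refine (norm_integral_le_of_norm_le (g := fun x => δ * |partialDeriv φ i x| + M * h ‖x‖)
      ((hDi.const_mul δ).add ((hhb.mono_set sdiff_subset).const_mul M)) ?_).trans ?_
    · rw [ae_restrict_iff' hΩ.measurableSet]
      refine .of_forall fun x hx => ?_
      by_cases hr : ‖x‖ ∈ Ioo a b
      · have h1 := hsub _ hr
        have h2 : h ‖x‖ = |q ‖x‖ - P ‖x‖| := by
          simp only [hh, indicator_of_mem (Ioo_subset_Icc_self hr), Real.norm_eq_abs]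
        have h3 : |x i / ‖x‖| ≤ 1 := by
          rw [abs_div, abs_norm]
          exact div_le_one_of_le₀ (PiLp.norm_apply_le x i) (norm_nonneg _)
        have h4 : |φ x| ≤ M := hM x
        have e3 : ((c + ∫ s in (1 / 2)..‖x‖, q s) * partialDeriv φ i x +
          q ‖x‖ * (x i / ‖x‖) * φ x) - ((c + ∫ s in (1 / 2)..‖x‖, P s) * partialDeriv φ i x +
          P ‖x‖ * (x i / ‖x‖) * φ x) =
          ((∫ s in (1 / 2)..‖x‖, q s) - ∫ s in (1 / 2)..‖x‖, P s) * partialDeriv φ i x +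
          (q ‖x‖ - P ‖x‖) * ((x i / ‖x‖) * φ x) := by ring
        rw [e3, h2, Real.norm_eq_abs]
        refine (abs_add_le _ _).trans (add_le_add ?_ ?_)
        · rw [abs_mul]
          exact mul_le_mul_of_nonneg_right h1 (abs_nonneg _)
        · rw [abs_mul, abs_mul, mul_comm M]
          refine mul_le_mul_of_nonneg_left ?_ (abs_nonneg _)
          calc |x i / ‖x‖| * |φ x| ≤ 1 * M := mul_le_mul h3 h4 (abs_nonneg _) zero_le_one
            _ = M := one_mul M
      · rw [(hz x hr).1, (hz x hr).2]
        simp only [mul_zero, add_zero, sub_zero, norm_zero, abs_zero, zero_add]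
        exact mul_nonneg hM0 (norm_nonneg _)
    · rw [integral_add (hDi.const_mul δ) ((hhb.mono_set sdiff_subset).const_mul M),
        integral_const_mul, integral_const_mul, ← hD, restrict_puncturedBall,
        setIntegral_unitBall_comp_norm, mul_add]
      refine add_le_add le_rfl ?_
      have h5 : ∫ r in Ioo (0 : ℝ) 1, r ^ (n - 1) * h r ≤ δ := by
        refine le_trans ?_ hPδ
        refine (setIntegral_mono_on hhr hhi.integrableOn measurableSet_Ioo fun r hr => ?_).trans
          (setIntegral_le_integral hhi (.of_forall fun _ => norm_nonneg _))
        exact mul_le_of_le_one_left (norm_nonneg _) (pow_le_one₀ hr.1.le hr.2.le)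
      calc M * (sphereArea n * ∫ r in Ioo (0 : ℝ) 1, r ^ (n - 1) * h r)
          ≤ M * (sphereArea n * δ) := by gcongr
        _ = δ * (M * sphereArea n) := by ring
  have hzero : |(∫ x in unitBall n \ {0}, (c + ∫ s in (1 / 2)..‖x‖, q s) *
      partialDeriv φ i x) + ∫ x in unitBall n \ {0}, q ‖x‖ * (x i / ‖x‖) * φ x| ≤ 0 := by
    refine le_of_forall_pos_le_add fun ε hε => ?_
    have hpos : 0 < D + M * sphereArea n + 1 := by positivity
    refine (main (ε / (D + M * sphereArea n + 1)) (by positivity)).trans ?_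
    rw [zero_add, div_mul_eq_mul_div, div_le_iff₀ hpos]
    nlinarith
  exact eq_neg_of_add_eq_zero_left (abs_nonpos_iff.1 hzero)

/-- A radial function with weak partial derivatives on the punctured ball has an absolutely
continuous profile, and its weak gradient is the radial one. -/
theorem exists_radial_weak_gradient [NeZero n] {f : ℝ → ℝ}
    {F : Fin n → EuclideanSpace ℝ (Fin n) → ℝ}
    (h : ∀ i, HasWeakPartialDeriv (unitBall n \ {0}) i (fun x => f ‖x‖) (F i)) :
    ∃ (q : ℝ → ℝ) (c : ℝ), LocallyIntegrableOn q (Ioo 0 1) ∧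
      (∀ᵐ r ∂(volume.restrict (Ioo (0 : ℝ) 1)), f r = c + ∫ s in (1 / 2)..r, q s) ∧
      ∀ i, ∀ᵐ x ∂(volume.restrict (unitBall n \ {0})), F i x = q ‖x‖ * (x i / ‖x‖) := by
  have hΩ := isOpen_puncturedBall (n := n)
  have hA := (sphereArea_pos (n := n)).ne'
  have hf : LocallyIntegrableOn (fun x : EuclideanSpace ℝ (Fin n) => f ‖x‖) (unitBall n \ {0}) :=
    (h ⟨0, Nat.pos_of_ne_zero (NeZero.ne n)⟩).1
  have hfl : LocallyIntegrableOn f (Ioo 0 1) := by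
    have h1 := (locallyIntegrableOn_sphereIntegral hf).smul (sphereArea n)⁻¹
    refine h1.congr ?_
    rw [Filter.EventuallyEq, ae_restrict_iff' measurableSet_Ioo]
    refine .of_forall fun r hr => ?_
    simp only [Pi.smul_apply, smul_eq_mul, sphereIntegral_radial f hr.1]
    field_simp
  have hpc : ∀ m : ℤ, ContinuousOn (fun x : EuclideanSpace ℝ (Fin n) => ‖x‖ ^ m)
      (unitBall n \ {0}) := fun m =>
    continuous_norm.continuousOn.zpow₀ m fun x hx => Or.inl (norm_ne_zero_iff.2 hx.2)
  have hxc : ∀ i, ContinuousOn (fun x : EuclideanSpace ℝ (Fin n) => x i / ‖x‖)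
      (unitBall n \ {0}) := fun i =>
    (contDiff_coord (k := 0) i).continuous.continuousOn.div continuous_norm.continuousOn
      fun x hx => norm_ne_zero_iff.2 hx.2
  -- the radial component of the weak gradient, averaged over spheres, is the derivative
  set N : EuclideanSpace ℝ (Fin n) → ℝ := fun x => ∑ i, F i x * (x i / ‖x‖) with hN
  have hNl : LocallyIntegrableOn N (unitBall n \ {0}) := by
    rw [locallyIntegrableOn_iff hΩ.isLocallyClosed]
    intro K hK hKc
    refine integrable_finsetSum _ fun i _ => ?_
    exact ((h i).2.1.mul_continuousOn (hxc i) hΩ.isLocallyClosed).integrableOn_compact_subset hK hKc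
  set q : ℝ → ℝ := fun r => sphereIntegral N r / sphereArea n with hq
  have hql : LocallyIntegrableOn q (Ioo 0 1) := by
    have h1 := (locallyIntegrableOn_sphereIntegral hNl).smul (sphereArea n)⁻¹
    refine h1.congr (.of_forall fun r => ?_)
    simp only [Pi.smul_apply, smul_eq_mul, hq]
    field_simp
  have hnorm : ∀ x : EuclideanSpace ℝ (Fin n), ∑ i, x i * x i = ‖x‖ ^ 2 := fun x => by
    rw [EuclideanSpace.real_norm_sq_eq]
    exact Finset.sum_congr rfl fun i _ => (sq (x i)).symm
  have hn1 : ∀ r : ℝ, 0 < r → r ^ (n - 1) * r ^ (1 - (n : ℤ)) = 1 := fun r hr => by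
    have hcast : ((n - 1 : ℕ) : ℤ) = (n : ℤ) - 1 := by
      rw [Nat.cast_sub (Nat.pos_of_ne_zero (NeZero.ne n))]; simp
    rw [← zpow_natCast, hcast, ← zpow_add₀ hr.ne']
    simp
  obtain ⟨c, hc⟩ := exists_ae_eq_primitive hfl hql (by
    intro ψ h1 h2 h3
    obtain ht := isTestFunction_comp_norm (n := n) h1 h2 h3
    have hd : Continuous (deriv ψ) := h1.continuous_deriv (by simp)
    have hd3 : tsupport (deriv ψ) ⊆ Ioo 0 1 := (tsupport_deriv_subset (𝕜 := ℝ)).trans h3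
    have lA : LocallyIntegrableOn (fun x : EuclideanSpace ℝ (Fin n) =>
        f ‖x‖ * ‖x‖ ^ (1 - (n : ℤ))) (unitBall n \ {0}) :=
      hf.mul_continuousOn (hpc _) hΩ.isLocallyClosed
    have lB : LocallyIntegrableOn (fun x => N x * ‖x‖ ^ (1 - (n : ℤ))) (unitBall n \ {0}) :=
      hNl.mul_continuousOn (hpc _) hΩ.isLocallyClosed
    have eA := setIntegral_mul_comp_norm lA hd h2.deriv hd3
    have eB := setIntegral_mul_comp_norm lB h1.continuous h2 h3
    have eA' : ∫ x in unitBall n \ {0}, f ‖x‖ * ‖x‖ ^ (1 - (n : ℤ)) * deriv ψ ‖x‖ =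
        sphereArea n * ∫ r in Ioo (0 : ℝ) 1, f r * deriv ψ r := by
      rw [eA, ← integral_const_mul]
      refine setIntegral_congr_fun measurableSet_Ioo fun r hr => ?_
      have := sphereIntegral_radial (n := n) (fun r => f r * r ^ (1 - (n : ℤ))) hr.1
      rw [this]
      linear_combination (sphereArea n * f r * deriv ψ r) * hn1 r hr.1
    have eB' : ∫ x in unitBall n \ {0}, N x * ‖x‖ ^ (1 - (n : ℤ)) * ψ ‖x‖ =
        sphereArea n * ∫ r in Ioo (0 : ℝ) 1, q r * ψ r := by
      rw [eB, ← integral_const_mul]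
      refine setIntegral_congr_fun measurableSet_Ioo fun r hr => ?_
      have := sphereIntegral_mul_radial N (fun r => r ^ (1 - (n : ℤ))) hr.1
      have hqr : sphereArea n * q r = sphereIntegral N r := by
        simp only [hq]; field_simp
      rw [this]
      linear_combination (sphereIntegral N r * ψ r) * hn1 r hr.1 - ψ r * hqr
    have hm := fun i => contDiffOn_coord_mul_norm_zpow (n := n) i (-n)
    have hw := fun i => (h i).mul_smooth hΩ (hm i)
    have key := fun i => (hw i).2.2 _ ht
    have sumkey := Finset.sum_congr (rfl : (Finset.univ : Finset (Fin n)) = Finset.univ)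
      fun i _ => key i
    rw [Finset.sum_neg_distrib, ← integral_finsetSum, ← integral_finsetSum] at sumkey
    · have e1 : ∫ x in unitBall n \ {0}, f ‖x‖ * ‖x‖ ^ (1 - (n : ℤ)) * deriv ψ ‖x‖ =
          -∫ x in unitBall n \ {0}, N x * ‖x‖ ^ (1 - (n : ℤ)) * ψ ‖x‖ := by
        convert sumkey using 1
        · refine setIntegral_congr_fun hΩ.measurableSet fun x hx => ?_
          have hx0 : x ≠ 0 := hx.2
          have hx1 : ‖x‖ ≠ 0 := norm_ne_zero_iff.2 hx0
          have hz : ‖x‖ ^ (1 - (n : ℤ)) = ‖x‖ * ‖x‖ ^ (-(n : ℤ)) := by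
            rw [sub_eq_add_neg, zpow_add₀ hx1, zpow_one]
          simp only
          have : ∀ i, f ‖x‖ * (x i * ‖x‖ ^ (-(n : ℤ))) * partialDeriv (fun x => ψ ‖x‖) i x =
              (f ‖x‖ * ‖x‖ ^ (-(n : ℤ)) * deriv ψ ‖x‖ / ‖x‖) * (x i * x i) := fun i => by
            rw [partialDeriv_comp_norm hx0 (h1.differentiable (by simp) _)]
            ring
          rw [Finset.sum_congr rfl fun i _ => this i, ← Finset.mul_sum, hnorm, hz]
          field_simp
        · congr 1
          refine setIntegral_congr_fun hΩ.measurableSet fun x hx => ?_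
          have hx0 : x ≠ 0 := hx.2
          have hx1 : ‖x‖ ≠ 0 := norm_ne_zero_iff.2 hx0
          have hz : ‖x‖ ^ (1 - (n : ℤ)) = ‖x‖ * ‖x‖ ^ (-(n : ℤ)) := by
            rw [sub_eq_add_neg, zpow_add₀ hx1, zpow_one]
          have hz2 : ‖x‖ ^ (-(n : ℤ) - 2) = ‖x‖ ^ (-(n : ℤ)) / ‖x‖ ^ 2 := by
            rw [zpow_sub₀ hx1]; norm_cast
          have : ∀ i, (F i x * (x i * ‖x‖ ^ (-(n : ℤ))) + f ‖x‖ *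
              partialDeriv (fun x => x i * ‖x‖ ^ (-(n : ℤ))) i x) * ψ ‖x‖ =
              (F i x * (x i / ‖x‖)) * (‖x‖ * ‖x‖ ^ (-(n : ℤ)) * ψ ‖x‖) +
              f ‖x‖ * ‖x‖ ^ (-(n : ℤ)) * ψ ‖x‖ - f ‖x‖ * n * (‖x‖ ^ (-(n : ℤ)) / ‖x‖ ^ 2) *
                ψ ‖x‖ * (x i * x i) := fun i => by
            rw [partialDeriv_coord_mul_norm_zpow i i _ hx0, if_pos rfl, hz2]
            push_cast
            field_simp
            ring
          simp only
          rw [Finset.sum_congr rfl fun i _ => this i, Finset.sum_sub_distrib,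
            Finset.sum_add_distrib, ← Finset.sum_mul, Finset.sum_const, Finset.card_univ,
            Fintype.card_fin, nsmul_eq_mul, ← Finset.mul_sum (f := fun i => x i * x i), hnorm, hz,
            show ∑ i, F i x * (x i / ‖x‖) = N x from rfl]
          field_simp
          ring
      rw [eA', eB', ← mul_neg] at e1
      exact mul_left_cancel₀ hA e1
    · intro i _
      exact (integrable_mul_of_compactSupport (hw i).2.1 ht.1.continuous ht.2.1
        ht.2.2).integrableOn
    · intro i _
      exact (integrable_mul_of_compactSupport (hw i).1
        (continuous_partialDeriv (ht.1.of_le (by simp)) i)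
        (ht.2.1.of_isClosed_subset (isClosed_tsupport _) (tsupport_partialDeriv_subset _ i))
        ((tsupport_partialDeriv_subset _ i).trans ht.2.2)).integrableOn)
  refine ⟨q, c, hql, hc, fun i => ?_⟩
  have h1 : ∀ᵐ x : EuclideanSpace ℝ (Fin n) ∂(volume.restrict (unitBall n \ {0})),
      c + ∫ s in (1 / 2)..‖x‖, q s = f ‖x‖ := by
    rw [restrict_puncturedBall]
    filter_upwards [ae_norm_of_ae (n := n) hc] with x hx using hx.symm
  exact (h i).ae_eq hΩ ((hasWeakPartialDeriv_radial_primitive hql c i).congr h1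
    (.of_forall fun _ => rfl))

end KHessian

namespace KHessian

variable {n : ℕ}

/-! ### The Hessian of a radial function -/

/-- The gradient of a radial `u` is `p(|x|) x / |x|`, and the Hessian splits into a multiple of the
identity and a multiple of `x xᵀ`. The profile `p` is obtained in two steps. The radial function `u`
has a weak gradient, so `∇u = P(|x|) x / |x|` for some locally integrable `P`. Then
`P(|x|) = ∑ u_i x_i / |x|` is itself radial with a weak gradient, because `D²u` exists away from the
origin; hence `P` agrees almost everywhere with a continuous function `p`. The coefficient of `x xᵀ`
is only a measurable function of the radius, and nothing is needed about it. -/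
theorem exists_radial_profile [NeZero n] {u : EuclideanSpace ℝ (Fin n) → ℝ}
    {G : EuclideanSpace ℝ (Fin n) → EuclideanSpace ℝ (Fin n)}
    {H : EuclideanSpace ℝ (Fin n) → Matrix (Fin n) (Fin n) ℝ}
    (hu : IsRadial u) (hG : HasWeakGradient (unitBall n) u G)
    (hH : HasWeakHessian (unitBall n \ {0}) G H) :
    ∃ (p q : ℝ → ℝ) (c : ℝ), ContinuousOn p (Ioo 0 1) ∧
      (∀ᵐ x ∂(volume.restrict (unitBall n)), u x = c + ∫ s in (1 / 2)..‖x‖, p s) ∧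
      (∀ i, ∀ᵐ x ∂(volume.restrict (unitBall n)), G x i = p ‖x‖ * (x i / ‖x‖)) ∧
      ∀ i j, ∀ᵐ x ∂(volume.restrict (unitBall n)),
        H x i j = (p ‖x‖ / ‖x‖) * (if i = j then 1 else 0) + q ‖x‖ * (x i * x j) := by
  have hΩ := isOpen_puncturedBall (n := n)
  obtain ⟨w, hw⟩ := hu
  have h1 : ∀ i, HasWeakPartialDeriv (unitBall n \ {0}) i (fun x => w ‖x‖) (fun x => G x i) :=
    fun i => ((hG i).mono sdiff_subset).congr (by rw [restrict_puncturedBall]; exact hw)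
      (.of_forall fun _ => rfl)
  obtain ⟨P, c, hP, hwc, hGP⟩ := exists_radial_weak_gradient h1
  have hnorm : ∀ x : EuclideanSpace ℝ (Fin n), ∑ i, x i * x i = ‖x‖ ^ 2 := fun x => by
    rw [EuclideanSpace.real_norm_sq_eq]
    exact Finset.sum_congr rfl fun i _ => (sq (x i)).symm
  have hm := fun i => contDiffOn_coord_mul_norm_zpow (n := n) i (-1)
  have h2 : ∀ j, HasWeakPartialDeriv (unitBall n \ {0}) j (fun x => P ‖x‖)
      (fun x => ∑ i, (H x i j * (x i * ‖x‖ ^ (-1 : ℤ)) +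
        G x i * partialDeriv (fun x => x i * ‖x‖ ^ (-1 : ℤ)) j x)) := fun j => by
    refine (HasWeakPartialDeriv.sum Finset.univ fun i _ =>
      (hH i j).mul_smooth hΩ (hm i)).congr ?_ (.of_forall fun _ => rfl)
    rw [ae_restrict_iff' hΩ.measurableSet]
    have := ae_all_iff.2 hGP
    rw [ae_restrict_iff' hΩ.measurableSet] at this
    filter_upwards [this] with x hx hxΩ
    have hx1 : ‖x‖ ≠ 0 := norm_ne_zero_iff.2 hxΩ.2
    have : ∀ i, G x i * (x i * ‖x‖ ^ (-1 : ℤ)) = P ‖x‖ / ‖x‖ ^ 2 * (x i * x i) := fun i => by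
      rw [hx hxΩ i, zpow_neg_one]
      field_simp
    rw [Finset.sum_congr rfl fun i _ => this i, ← Finset.mul_sum, hnorm]
    field_simp
  obtain ⟨q, c', hq, hPq, -⟩ := exists_radial_weak_gradient h2
  set p : ℝ → ℝ := fun r => c' + ∫ s in (1 / 2)..r, q s with hp
  have hpc : ContinuousOn p (Ioo 0 1) := continuousOn_const.add (continuousOn_primitive_Ioo hq)
  have hPp : ∀ᵐ x : EuclideanSpace ℝ (Fin n) ∂(volume.restrict (unitBall n)), P ‖x‖ = p ‖x‖ :=
    ae_norm_of_ae hPq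
  have hGp : ∀ i, ∀ᵐ x ∂(volume.restrict (unitBall n)), G x i = p ‖x‖ * (x i / ‖x‖) := fun i => by
    have := hGP i
    rw [restrict_puncturedBall] at this
    filter_upwards [this, hPp] with x h1 h2
    rw [h1, h2]
  refine ⟨p, fun r => q r / r ^ 2 - p r / r ^ 3, c, hpc, ?_, hGp, fun i j => ?_⟩
  · have e : ∀ r ∈ Ioo (0 : ℝ) 1, ∫ s in (1 / 2)..r, P s = ∫ s in (1 / 2)..r, p s := by
      intro r hr
      refine intervalIntegral.integral_congr_ae ?_
      rw [ae_restrict_iff' measurableSet_Ioo] at hPq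
      filter_upwards [hPq] with s hs hs'
      exact hs (ordConnected_Ioo.uIcc_subset ⟨by norm_num, by norm_num⟩ hr (uIoc_subset_uIcc hs'))
    rw [← restrict_puncturedBall] at hw ⊢
    have h3 := ae_norm_of_ae (n := n) hwc
    rw [← restrict_puncturedBall] at h3
    filter_upwards [hw, h3, ae_restrict_mem hΩ.measurableSet] with x h1 h2 h3
    rw [h1, h2, e _ (norm_mem_Ioo h3)]
  · have h3 := (hasWeakPartialDeriv_radial_primitive (n := n) hq c' j).mul_smooth hΩ (hm i)
    have h4 := (hH i j).ae_eq hΩ (h3.congr (f' := fun x => G x i) ?_ (.of_forall fun _ => rfl))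
    · rw [← restrict_puncturedBall]
      filter_upwards [h4, ae_restrict_mem hΩ.measurableSet] with x h5 h6
      have hx1 : ‖x‖ ≠ 0 := norm_ne_zero_iff.2 h6.2
      rw [h5, partialDeriv_coord_mul_norm_zpow i j _ h6.2]
      have hz : ‖x‖ ^ ((-1 : ℤ) - 2) = (‖x‖ ^ 3)⁻¹ := by
        rw [show (-1 : ℤ) - 2 = -(3 : ℕ) by norm_num, zpow_neg, zpow_natCast]
      rw [hz, zpow_neg_one]
      simp only [hp]
      split_ifs <;> push_cast <;> field_simp <;> ring
    · rw [restrict_puncturedBall]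
      filter_upwards [hGp i] with x hx
      rw [hx, zpow_neg_one, div_eq_mul_inv (x i)]

/-! ### Differentiating `S_k` along a rank-one direction -/

/-- The matrix determinant lemma for `β I + t y yᵀ`; the case `β = 0` follows by density. -/
theorem det_scalar_add_rankOne {ι : Type*} [Fintype ι] [DecidableEq ι] (β t : ℝ) (y : ι → ℝ)
    (hι : 1 ≤ Fintype.card ι) :
    (Matrix.of fun i j => β * (if i = j then 1 else 0) + t * (y i * y j)).det =
      β ^ Fintype.card ι + t * β ^ (Fintype.card ι - 1) * ∑ i, y i ^ 2 := by
  have hne : ∀ β : ℝ, β ≠ 0 →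
      (Matrix.of fun i j => β * (if i = j then 1 else 0) + t * (y i * y j)).det =
      β ^ Fintype.card ι + t * β ^ (Fintype.card ι - 1) * ∑ i, y i ^ 2 := by
    intro β hβ
    have h1 : (Matrix.of fun i j => β * (if i = j then 1 else 0) + t * (y i * y j)) =
        β • (1 + Matrix.replicateCol Unit (fun i => t / β * y i) * Matrix.replicateRow Unit y) := by
      ext i j
      simp only [Matrix.of_apply, Matrix.smul_apply, Matrix.add_apply, Matrix.mul_apply,
        Matrix.one_apply, Matrix.replicateCol_apply, Matrix.replicateRow_apply, smul_eq_mul,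
        Finset.univ_unique, Finset.sum_singleton]
      field_simp
    rw [h1, Matrix.det_smul, Matrix.det_one_add_replicateCol_mul_replicateRow]
    obtain ⟨m, hm⟩ : ∃ m, Fintype.card ι = m + 1 := ⟨_, (Nat.sub_add_cancel hι).symm⟩
    rw [hm, Nat.add_sub_cancel]
    have h2 : y ⬝ᵥ (fun i => t / β * y i) = t / β * ∑ i, y i ^ 2 := by
      rw [dotProduct, Finset.mul_sum]
      exact Finset.sum_congr rfl fun i _ => by ring
    rw [h2, pow_succ]
    field_simp
  have hc1 : Continuous fun β : ℝ =>
      (Matrix.of fun i j => β * (if i = j then 1 else 0) + t * (y i * y j)).det := by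
    refine Continuous.matrix_det ?_
    refine continuous_matrix fun i j => ?_
    simp only [Matrix.of_apply]
    fun_prop
  have hc2 : Continuous fun β : ℝ =>
      β ^ Fintype.card ι + t * β ^ (Fintype.card ι - 1) * ∑ i, y i ^ 2 := by fun_prop
  have hd : Dense {β : ℝ | β ≠ 0} := dense_compl_singleton 0
  exact congrFun (hc1.ext_on hd hc2 hne) β

theorem sum_powersetCard_sum {k : ℕ} (hk : 1 ≤ k) (z : Fin n → ℝ) :
    ∑ s ∈ (Finset.univ : Finset (Fin n)).powersetCard k, ∑ i ∈ s, z i =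
      (n - 1).choose (k - 1) * ∑ i, z i := by
  have h1 : ∀ s ∈ (Finset.univ : Finset (Fin n)).powersetCard k,
      ∑ i ∈ s, z i = ∑ i, if i ∈ s then z i else 0 := fun s _ => by
    rw [Finset.sum_ite_mem, Finset.univ_inter]
  rw [Finset.sum_congr rfl h1, Finset.sum_comm, Finset.mul_sum]
  refine Finset.sum_congr rfl fun i _ => ?_
  rw [← Finset.sum_filter, Finset.sum_const, nsmul_eq_mul]
  have h2 := Finset.card_filter_powersetCard_subset ({i} : Finset (Fin n)) Finset.univ k
  simp only [Finset.singleton_subset_iff] at h2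
  rw [h2] <;> simp [hk]

/-- `S_k` is affine in `t` along `β I + t y yᵀ`, since each principal minor is. -/
theorem hessianSum_scalar_add_rankOne {k : ℕ} (hk : 1 ≤ k) (β t : ℝ) (y : Fin n → ℝ) :
    hessianSum k (Matrix.of fun i j => β * (if i = j then 1 else 0) + t * (y i * y j)) =
      n.choose k * β ^ k + t * ((n - 1).choose (k - 1) * β ^ (k - 1) * ∑ i, y i ^ 2) := by
  have h1 : ∀ s ∈ (Finset.univ : Finset (Fin n)).powersetCard k,
      ((Matrix.of fun i j => β * (if i = j then 1 else 0) + t * (y i * y j)).submatrix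
        (fun a : s => (a : Fin n)) (fun a : s => (a : Fin n))).det =
      β ^ k + t * β ^ (k - 1) * ∑ i ∈ s, y i ^ 2 := by
    intro s hs
    have hc : Fintype.card s = k := by
      rw [Fintype.card_coe]; exact (Finset.mem_powersetCard.1 hs).2
    have := det_scalar_add_rankOne (ι := s) β t (fun a => y a) (by rw [hc]; exact hk)
    rw [hc, Finset.sum_coe_sort s fun i => y i ^ 2] at this
    rw [← this]
    congr 1
    ext a b
    simp only [Matrix.submatrix_apply, Matrix.of_apply, Subtype.ext_iff]
  rw [hessianSum, Finset.sum_congr rfl h1, Finset.sum_add_distrib, ← Finset.mul_sum,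
    sum_powersetCard_sum hk]
  simp only [Finset.sum_const, Finset.card_powersetCard, Finset.card_univ, Fintype.card_fin,
    nsmul_eq_mul]
  ring

theorem differentiable_hessianSum (k : ℕ) :
    Differentiable ℝ fun a : Fin n → Fin n → ℝ => hessianSum k (Matrix.of a) := by
  simp only [hessianSum, Matrix.det_apply, Matrix.submatrix_apply, Matrix.of_apply]
  fun_prop

/-- The chain rule along the line `t ↦ A + t y yᵀ`. -/
theorem sum_mul_hessianSumDeriv {k : ℕ} (A : Matrix (Fin n) (Fin n) ℝ) (y : Fin n → ℝ) :
    ∑ i, ∑ j, y i * y j * hessianSumDeriv k A i j =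
      deriv (fun t : ℝ => hessianSum k (A + t • Matrix.of fun i j => y i * y j)) 0 := by
  set S : (Fin n → Fin n → ℝ) → ℝ := fun a => hessianSum k (Matrix.of a) with hS
  set L := fderiv ℝ S (fun i j => A i j) with hL
  have hline : ∀ b : Fin n → Fin n → ℝ,
      deriv (fun t : ℝ => hessianSum k (A + t • Matrix.of b)) 0 = L b := by
    intro b
    have hd : HasDerivAt (fun t : ℝ => (fun i j => A i j) + t • b) b 0 := by
      simpa using ((hasDerivAt_id (0 : ℝ)).smul_const b).const_add (fun i j => A i j)
    have h0 : (fun i j => A i j) + (0 : ℝ) • b = fun i j => A i j := by simp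
    have hf : HasFDerivAt S L ((fun i j => A i j) + (0 : ℝ) • b) := by
      rw [h0]; exact (differentiable_hessianSum k _).hasFDerivAt
    exact (hf.comp_hasDerivAt 0 hd).deriv
  have hsingle : ∀ i j, hessianSumDeriv k A i j = L (Pi.single i (Pi.single j 1)) := by
    intro i j
    rw [← hline, hessianSumDeriv]
    congr 2
    ext t
    congr 3
    ext a b
    by_cases h1 : i = a <;> by_cases h2 : j = b <;>
      simp [Matrix.single, h1, h2]
  rw [hline]
  simp only [hsingle, ← smul_eq_mul (a := y _ * y _), ← map_smul, ← map_sum]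
  congr 1
  ext a b
  have h3 : ∀ c, (if a = c then ∑ x, (y c * y x) • (Pi.single x (1 : ℝ) : Fin n → ℝ) else 0) b =
      if a = c then y a * y b else 0 := fun c => by
    split_ifs with h
    · subst h
      simp [Finset.sum_apply, Pi.single_apply]
    · rfl
  simp [Finset.sum_apply, Pi.single_apply, h3]

/-- The quadratic form of `S_k^{ij}` in the direction of `y` does not see the coefficient `γ` of
`y yᵀ`. For a radial Hessian this means that `u''` does not enter. -/
theorem sum_mul_hessianSumDeriv_radial {k : ℕ} (hk : 1 ≤ k) (β γ : ℝ) (y : Fin n → ℝ)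
    {A : Matrix (Fin n) (Fin n) ℝ}
    (hA : ∀ i j, A i j = β * (if i = j then 1 else 0) + γ * (y i * y j)) :
    ∑ i, ∑ j, y i * y j * hessianSumDeriv k A i j =
      (n - 1).choose (k - 1) * β ^ (k - 1) * ∑ i, y i ^ 2 := by
  rw [sum_mul_hessianSumDeriv]
  have h : ∀ t : ℝ, hessianSum k (A + t • Matrix.of fun i j => y i * y j) =
      n.choose k * β ^ k + (γ + t) * ((n - 1).choose (k - 1) * β ^ (k - 1) * ∑ i, y i ^ 2) := by
    intro t
    rw [← hessianSum_scalar_add_rankOne hk]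
    congr 1
    ext i j
    simp only [Matrix.add_apply, Matrix.smul_apply, Matrix.of_apply, smul_eq_mul, hA]
    ring
  simp only [h]
  have hd : HasDerivAt (fun t : ℝ => n.choose k * β ^ k +
      (γ + t) * ((n - 1).choose (k - 1) * β ^ (k - 1) * ∑ i, y i ^ 2))
      (1 * ((n - 1).choose (k - 1) * β ^ (k - 1) * ∑ i, y i ^ 2)) 0 :=
    (((hasDerivAt_id (0 : ℝ)).const_add γ).mul_const _).const_add _
  rw [hd.deriv, one_mul]

end KHessian

namespace KHessian

variable {n k : ℕ}

/-! ### Reduction to the radial variable -/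

/-- The coefficient `S_k^{ij}(D²u) x_i x_j / |x|²` in units of `(u'/r)^{k-1}`. -/
noncomputable def hessianConst (n k : ℕ) : ℝ := (n - 1).choose (k - 1)

theorem hessianConst_pos (hkn : k ≤ n) : 0 < hessianConst n k :=
  Nat.cast_pos.2 (Nat.choose_pos (Nat.sub_le_sub_right hkn 1))

/-- The form `S_k^{ij}(D²u) a_i b_j` for two radial vectors `a`, `b`. -/
theorem sum_radial_hessianSumDeriv (hk : 1 ≤ k) {A : Matrix (Fin n) (Fin n) ℝ} {β γ : ℝ}
    {x : EuclideanSpace ℝ (Fin n)} (hx : x ≠ 0)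
    (hA : ∀ i j, A i j = β * (if i = j then 1 else 0) + γ * (x i * x j))
    {a b : Fin n → ℝ} {s t : ℝ} (ha : ∀ i, a i = s * (x i / ‖x‖)) (hb : ∀ i, b i = t * (x i / ‖x‖)) :
    ∑ i, ∑ j, a i * b j * hessianSumDeriv k A i j = hessianConst n k * β ^ (k - 1) * (s * t) := by
  have hx1 : ‖x‖ ≠ 0 := norm_ne_zero_iff.2 hx
  have h1 := sum_mul_hessianSumDeriv_radial hk β γ x hA
  rw [← EuclideanSpace.real_norm_sq_eq] at h1
  have h2 : ∀ i j, a i * b j * hessianSumDeriv k A i j =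
      s * t / ‖x‖ ^ 2 * (x i * x j * hessianSumDeriv k A i j) := fun i j => by
    rw [ha, hb]; field_simp
  simp only [h2, ← Finset.mul_sum]
  rw [h1, hessianConst]
  field_simp

theorem pow_sub_one_mul_div_pow (hk : 1 ≤ k) (hkn : k ≤ n) {r : ℝ} (hr : 0 < r) (s : ℝ) :
    r ^ (n - 1) * (s / r) ^ (k - 1) = r ^ (n - k) * s ^ (k - 1) := by
  have : n - 1 = (n - k) + (k - 1) := by omega
  rw [this, pow_add, div_pow]
  have : r ^ (k - 1) ≠ 0 := pow_ne_zero _ hr.ne'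
  field_simp

theorem pow_sub_one_mul_self (hk : 1 ≤ k) (s : ℝ) : s ^ (k - 1) * s = s ^ k := by
  rw [← pow_succ, Nat.sub_add_cancel hk]

/-- A profile that is constant near the origin and vanishes near `1` gives a test function on the
whole ball. -/
theorem isTestFunction_comp_norm_of_const {m : WithTop ℕ∞} {ψ : ℝ → ℝ} (hψ : ContDiff ℝ m ψ)
    {a b : ℝ} (ha : 0 < a) (hb : b < 1) (h0 : ∀ r < a, ψ r = ψ 0) (h1 : ∀ r, b ≤ r → ψ r = 0) :
    IsTestFunction m (unitBall n) (fun x => ψ ‖x‖) := by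
  have hs : Function.support (fun x : EuclideanSpace ℝ (Fin n) => ψ ‖x‖) ⊆
      Metric.closedBall 0 b := by
    intro x hx
    rw [mem_closedBall_zero_iff]
    by_contra h
    exact hx (h1 _ (not_le.1 h).le)
  have hts : tsupport (fun x : EuclideanSpace ℝ (Fin n) => ψ ‖x‖) ⊆ Metric.closedBall 0 b :=
    closure_minimal hs Metric.isClosed_closedBall
  refine ⟨contDiff_comp_norm hψ ?_, HasCompactSupport.of_support_subset_isCompact
    (isCompact_closedBall _ _) hs, hts.trans (Metric.closedBall_subset_ball hb)⟩
  filter_upwards [Iio_mem_nhds ha] with y hy using h0 y hy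

/-- The profile `p = u'` of a radial weak solution: it is continuous, satisfies the integrated
equation, has finite energy, and the radial part of the second variation is nonnegative. No sign
of `p` is asserted. -/
structure IsRadialProfile (n k : ℕ) (g v p : ℝ → ℝ) : Prop where
  continuousOn : ContinuousOn p (Ioo 0 1)
  hasDerivAt : ∀ r ∈ Ioo (0 : ℝ) 1, HasDerivAt v (p r) r
  integrable_rhs : IntegrableOn (fun r => r ^ (n - 1) * g (v r)) (Ioo 0 1)
  flux : ∀ r ∈ Ioo (0 : ℝ) 1, r ^ (n - k) * p r ^ k =
    k / hessianConst n k * ∫ s in (0 : ℝ)..r, s ^ (n - 1) * g (v s)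
  energy : IntegrableOn (fun r => r ^ (n - k) * p r ^ (k + 1)) (Ioo 0 1)
  stable : ∀ ψ : ℝ → ℝ, ContDiff ℝ 1 ψ → HasCompactSupport ψ → tsupport ψ ⊆ Ioo 0 1 →
    IntegrableOn (fun r => hessianConst n k * (r ^ (n - k) * p r ^ (k - 1)) * deriv ψ r ^ 2 +
      r ^ (n - 1) * (deriv g (v r) * ψ r ^ 2)) (Ioo 0 1) ∧
    0 ≤ ∫ r in Ioo (0 : ℝ) 1, (hessianConst n k * (r ^ (n - k) * p r ^ (k - 1)) * deriv ψ r ^ 2 +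
      r ^ (n - 1) * (deriv g (v r) * ψ r ^ 2))

theorem integrableOn_of_unitBall_ae_eq [NeZero n] {F : EuclideanSpace ℝ (Fin n) → ℝ} {f : ℝ → ℝ}
    (hF : IntegrableOn F (unitBall n))
    (h : ∀ᵐ x ∂(volume.restrict (unitBall n)), F x = f ‖x‖) :
    IntegrableOn (fun r => r ^ (n - 1) * f r) (Ioo 0 1) :=
  integrableOn_unitBall_comp_norm.1 (hF.congr h)

theorem setIntegral_of_unitBall_ae_eq [NeZero n] {F : EuclideanSpace ℝ (Fin n) → ℝ} {f : ℝ → ℝ}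
    (h : ∀ᵐ x ∂(volume.restrict (unitBall n)), F x = f ‖x‖) :
    ∫ x in unitBall n, F x = sphereArea n * ∫ r in Ioo (0 : ℝ) 1, r ^ (n - 1) * f r := by
  rw [integral_congr_ae h, setIntegral_unitBall_comp_norm]

/-- A continuous flux with integrable weak derivative `h`, tested also against functions that
do not vanish at the origin, is `∫₀ʳ h`: the constant of integration is zero. -/
theorem eq_primitive_of_weak_equation {w h : ℝ → ℝ} (hw : ContinuousOn w (Ioo 0 1))
    (hh : IntegrableOn h (Ioo 0 1))
    (heq : ∀ (ψ : ℝ → ℝ) (a b : ℝ), ContDiff ℝ ∞ ψ → 0 < a → b < 1 → (∀ r < a, ψ r = ψ 0) →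
      (∀ r, b ≤ r → ψ r = 0) →
      ∫ r in Ioo (0 : ℝ) 1, w r * deriv ψ r = -∫ r in Ioo (0 : ℝ) 1, h r * ψ r) :
    ∀ r ∈ Ioo (0 : ℝ) 1, w r = ∫ s in (0 : ℝ)..r, h s := by
  have hwl : LocallyIntegrableOn w (Ioo 0 1) := hw.locallyIntegrableOn measurableSet_Ioo
  obtain ⟨c, hc⟩ := exists_ae_eq_primitive hwl hh.locallyIntegrableOn (by
    intro ψ h1 h2 h3
    obtain ⟨a, b, ha, ha', hb', hb, hK⟩ := exists_Icc_of_isCompact h2 h3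
    have hz : ∀ r, r ∉ Ioo a b → ψ r = 0 := fun r hr =>
      image_eq_zero_of_notMem_tsupport fun h => hr (hK h)
    refine heq ψ a b h1 ha hb (fun r hr => ?_) fun r hr => hz r fun h => absurd h.2 (not_lt.2 hr)
    rw [hz r fun h => absurd h.1 (not_lt.2 hr.le), hz 0 fun h => absurd h.1 (not_lt.2 ha.le)])
  have hi : IntervalIntegrable h volume 0 1 := by
    rw [intervalIntegrable_iff_integrableOn_Ioo_of_le zero_le_one]; exact hh
  have hsub : ∀ r ∈ Icc (0 : ℝ) 1, ∀ s ∈ Icc (0 : ℝ) 1, IntervalIntegrable h volume r s :=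
    fun r hr s hs => hi.mono_set (by
      rw [uIcc_of_le zero_le_one]; exact ordConnected_Icc.uIcc_subset hr hs)
  set C := c + ∫ s in (1 / 2 : ℝ)..0, h s with hC
  set F : ℝ → ℝ := fun r => ∫ s in (0 : ℝ)..r, h s with hF
  have hFac : AbsolutelyContinuousOnInterval F 0 1 :=
    hi.absolutelyContinuousOnInterval_intervalIntegral (by simp)
  have hFc : ContinuousOn F (Icc 0 1) := by
    have := hFac.continuousOn
    rwa [uIcc_of_le zero_le_one] at this
  have hwF : EqOn w (fun r => C + F r) (Ioo 0 1) := by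
    refine Measure.eqOn_open_of_ae_eq (μ := volume) ?_ isOpen_Ioo hw
      (continuousOn_const.add (hFc.mono Ioo_subset_Icc_self))
    filter_upwards [hc, ae_restrict_mem measurableSet_Ioo] with r hr hr'
    rw [hr, hC, hF, add_assoc, intervalIntegral.integral_add_adjacent_intervals]
    · exact hsub _ ⟨by norm_num, by norm_num⟩ _ ⟨le_rfl, zero_le_one⟩
    · exact hsub _ ⟨le_rfl, zero_le_one⟩ _ (Ioo_subset_Icc_self hr')
  -- a cutoff equal to `1` near the origin detects the constant
  set ψ : ℝ → ℝ := fun r => Real.smoothTransition (2 * (3 / 4 - r)) with hψ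
  have hψc : ContDiff ℝ ∞ ψ := Real.smoothTransition.contDiff.comp
    (contDiff_const.mul (contDiff_const.sub contDiff_id))
  have hψ0 : ∀ r ≤ 1 / 4, ψ r = 1 := fun r hr =>
    Real.smoothTransition.one_of_one_le (by linarith)
  have hψ1 : ∀ r, 3 / 4 ≤ r → ψ r = 0 := fun r hr =>
    Real.smoothTransition.zero_of_nonpos (by linarith)
  have key := heq ψ (1 / 4) (3 / 4) hψc (by norm_num) (by norm_num)
    (fun r hr => by rw [hψ0 r hr.le, hψ0 0 (by norm_num)]) hψ1
  have hψac : AbsolutelyContinuousOnInterval ψ 0 1 :=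
    (hψc.of_le (by simp)).contDiffOn.absolutelyContinuousOnInterval
  have hdc : Continuous (deriv ψ) := hψc.continuous_deriv (by simp)
  have e1 : ∫ r in (0 : ℝ)..1, deriv ψ r = -1 := by
    rw [hψac.integral_deriv_eq_sub, hψ1 1 (by norm_num), hψ0 0 (by norm_num)]; norm_num
  have e2 : ∫ r in (0 : ℝ)..1, F r * deriv ψ r = -∫ r in (0 : ℝ)..1, h r * ψ r := by
    rw [hFac.integral_mul_deriv_eq_deriv_mul hψac, hψ1 1 (by norm_num)]
    have : F 0 = 0 := by simp [hF]
    rw [this]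
    simp only [mul_zero, zero_mul, sub_zero, zero_sub, neg_inj]
    apply intervalIntegral.integral_congr_ae
    filter_upwards [hi.ae_hasDerivAt_integral] with x hx hx'
    rw [(hx (uIoc_subset_uIcc hx') 0 (by simp)).deriv]
  have e3 : ∫ r in Ioo (0 : ℝ) 1, w r * deriv ψ r =
      C * (∫ r in (0 : ℝ)..1, deriv ψ r) + ∫ r in (0 : ℝ)..1, F r * deriv ψ r := by
    rw [← intervalIntegral.integral_const_mul, ← intervalIntegral.integral_add,
      intervalIntegral.integral_of_le zero_le_one, integral_Ioc_eq_integral_Ioo]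
    · refine setIntegral_congr_fun measurableSet_Ioo fun r hr => ?_
      rw [hwF hr]; ring
    · exact (continuous_const.mul hdc).intervalIntegrable _ _
    · refine ContinuousOn.intervalIntegrable ?_
      rw [uIcc_of_le zero_le_one]
      exact hFc.mul hdc.continuousOn
  have e4 : ∫ r in Ioo (0 : ℝ) 1, h r * ψ r = ∫ r in (0 : ℝ)..1, h r * ψ r := by
    rw [intervalIntegral.integral_of_le zero_le_one, integral_Ioc_eq_integral_Ioo]
  have hC0 : C = 0 := by
    rw [e3, e1, e2, e4] at key
    linarith
  intro r hr
  rw [hwF hr, hC0]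
  exact zero_add _

/-- In polar coordinates, with radial test functions, the weak formulation becomes the
one-dimensional problem `IsRadialProfile`. -/
theorem exists_isRadialProfile [NeZero n] (hk : 1 ≤ k) (hkn : k ≤ n) {g : ℝ → ℝ}
    {u : EuclideanSpace ℝ (Fin n) → ℝ}
    {G : EuclideanSpace ℝ (Fin n) → EuclideanSpace ℝ (Fin n)}
    {H : EuclideanSpace ℝ (Fin n) → Matrix (Fin n) (Fin n) ℝ}
    (hG : HasWeakGradient (unitBall n) u G)
    (hH : HasWeakHessian (unitBall n \ {0}) G H) (hu : IsRadial u)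
    (hsol : IsWeakSolution k g u G H) (hst : IsSemistable k g u H) :
    ∃ v p : ℝ → ℝ, IsRadialProfile n k g v p ∧
      (∀ᵐ x ∂(volume.restrict (unitBall n)), u x = v ‖x‖) ∧
      (∀ᵐ x ∂(volume.restrict (unitBall n)), ‖G x‖ = |p ‖x‖|) := by
  obtain ⟨p, q, c, hp, huv, hGp, hHp⟩ := exists_radial_profile hu hG hH
  set v : ℝ → ℝ := fun r => c + ∫ s in (1 / 2)..r, p s with hv
  have hc0 := hessianConst_pos hkn
  have hA := sphereArea_pos (n := n)
  have hGa := ae_all_iff.2 hGp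
  have hHa := ae_all_iff.2 fun i => ae_all_iff.2 fun j => hHp i j
  have hpl : LocallyIntegrableOn p (Ioo 0 1) := hp.locallyIntegrableOn measurableSet_Ioo
  have hne : ∀ᵐ x ∂(volume.restrict (unitBall n)), x ∈ unitBall n \ {0} := by
    rw [← restrict_puncturedBall]; exact ae_restrict_mem isOpen_puncturedBall.measurableSet
  have hvd : ∀ r ∈ Ioo (0 : ℝ) 1, HasDerivAt v (p r) r := fun r hr =>
    (intervalIntegral.integral_hasDerivAt_right
      (intervalIntegrable_of_locallyIntegrableOn_Ioo hpl ⟨by norm_num, by norm_num⟩ hr)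
      (hp.stronglyMeasurableAtFilter isOpen_Ioo r hr)
      (hp.continuousAt (isOpen_Ioo.mem_nhds hr))).const_add c
  have hrhs : IntegrableOn (fun r => r ^ (n - 1) * g (v r)) (Ioo 0 1) :=
    integrableOn_of_unitBall_ae_eq (f := fun r => g (v r)) hsol.integrable_rhs (by
      filter_upwards [huv] with x hx; rw [hx])
  refine ⟨v, p, ⟨hp, hvd, hrhs, ?_, ?_, ?_⟩, huv, ?_⟩
  · have hwc : ContinuousOn (fun r => r ^ (n - k) * p r ^ k) (Ioo 0 1) :=
      (continuousOn_pow _).mul (hp.pow k)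
    have := eq_primitive_of_weak_equation hwc (hrhs.const_mul (k / hessianConst n k)) (by
      intro ψ a b h1 ha hb h2 h3
      have ht := isTestFunction_comp_norm_of_const (n := n) (h1.of_le (m := 1) (by simp)) ha hb h2 h3
      obtain ⟨-, hz⟩ := hsol.equation _ ht
      have hk0 : (k : ℝ) ≠ 0 := Nat.cast_ne_zero.2 (by omega)
      rw [setIntegral_of_unitBall_ae_eq (f := fun r => 1 / (k : ℝ) *
        (hessianConst n k * (p r / r) ^ (k - 1) * (p r * deriv ψ r)) + g (v r) * ψ r)] at hz
      · have hz' := (mul_eq_zero.1 hz).resolve_left hA.ne'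
        -- `ψ'` is supported in a compact subset of `(0,1)`
        have hd : Continuous (deriv ψ) := h1.continuous_deriv (by simp)
        have hds : Function.support (deriv ψ) ⊆ Icc a b := by
          intro r hr
          by_contra h
          apply hr
          rcases lt_or_ge r a with h' | h'
          · have : ψ =ᶠ[nhds r] fun _ => ψ 0 := by
              filter_upwards [Iio_mem_nhds h'] with y hy using h2 y hy
            rw [this.deriv_eq, deriv_const]
          · have hb' : b < r := not_le.1 fun h'' => h ⟨h', h''⟩
            have : ψ =ᶠ[nhds r] fun _ => 0 := by
              filter_upwards [Ioi_mem_nhds hb'] with y hy using h3 y (le_of_lt hy)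
            rw [this.deriv_eq, deriv_const]
        have hdc : HasCompactSupport (deriv ψ) :=
          HasCompactSupport.of_support_subset_isCompact isCompact_Icc hds
        have hdt : tsupport (deriv ψ) ⊆ Ioo 0 1 := (closure_minimal hds isClosed_Icc).trans
          fun r hr => ⟨ha.trans_le hr.1, hr.2.trans_lt hb⟩
        have i1 := LocallyIntegrableOn.integrableOn_mul_compactSupport
          (hwc.locallyIntegrableOn (μ := volume) measurableSet_Ioo) hd hdc hdt
        have i2 : IntegrableOn (fun r => k / hessianConst n k * (r ^ (n - 1) * g (v r)) * ψ r)
            (Ioo 0 1) :=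
          (IntegrableOn.mul_continuousOn_of_subset (hrhs.const_mul (k / hessianConst n k))
            h1.continuous.continuousOn measurableSet_Ioo isCompact_Icc Ioo_subset_Icc_self)
        have e : ∫ r in Ioo (0 : ℝ) 1, (r ^ (n - k) * p r ^ k * deriv ψ r +
            k / hessianConst n k * (r ^ (n - 1) * g (v r)) * ψ r) = 0 := by
          have hz2 := congrArg (fun t => k / hessianConst n k * t) hz'
          simp only [mul_zero, ← integral_const_mul] at hz2
          refine Eq.trans ?_ hz2
          refine setIntegral_congr_fun measurableSet_Ioo fun r hr => ?_
          rw [← pow_sub_one_mul_self hk (p r), ← mul_assoc (r ^ (n - k)),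
            ← pow_sub_one_mul_div_pow hk hkn hr.1]
          field_simp
        rw [integral_add i1 i2] at e
        linarith
      · filter_upwards [huv, hGa, hHa, hne] with x h4 h5 h6 h7
        rw [h4, sum_radial_hessianSumDeriv hk h7.2 h6 h5 fun i =>
          partialDeriv_comp_norm h7.2 (h1.differentiable (by simp) _) i])
    intro r hr
    rw [this r hr, intervalIntegral.integral_const_mul]
  · have h1 := integrableOn_of_unitBall_ae_eq (f := fun r =>
      hessianConst n k * (p r / r) ^ (k - 1) * (p r * p r)) hsol.energy (by
        filter_upwards [hGa, hHa, hne] with x h5 h6 h7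
        rw [sum_radial_hessianSumDeriv hk h7.2 h6 h5 h5])
    refine IntegrableOn.congr_fun (h1.const_mul (hessianConst n k)⁻¹) (fun r hr => ?_)
      measurableSet_Ioo
    rw [pow_succ, ← pow_sub_one_mul_self hk (p r)]
    linear_combination (p r * p r) * pow_sub_one_mul_div_pow hk hkn hr.1 (p r) +
      (r ^ (n - 1) * (p r / r) ^ (k - 1) * (p r * p r)) * inv_mul_cancel₀ hc0.ne'
  · intro ψ h1 h2 h3
    obtain ⟨hi, hz⟩ := hst _ (isTestFunction_comp_norm (n := n) h1 h2 h3)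
    have hae : ∀ᵐ x ∂(volume.restrict (unitBall n)), (∑ i, ∑ j, partialDeriv (fun x => ψ ‖x‖) i x *
        partialDeriv (fun x => ψ ‖x‖) j x * hessianSumDeriv k (H x) i j) +
        deriv g (u x) * ψ ‖x‖ ^ 2 = (fun r => hessianConst n k * (p r / r) ^ (k - 1) *
          (deriv ψ r * deriv ψ r) + deriv g (v r) * ψ r ^ 2) ‖x‖ := by
      filter_upwards [huv, hHa, hne] with x h4 h6 h7
      have hd := fun i => partialDeriv_comp_norm h7.2 (h1.differentiable (by simp) ‖x‖) i
      rw [h4, sum_radial_hessianSumDeriv hk h7.2 h6 hd hd]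
    have hpt : ∀ r ∈ Ioo (0 : ℝ) 1, r ^ (n - 1) * (hessianConst n k * (p r / r) ^ (k - 1) *
        (deriv ψ r * deriv ψ r) + deriv g (v r) * ψ r ^ 2) =
        hessianConst n k * (r ^ (n - k) * p r ^ (k - 1)) * deriv ψ r ^ 2 +
          r ^ (n - 1) * (deriv g (v r) * ψ r ^ 2) := fun r hr => by
      rw [← pow_sub_one_mul_div_pow hk hkn hr.1]
      ring
    rw [setIntegral_of_unitBall_ae_eq (f := fun r => hessianConst n k * (p r / r) ^ (k - 1) *
          (deriv ψ r * deriv ψ r) + deriv g (v r) * ψ r ^ 2) hae] at hz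
    exact ⟨(integrableOn_of_unitBall_ae_eq (f := fun r => hessianConst n k * (p r / r) ^ (k - 1) *
          (deriv ψ r * deriv ψ r) + deriv g (v r) * ψ r ^ 2) hi hae).congr_fun hpt measurableSet_Ioo,
      (nonneg_of_mul_nonneg_right hz hA).trans_eq (setIntegral_congr_fun measurableSet_Ioo hpt)⟩
  · filter_upwards [hGa, hne] with x h5 h7
    have hx1 : ‖x‖ ≠ 0 := norm_ne_zero_iff.2 h7.2
    have : G x = (p ‖x‖ / ‖x‖) • x := by
      ext i
      rw [h5, PiLp.smul_apply, smul_eq_mul]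
      ring
    rw [this, norm_smul, norm_div, norm_norm, Real.norm_eq_abs]
    field_simp

end KHessian

namespace KHessian

variable {n k : ℕ} {g v p : ℝ → ℝ}

/-! ### The profile is nondecreasing -/

theorem hasCompactSupport_sq {f : ℝ → ℝ} (hf : HasCompactSupport f) :
    HasCompactSupport fun r => f r ^ 2 :=
  hf.comp_left (g := fun t : ℝ => t ^ 2) (by simp)

theorem exists_bump : ∃ ψ : ℝ → ℝ, ContDiff ℝ ∞ ψ ∧ HasCompactSupport ψ ∧
    tsupport ψ ⊆ Icc (-1) 1 ∧ 0 < ∫ r, deriv ψ r ^ 2 := by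
  let b : ContDiffBump (0 : ℝ) := ⟨1 / 2, 1, by norm_num, by norm_num⟩
  have hd : Continuous (deriv b) := b.contDiff.continuous_deriv (n := ∞) (by simp)
  refine ⟨b, b.contDiff, b.hasCompactSupport, ?_, ?_⟩
  · rw [b.tsupport_eq, Real.closedBall_eq_Icc]
    simp [b]
  · have hne : ∃ x, deriv b x ≠ 0 := by
      by_contra! h
      have h1 := is_const_of_deriv_eq_zero (b.contDiff (n := 1).differentiable (by simp)) h 0 2
      rw [b.one_of_mem_closedBall (by simp [b]), b.zero_of_le_dist (by simp [b])] at h1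
      exact one_ne_zero h1
    obtain ⟨x, hx⟩ := hne
    refine Continuous.integral_pos_of_hasCompactSupport_nonneg_nonzero (hd.pow 2) ?_
      (fun _ => sq_nonneg _) (x := x) (pow_ne_zero 2 hx)
    exact hasCompactSupport_sq b.hasCompactSupport.deriv

/-- Concentrating test functions: the leading coefficient of a one-dimensional
quadratic form that is bounded below on test functions cannot be negative. -/
theorem IsRadialProfile.pow_nonneg (h : IsRadialProfile n k g v p) (hg : LocallyLipschitz g)
    (hkn : k ≤ n) : ∀ r ∈ Ioo (0 : ℝ) 1, 0 ≤ p r ^ (k - 1) := by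
  intro r₀ hr₀
  by_contra! hneg
  have hc0 := hessianConst_pos hkn
  set f : ℝ → ℝ := fun r => hessianConst n k * (r ^ (n - k) * p r ^ (k - 1)) with hf
  have hfc : ContinuousOn f (Ioo 0 1) :=
    continuousOn_const.mul ((continuousOn_pow _).mul (h.continuousOn.pow _))
  have hf0 : f r₀ < 0 :=
    mul_neg_of_pos_of_neg hc0 (mul_neg_of_pos_of_neg (pow_pos hr₀.1 _) hneg)
  set δ := -f r₀ / 2 with hδ
  have hδ0 : 0 < δ := by rw [hδ]; linarith
  obtain ⟨K, t, ht, hK⟩ := hg (v r₀)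
  have e1 : ∀ᶠ r in nhds r₀, f r < -δ :=
    (hfc.continuousAt (isOpen_Ioo.mem_nhds hr₀)).eventually_lt_const (by rw [hδ]; linarith)
  have e2 : ∀ᶠ r in nhds r₀, v r ∈ interior t :=
    (h.hasDerivAt r₀ hr₀).continuousAt.eventually
      (isOpen_interior.mem_nhds (mem_interior_iff_mem_nhds.2 ht))
  obtain ⟨ε₀, hε₀, hball⟩ := Metric.eventually_nhds_iff.1
    ((e1.and e2).and (isOpen_Ioo.mem_nhds hr₀))
  obtain ⟨ψ₀, h1, h2, h3, hA⟩ := exists_bump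
  set A := ∫ r, deriv ψ₀ r ^ 2 with hAdef
  set B := ∫ r, ψ₀ r ^ 2 with hBdef
  have hB : 0 ≤ B := integral_nonneg fun _ => sq_nonneg _
  have hK0 : (0 : ℝ) ≤ K := K.2
  -- rescale the bump to width `ε`
  have main : ∀ ε, 0 < ε → ε < ε₀ → δ * A ≤ K * B * ε ^ 2 := by
    intro ε hε hεε
    set ψ : ℝ → ℝ := fun r => ψ₀ ((r - r₀) / ε) with hψ
    have hψc : ContDiff ℝ ∞ ψ := h1.comp ((contDiff_id.sub contDiff_const).div_const ε)
    have hψd : ∀ r, deriv ψ r = deriv ψ₀ ((r - r₀) / ε) / ε := by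
      intro r
      have := ((h1.differentiable (by simp) ((r - r₀) / ε)).hasDerivAt).comp r
        (((hasDerivAt_id r).sub_const r₀).div_const ε)
      rw [show ψ = ψ₀ ∘ fun r => (id r - r₀) / ε from rfl, this.deriv]
      simp [div_eq_mul_inv]
    have hz : ∀ r, r ∉ Icc (r₀ - ε) (r₀ + ε) → ψ r = 0 := by
      intro r hr
      refine image_eq_zero_of_notMem_tsupport (f := ψ₀) fun hm => hr ?_
      have := h3 hm
      rw [mem_Icc, le_div_iff₀ hε, div_le_iff₀ hε] at this
      constructor <;> linarith [this.1, this.2]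
    have hsupp : Function.support ψ ⊆ Icc (r₀ - ε) (r₀ + ε) := fun r hr => by
      by_contra h'; exact hr (hz r h')
    have hnear : ∀ r ∈ Icc (r₀ - ε) (r₀ + ε), (f r < -δ ∧ v r ∈ interior t) ∧ r ∈ Ioo (0 : ℝ) 1 :=
      fun r hr => hball (by
        rw [Real.dist_eq, abs_lt]; constructor <;> linarith [hr.1, hr.2])
    have hts : tsupport ψ ⊆ Icc (r₀ - ε) (r₀ + ε) := closure_minimal hsupp isClosed_Icc
    have hψcs : HasCompactSupport ψ := HasCompactSupport.of_support_subset_isCompact isCompact_Icc hsupp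
    obtain ⟨hi, hst⟩ := h.stable ψ (hψc.of_le (by simp)) hψcs fun r hr => (hnear r (hts hr)).2
    have hd : Continuous (deriv ψ) := hψc.continuous_deriv (by simp)
    have hi1 : Integrable fun r => deriv ψ r ^ 2 :=
      (hd.pow 2).integrable_of_hasCompactSupport
        (hasCompactSupport_sq hψcs.deriv)
    have hi2 : Integrable fun r => ψ r ^ 2 :=
      (hψc.continuous.pow 2).integrable_of_hasCompactSupport
        (hasCompactSupport_sq hψcs)
    have hle := setIntegral_mono_on hi
      (((hi1.const_mul (-δ)).add (hi2.const_mul K)).integrableOn (s := Ioo 0 1))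
      measurableSet_Ioo (by
        intro r hr
        by_cases hr' : r ∈ Icc (r₀ - ε) (r₀ + ε)
        · obtain ⟨⟨h4, h5⟩, h6⟩ := hnear r hr'
          have h7 : deriv g (v r) ≤ K := (le_abs_self _).trans
            (norm_deriv_le_of_lipschitzOn (mem_interior_iff_mem_nhds.1 h5) hK)
          have h8 : f r * deriv ψ r ^ 2 ≤ -δ * deriv ψ r ^ 2 :=
            mul_le_mul_of_nonneg_right h4.le (sq_nonneg _)
          have h9 : r ^ (n - 1) * (deriv g (v r) * ψ r ^ 2) ≤ K * ψ r ^ 2 := by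
            have h10 : deriv g (v r) * ψ r ^ 2 ≤ K * ψ r ^ 2 :=
              mul_le_mul_of_nonneg_right h7 (sq_nonneg _)
            have h11 : r ^ (n - 1) ≤ 1 := pow_le_one₀ hr.1.le hr.2.le
            have h12 : 0 ≤ r ^ (n - 1) := _root_.pow_nonneg hr.1.le _
            have h13 : 0 ≤ K * ψ r ^ 2 := by positivity
            calc r ^ (n - 1) * (deriv g (v r) * ψ r ^ 2) ≤ r ^ (n - 1) * (K * ψ r ^ 2) :=
                  mul_le_mul_of_nonneg_left h10 h12
              _ ≤ K * ψ r ^ 2 := mul_le_of_le_one_left h13 h11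
          exact add_le_add h8 h9
        · have h4 : ψ r = 0 := hz r hr'
          have h5 : deriv ψ r = 0 := image_eq_zero_of_notMem_tsupport fun hm =>
            hr' (hts (tsupport_deriv_subset (𝕜 := ℝ) hm))
          simp [h4, h5])
    have hupper : ∫ r in Ioo (0 : ℝ) 1, ((fun r => -δ * deriv ψ r ^ 2) + fun r => K * ψ r ^ 2) r =
        -δ * (A / ε) + K * (ε * B) := by
      have hz1 : ∀ r, r ∉ Ioo (0 : ℝ) 1 → r ∉ tsupport ψ := fun r hr hm => hr (hnear r (hts hm)).2
      rw [setIntegral_eq_integral_of_forall_compl_eq_zero, integral_add'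
        (hi1.const_mul _) (hi2.const_mul _), integral_const_mul, integral_const_mul]
      · have s1 : ∫ r, ψ r ^ 2 = ε * B := by
          have := integral_sub_right_eq_self (μ := volume) (fun r => ψ₀ (r / ε) ^ 2) r₀
          rw [show (fun r => ψ r ^ 2) = fun r => ψ₀ ((r - r₀) / ε) ^ 2 from rfl, this,
            Measure.integral_comp_div (fun r => ψ₀ r ^ 2), abs_of_pos hε, smul_eq_mul]
        have s2 : ∫ r, deriv ψ r ^ 2 = A / ε := by
          have := integral_sub_right_eq_self (μ := volume) (fun r => (deriv ψ₀ (r / ε) / ε) ^ 2) r₀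
          simp only [hψd]
          rw [this, Measure.integral_comp_div (fun r => (deriv ψ₀ r / ε) ^ 2), abs_of_pos hε,
            smul_eq_mul]
          simp only [div_pow, integral_div]
          field_simp
          rfl
        rw [s1, s2]
      · intro r hr
        have h4 : ψ r = 0 := image_eq_zero_of_notMem_tsupport (hz1 r hr)
        have h5 : deriv ψ r = 0 := image_eq_zero_of_notMem_tsupport fun hm =>
          hz1 r hr (tsupport_deriv_subset (𝕜 := ℝ) hm)
        simp [h4, h5]
    have := hst.trans (hle.trans_eq hupper)
    have h4 : δ * (A / ε) ≤ K * (ε * B) := by linarith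
    rw [← mul_div_assoc, div_le_iff₀ hε] at h4
    linarith
  -- let `ε → 0`
  have hlim : Filter.Tendsto (fun ε : ℝ => K * B * ε ^ 2) (nhdsWithin 0 (Ioi 0)) (nhds 0) := by
    have : Continuous fun ε : ℝ => K * B * ε ^ 2 := by fun_prop
    simpa using (this.tendsto 0).mono_left nhdsWithin_le_nhds
  have hle : δ * A ≤ 0 := ge_of_tendsto hlim (by
    filter_upwards [Ioo_mem_nhdsGT hε₀] with ε hε using main ε hε.1 hε.2)
  exact absurd hle (not_le.2 (mul_pos hδ0 hA))

/-- A negative value of `p` would give `p ^ k = p ^ (k - 1) * p ≤ 0` by semistability, while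
`p ^ k ≥ 0` by the equation, as `g ≥ 0`. For odd `k` the equation alone suffices; for even `k` it
does not determine the sign. -/
theorem IsRadialProfile.nonneg (h : IsRadialProfile n k g v p) (hg : LocallyLipschitz g)
    (hg0 : ∀ s, 0 ≤ g s) (hk : 1 ≤ k) (hkn : k ≤ n) : ∀ r ∈ Ioo (0 : ℝ) 1, 0 ≤ p r := by
  intro r hr
  by_contra! hneg
  have h1 := h.pow_nonneg hg hkn r hr
  have h2 : p r ^ k ≤ 0 := by
    rw [← pow_sub_one_mul_self hk]
    exact mul_nonpos_of_nonneg_of_nonpos h1 hneg.le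
  have h3 : 0 ≤ r ^ (n - k) * p r ^ k := by
    rw [h.flux r hr]
    have h4 : 0 ≤ ∫ s in (0 : ℝ)..r, s ^ (n - 1) * g (v s) :=
      intervalIntegral.integral_nonneg hr.1.le fun s hs =>
        mul_nonneg (_root_.pow_nonneg hs.1 _) (hg0 _)
    have := hessianConst_pos hkn
    positivity
  have h4 : 0 ≤ p r ^ k := nonneg_of_mul_nonneg_right h3 (pow_pos hr.1 _)
  exact (pow_ne_zero k hneg.ne) (le_antisymm h2 h4)

/-- A nonnegative profile, extended continuously past `r = 1`; only the values of `p` and `v` on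
`(0,1]` carry information. -/
structure IsRadialSolution (n k : ℕ) (g v p : ℝ → ℝ) : Prop where
  continuousOn : ContinuousOn p (Ioi 0)
  nonneg : ∀ r, 0 < r → 0 ≤ p r
  hasDerivAt : ∀ r, 0 < r → HasDerivAt v (p r) r
  integrable_rhs : IntervalIntegrable (fun r => r ^ (n - 1) * g (v r)) volume 0 1
  flux : ∀ r ∈ Ioc (0 : ℝ) 1, r ^ (n - k) * p r ^ k =
    k / hessianConst n k * ∫ s in (0 : ℝ)..r, s ^ (n - 1) * g (v s)
  energy : IntegrableOn (fun r => r ^ (n - k) * p r ^ (k + 1)) (Ioo 0 1)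
  stable : ∀ ψ : ℝ → ℝ, ContDiff ℝ 1 ψ → HasCompactSupport ψ → tsupport ψ ⊆ Ioo 0 1 →
    IntegrableOn (fun r => hessianConst n k * (r ^ (n - k) * p r ^ (k - 1)) * deriv ψ r ^ 2 +
      r ^ (n - 1) * (deriv g (v r) * ψ r ^ 2)) (Ioo 0 1) ∧
    0 ≤ ∫ r in Ioo (0 : ℝ) 1, (hessianConst n k * (r ^ (n - k) * p r ^ (k - 1)) * deriv ψ r ^ 2 +
      r ^ (n - 1) * (deriv g (v r) * ψ r ^ 2))

/-- The extension past `r = 1` is the nonnegative `k`-th root of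
`W(min r 1) / r^{n-k}`, where `W` is the flux; it agrees with `p` on `(0,1)`. -/
theorem IsRadialProfile.exists_isRadialSolution (h : IsRadialProfile n k g v p)
    (hg : LocallyLipschitz g) (hg0 : ∀ s, 0 ≤ g s) (hk : 1 ≤ k) (hkn : k ≤ n) :
    ∃ v' p' : ℝ → ℝ, IsRadialSolution n k g v' p' ∧ EqOn v v' (Ioo 0 1) ∧ EqOn p p' (Ioo 0 1) := by
  have hp0 := h.nonneg hg hg0 hk hkn
  have hc0 := hessianConst_pos hkn
  have hk0 : k ≠ 0 := by omega
  have hi : IntervalIntegrable (fun r => r ^ (n - 1) * g (v r)) volume 0 1 := by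
    rw [intervalIntegrable_iff_integrableOn_Ioo_of_le zero_le_one]; exact h.integrable_rhs
  set W : ℝ → ℝ := fun r => k / hessianConst n k * ∫ s in (0 : ℝ)..r, s ^ (n - 1) * g (v s) with hW
  have hWc : ContinuousOn W (Icc 0 1) := by
    have := (hi.absolutelyContinuousOnInterval_intervalIntegral (c := 0) (by simp)).continuousOn
    rw [uIcc_of_le zero_le_one] at this
    exact continuousOn_const.mul this
  have hW0 : ∀ r ∈ Icc (0 : ℝ) 1, 0 ≤ W r := by
    intro r hr
    have h4 : 0 ≤ ∫ s in (0 : ℝ)..r, s ^ (n - 1) * g (v s) :=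
      intervalIntegral.integral_nonneg hr.1 fun s hs =>
        mul_nonneg (_root_.pow_nonneg hs.1 _) (hg0 _)
    simp only [hW]
    positivity
  set p' : ℝ → ℝ := fun r => (W (min r 1) / r ^ (n - k)) ^ (1 / (k : ℝ)) with hp'
  have hmin : ∀ r, 0 < r → min r 1 ∈ Icc (0 : ℝ) 1 := fun r hr =>
    ⟨le_min hr.le zero_le_one, min_le_right _ _⟩
  have hp'c : ContinuousOn p' (Ioi 0) := by
    refine ContinuousOn.rpow_const (ContinuousOn.div ?_ (continuousOn_pow _) fun r hr =>
      pow_ne_zero _ (ne_of_gt hr)) fun r hr => Or.inr (by positivity)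
    exact hWc.comp (continuous_id.min continuous_const).continuousOn fun r hr => hmin r hr
  have hbase : ∀ r, 0 < r → 0 ≤ W (min r 1) / r ^ (n - k) := fun r hr =>
    div_nonneg (hW0 _ (hmin r hr)) (_root_.pow_nonneg hr.le _)
  have hp'0 : ∀ r, 0 < r → 0 ≤ p' r := fun r hr => Real.rpow_nonneg (hbase r hr) _
  have hflux' : ∀ r ∈ Ioc (0 : ℝ) 1, r ^ (n - k) * p' r ^ k = W r := by
    intro r hr
    simp only [hp']
    rw [one_div, Real.rpow_inv_natCast_pow (hbase r hr.1) hk0, min_eq_left hr.2]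
    have : r ^ (n - k) ≠ 0 := pow_ne_zero _ hr.1.ne'
    field_simp
  have hpp : EqOn p p' (Ioo 0 1) := by
    intro r hr
    have h1 := (h.flux r hr).trans (hflux' r ⟨hr.1, hr.2.le⟩).symm
    have h2 := mul_left_cancel₀ (pow_ne_zero _ hr.1.ne') h1
    exact (pow_left_inj₀ (hp0 r hr) (hp'0 r hr.1) hk0).1 h2
  set v' : ℝ → ℝ := fun r => v (1 / 2) + ∫ s in (1 / 2)..r, p' s with hv'
  have hsubI : ∀ r : ℝ, 0 < r → uIcc (1 / 2) r ⊆ Ioi 0 := fun r hr =>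
    ordConnected_Ioi.uIcc_subset (mem_Ioi.2 (by norm_num)) hr
  have hp'i : ∀ r, 0 < r → IntervalIntegrable p' volume (1 / 2) r := fun r hr =>
    (hp'c.mono (hsubI r hr)).intervalIntegrable
  have hv'd : ∀ r, 0 < r → HasDerivAt v' (p' r) r := fun r hr =>
    (intervalIntegral.integral_hasDerivAt_right (hp'i r hr)
      (hp'c.stronglyMeasurableAtFilter isOpen_Ioi r hr)
      (hp'c.continuousAt (isOpen_Ioi.mem_nhds hr))).const_add _
  have hvv : EqOn v v' (Ioo 0 1) := by
    intro r hr
    have hsub : uIcc (1 / 2) r ⊆ Ioo (0 : ℝ) 1 :=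
      ordConnected_Ioo.uIcc_subset ⟨by norm_num, by norm_num⟩ hr
    have h1 : ∫ s in (1 / 2)..r, p s = v r - v (1 / 2) :=
      intervalIntegral.integral_eq_sub_of_hasDerivAt (fun s hs => h.hasDerivAt s (hsub hs))
        (h.continuousOn.mono hsub).intervalIntegrable
    have h2 : ∫ s in (1 / 2)..r, p s = ∫ s in (1 / 2)..r, p' s :=
      intervalIntegral.integral_congr fun s hs => hpp (hsub hs)
    simp only [hv']
    linarith
  have hrhs' : EqOn (fun r => r ^ (n - 1) * g (v r)) (fun r => r ^ (n - 1) * g (v' r)) (Ioo 0 1) :=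
    fun r hr => by simp only [hvv hr]
  refine ⟨v', p', ⟨hp'c, hp'0, hv'd, ?_, ?_, ?_, ?_⟩, hvv, hpp⟩
  · rw [intervalIntegrable_iff_integrableOn_Ioo_of_le zero_le_one]
    exact h.integrable_rhs.congr_fun hrhs' measurableSet_Ioo
  · intro r hr
    rw [hflux' r hr, hW]
    simp only
    rw [intervalIntegral.integral_of_le hr.1.le, intervalIntegral.integral_of_le hr.1.le,
      integral_Ioc_eq_integral_Ioo, integral_Ioc_eq_integral_Ioo,
      setIntegral_congr_fun measurableSet_Ioo fun s hs => hrhs' ⟨hs.1, hs.2.trans_le hr.2⟩]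
  · exact h.energy.congr_fun (fun r hr => by simp only [hpp hr]) measurableSet_Ioo
  · intro ψ h1 h2 h3
    obtain ⟨h4, h5⟩ := h.stable ψ h1 h2 h3
    have he : EqOn (fun r => hessianConst n k * (r ^ (n - k) * p r ^ (k - 1)) * deriv ψ r ^ 2 +
      r ^ (n - 1) * (deriv g (v r) * ψ r ^ 2)) (fun r => hessianConst n k *
      (r ^ (n - k) * p' r ^ (k - 1)) * deriv ψ r ^ 2 +
      r ^ (n - 1) * (deriv g (v' r) * ψ r ^ 2)) (Ioo 0 1) := fun r hr => by
        simp only [hpp hr, hvv hr]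
    exact ⟨h4.congr_fun he measurableSet_Ioo,
      h5.trans_eq (setIntegral_congr_fun measurableSet_Ioo he)⟩

end KHessian

namespace KHessian

/-! ### Regularity and monotonicity of the slope -/

variable {n k : ℕ} {g v p : ℝ → ℝ}

namespace IsRadialSolution

theorem continuousOn_profile (h : IsRadialSolution n k g v p) : ContinuousOn v (Ioi 0) :=
  fun r hr => (h.hasDerivAt r hr).continuousAt.continuousWithinAt

theorem continuousOn_rhs (h : IsRadialSolution n k g v p) (hg : Continuous g) :
    ContinuousOn (fun r => r ^ (n - 1) * g (v r)) (Ioi 0) :=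
  (continuousOn_pow _).mul (hg.comp_continuousOn h.continuousOn_profile)

theorem intervalIntegrable_rhs (h : IsRadialSolution n k g v p) {r : ℝ} (hr : r ∈ Icc (0 : ℝ) 1) :
    IntervalIntegrable (fun r => r ^ (n - 1) * g (v r)) volume 0 r :=
  h.integrable_rhs.mono_set (by
    rw [uIcc_of_le hr.1, uIcc_of_le zero_le_one]; exact Icc_subset_Icc_right hr.2)

/-- The flux `r^{n-k} p^k` is nondecreasing, because `g ≥ 0`. -/
theorem flux_mono (h : IsRadialSolution n k g v p) (hg0 : ∀ s, 0 ≤ g s) (hkn : k ≤ n) {s t : ℝ}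
    (hs : 0 < s) (hst : s ≤ t) (ht : t ≤ 1) : s ^ (n - k) * p s ^ k ≤ t ^ (n - k) * p t ^ k := by
  rw [h.flux s ⟨hs, hst.trans ht⟩, h.flux t ⟨hs.trans_le hst, ht⟩]
  have hc := hessianConst_pos hkn
  refine mul_le_mul_of_nonneg_left ?_ (by positivity)
  have hi := h.intervalIntegrable_rhs (r := t) ⟨(hs.trans_le hst).le, ht⟩
  refine intervalIntegral.integral_mono_interval le_rfl hs.le hst ?_ hi
  filter_upwards [ae_restrict_mem measurableSet_Ioc] with x hx
  exact mul_nonneg (_root_.pow_nonneg hx.1.le _) (hg0 _)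

/-- A one-sided Harnack inequality: the slope cannot drop by more than a fixed factor over a
bounded ratio of radii. -/
theorem harnack (h : IsRadialSolution n k g v p) (hg0 : ∀ s, 0 ≤ g s) (hk : 1 ≤ k) (hkn : k ≤ n)
    {θ ρ r : ℝ} (hθ : 0 ≤ θ) (hθ1 : θ ≤ 1) (hρ : 0 < ρ) (hρr : ρ ≤ r) (hr : r ≤ 1)
    (hθr : θ * r ≤ ρ) : θ ^ (n - k) * p ρ ≤ p r := by
  have hr0 : 0 < r := hρ.trans_le hρr
  have hp := h.nonneg ρ hρ
  refine le_of_pow_le_pow_left₀ (n := k) (by omega) (h.nonneg r hr0) ?_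
  have h1 := h.flux_mono hg0 hkn hρ hρr hr
  have h2 : (θ * r) ^ (n - k) ≤ ρ ^ (n - k) := pow_le_pow_left₀ (by positivity) hθr _
  have h3 : (θ ^ (n - k)) ^ k ≤ θ ^ (n - k) :=
    pow_le_of_le_one (by positivity) (pow_le_one₀ hθ hθ1) (by omega)
  have h4 : r ^ (n - k) * (θ ^ (n - k) * p ρ ^ k) ≤ r ^ (n - k) * p r ^ k := by
    calc _ = (θ * r) ^ (n - k) * p ρ ^ k := by rw [mul_pow]; ring
      _ ≤ ρ ^ (n - k) * p ρ ^ k := by gcongr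
      _ ≤ _ := h1
  have h5 := le_of_mul_le_mul_left h4 (by positivity)
  calc _ = (θ ^ (n - k)) ^ k * p ρ ^ k := mul_pow _ _ _
    _ ≤ θ ^ (n - k) * p ρ ^ k := by gcongr
    _ ≤ _ := h5

end IsRadialSolution

/-- The derivative of the slope `p` of a radial solution, as read off from the equation
`(r^{n-k} p^k)' = (k / c) r^{n-1} g(v)` at points where `p > 0`. -/
noncomputable def accel (n k : ℕ) (g v p : ℝ → ℝ) (r : ℝ) : ℝ :=
  r ^ (k - 1) * g (v r) / (hessianConst n k * p r ^ (k - 1)) - ((n : ℝ) - k) / k * (p r / r)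

namespace IsRadialSolution

theorem hasDerivAt_integral (h : IsRadialSolution n k g v p) (hg : Continuous g) {r : ℝ}
    (hr : r ∈ Ioc (0 : ℝ) 1) :
    HasDerivAt (fun r => ∫ s in (0 : ℝ)..r, s ^ (n - 1) * g (v s)) (r ^ (n - 1) * g (v r)) r :=
  intervalIntegral.integral_hasDerivAt_right (h.intervalIntegrable_rhs ⟨hr.1.le, hr.2⟩)
    ((h.continuousOn_rhs hg).stronglyMeasurableAtFilter isOpen_Ioi r hr.1)
    ((h.continuousOn_rhs hg).continuousAt (isOpen_Ioi.mem_nhds hr.1))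

/-- Where `p > 0`, it is the `k`-th root of `W / r^{n-k}` with a differentiable flux `W`, hence
differentiable; the value of the derivative is read off by differentiating `r^{n-k} p^k = W`. -/
theorem hasDerivWithinAt_slope (h : IsRadialSolution n k g v p) (hg : Continuous g) (hk : 1 ≤ k)
    (hkn : k ≤ n) {r : ℝ} (hr : r ∈ Ioc (0 : ℝ) 1) (hpr : 0 < p r) :
    HasDerivWithinAt p (accel n k g v p r) (Ioc 0 1) r := by
  have hr0 := hr.1
  have hk0 : k ≠ 0 := by omega
  have hc := hessianConst_pos hkn
  set W : ℝ → ℝ := fun r => k / hessianConst n k * ∫ s in (0 : ℝ)..r, s ^ (n - 1) * g (v s) with hW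
  have hWd : HasDerivAt W (k / hessianConst n k * (r ^ (n - 1) * g (v r))) r :=
    (h.hasDerivAt_integral hg hr).const_mul _
  have hbd : HasDerivAt (fun r => W r / r ^ (n - k)) _ r :=
    hWd.div (hasDerivAt_pow (n - k) r) (by positivity)
  have hbr : W r / r ^ (n - k) = p r ^ k := by
    rw [hW]; simp only [← h.flux r hr]; field_simp
  have hbr0 : 0 < W r / r ^ (n - k) := by rw [hbr]; positivity
  have hQd := hbd.rpow_const (p := 1 / (k : ℝ)) (Or.inl hbr0.ne')
  have hpow : ∀ x : ℝ, 0 ≤ x → (x ^ (1 / (k : ℝ))) ^ k = x := fun x hx => by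
    rw [one_div, Real.rpow_inv_natCast_pow hx hk0]
  have hQp : ∀ x ∈ Ioc (0 : ℝ) 1, (W x / x ^ (n - k)) ^ (1 / (k : ℝ)) = p x := by
    intro x hx
    have hx0 := hx.1
    have h1 : W x / x ^ (n - k) = p x ^ k := by
      rw [hW]; simp only [← h.flux x hx]; field_simp
    rw [h1, one_div, Real.pow_rpow_inv_natCast (h.nonneg x hx.1) hk0]
  obtain ⟨d, hd⟩ : ∃ d, HasDerivAt (fun x => (W x / x ^ (n - k)) ^ (1 / (k : ℝ))) d r := ⟨_, hQd⟩
  have hprod := (hasDerivAt_pow (n - k) r).mul (hd.pow k)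
  have hev : (fun x => x ^ (n - k) * ((W x / x ^ (n - k)) ^ (1 / (k : ℝ))) ^ k) =ᶠ[nhds r] W := by
    filter_upwards [hbd.continuousAt.eventually (lt_mem_nhds hbr0), lt_mem_nhds hr.1] with x hx hx0
    rw [hpow _ hx.le]
    field_simp
  have huniq := (hprod.congr_of_eventuallyEq hev.symm).unique hWd
  have hdd : d = accel n k g v p r := by
    simp only [hQp r hr] at huniq
    have hnk : ((n - k : ℕ) : ℝ) = n - k := by push_cast [hkn]; ring
    have e1 : r ^ (n - 1) = r ^ (n - k) * r ^ (k - 1) := by rw [← pow_add]; congr 1; omega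
    have e2 : p r ^ k = p r ^ (k - 1) * p r := (pow_sub_one_mul_self hk _).symm
    have e3 : ((n - k : ℕ) : ℝ) * r ^ (n - k - 1) = ((n : ℝ) - k) * (r ^ (n - k) / r) := by
      rw [hnk]
      rcases Nat.eq_zero_or_pos (n - k) with h0 | h0
      · have : (n : ℝ) - k = 0 := by rw [← hnk, h0]; simp
        rw [this]; simp
      · rw [← pow_sub_one_mul_self h0 r]; field_simp
    simp only [Pi.pow_apply, hQp r hr] at huniq
    rw [e3, e1, e2] at huniq
    have hkr : (k : ℝ) ≠ 0 := by positivity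
    rw [accel]
    have hq : p r ^ (k - 1) ≠ 0 := by positivity
    have hR : r ^ (n - k) ≠ 0 := by positivity
    field_simp at huniq ⊢
    linear_combination huniq
  rw [← hdd]
  exact hd.hasDerivWithinAt.congr (fun x hx => (hQp x hx).symm) (hQp r hr).symm

theorem hasDerivAt_slope (h : IsRadialSolution n k g v p) (hg : Continuous g) (hk : 1 ≤ k)
    (hkn : k ≤ n) {r : ℝ} (hr : r ∈ Ioo (0 : ℝ) 1) (hpr : 0 < p r) :
    HasDerivAt p (accel n k g v p r) r :=
  (h.hasDerivWithinAt_slope hg hk hkn ⟨hr.1, hr.2.le⟩ hpr).hasDerivAt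
    (Filter.mem_of_superset (isOpen_Ioo.mem_nhds hr) Ioo_subset_Ioc_self)

theorem continuousAt_accel (h : IsRadialSolution n k g v p) (hg : Continuous g)
    (hkn : k ≤ n) {r : ℝ} (hr : 0 < r) (hpr : 0 < p r) : ContinuousAt (accel n k g v p) r := by
  have hp : ContinuousAt p r := h.continuousOn.continuousAt (isOpen_Ioi.mem_nhds hr)
  have hv : ContinuousAt v r := (h.hasDerivAt r hr).continuousAt
  have hc := hessianConst_pos hkn
  unfold accel
  refine ContinuousAt.sub (ContinuousAt.div ((continuousAt_id.pow _).mul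
    (ContinuousAt.comp (g := g) (f := v) hg.continuousAt hv)) (continuousAt_const.mul (hp.pow _)) (by positivity))
    (continuousAt_const.mul (hp.div continuousAt_id hr.ne'))

/-- The equation at a point where `p > 0`, solved for `g(v)`. -/
theorem rhs_eq (hk : 1 ≤ k) (hkn : k ≤ n) {r : ℝ} (hr : 0 < r) (hpr : 0 < p r) :
    r ^ (k - 1) * g (v r) = hessianConst n k * p r ^ (k - 1) *
      (accel n k g v p r + ((n : ℝ) - k) / k * (p r / r)) := by
  have hc := hessianConst_pos hkn
  have hk0 : (k : ℝ) ≠ 0 := by positivity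
  rw [accel]
  field_simp
  ring

end IsRadialSolution

end KHessian

namespace KHessian

/-! ### The weighted Hardy-type inequality for the slope -/

variable {n k : ℕ} {g v p : ℝ → ℝ}

/-- If `g ∘ v` is differentiable at a point where `v` has a nonzero strict derivative, then `g` is
differentiable at the image, because `v` has a differentiable local inverse. -/
theorem differentiableAt_of_comp_hasStrictDerivAt {a r : ℝ} (hv : HasStrictDerivAt v a r)
    (ha : a ≠ 0) (hd : DifferentiableAt ℝ (fun s => g (v s)) r) : DifferentiableAt ℝ g (v r) := by
  have h1 := (hv.to_localInverse ha).hasDerivAt.differentiableAt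
  have h2 : hv.localInverse v a r ha (v r) = r := (hv.eventually_left_inverse ha).self_of_nhds
  have h3 : DifferentiableAt ℝ (fun y => g (v (hv.localInverse v a r ha y))) (v r) := by
    refine DifferentiableAt.comp (g := fun s => g (v s)) _ ?_ h1
    rw [h2]; exact hd
  refine h3.congr_of_eventuallyEq ?_
  filter_upwards [hv.eventually_right_inverse ha] with y hy
  rw [hy]

theorem exists_Icc_of_isCompact_subset_Ioo {K : Set ℝ} (hK : IsCompact K) {α β : ℝ} (hαβ : α < β)
    (hs : K ⊆ Ioo α β) : ∃ a b, α < a ∧ a < b ∧ b < β ∧ K ⊆ Ioo a b := by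
  rcases K.eq_empty_or_nonempty with rfl | hne
  · exact ⟨(2 * α + β) / 3, (α + 2 * β) / 3, by linarith, by linarith, by linarith, by simp⟩
  · obtain ⟨x, hx, hx'⟩ := hK.exists_isLeast hne
    obtain ⟨y, hy, hy'⟩ := hK.exists_isGreatest hne
    have h1 := (hs hx).1
    have h2 := (hs hy).2
    have h3 := hx' hy
    exact ⟨(α + x) / 2, (y + β) / 2, by linarith, by linarith, by linarith, fun z hz =>
      ⟨by linarith [hx' hz], by linarith [hy' hz]⟩⟩

namespace IsRadialSolution

theorem hasStrictDerivAt_profile (h : IsRadialSolution n k g v p) {r : ℝ} (hr : 0 < r) :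
    HasStrictDerivAt v (p r) r :=
  hasStrictDerivAt_of_hasDerivAt_of_continuousAt
    (Filter.mem_of_superset (isOpen_Ioi.mem_nhds hr) fun y hy => h.hasDerivAt y hy)
    (h.continuousOn.continuousAt (isOpen_Ioi.mem_nhds hr))

theorem contDiffOn_profile (h : IsRadialSolution n k g v p) : ContDiffOn ℝ 1 v (Ioi 0) := by
  rw [contDiffOn_one_iff_derivWithin isOpen_Ioi.uniqueDiffOn]
  refine ⟨fun r hr => (h.hasDerivAt r hr).differentiableAt.differentiableWithinAt,
    h.continuousOn.congr fun r hr => ?_⟩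
  rw [derivWithin_of_isOpen isOpen_Ioi hr, (h.hasDerivAt r hr).deriv]

theorem contDiffOn_slope (h : IsRadialSolution n k g v p) (hg : Continuous g) (hk : 1 ≤ k)
    (hkn : k ≤ n) {r₁ : ℝ} (hr₁ : 0 ≤ r₁) (hp : ∀ r ∈ Ioo r₁ 1, 0 < p r) :
    ContDiffOn ℝ 1 p (Ioo r₁ 1) := by
  have hd : ∀ r ∈ Ioo r₁ 1, HasDerivAt p (accel n k g v p r) r := fun r hr =>
    h.hasDerivAt_slope hg hk hkn ⟨hr₁.trans_lt hr.1, hr.2⟩ (hp r hr)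
  rw [contDiffOn_one_iff_derivWithin isOpen_Ioo.uniqueDiffOn]
  refine ⟨fun r hr => (hd r hr).differentiableAt.differentiableWithinAt,
    ContinuousOn.congr (f := accel n k g v p) (fun r hr => (h.continuousAt_accel hg hkn
      (hr₁.trans_lt hr.1) (hp r hr)).continuousWithinAt) fun r hr => ?_⟩
  rw [derivWithin_of_isOpen isOpen_Ioo hr, (hd r hr).deriv]

theorem absolutelyContinuousOnInterval_rhs (h : IsRadialSolution n k g v p)
    (hg : LocallyLipschitz g) {a b : ℝ} (ha : 0 < a) (hab : a ≤ b) :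
    AbsolutelyContinuousOnInterval (fun r => g (v r)) a b := by
  have hsub : Icc a b ⊆ Ioi 0 := fun x hx => ha.trans_le hx.1
  obtain ⟨K, hK⟩ := (h.contDiffOn_profile.mono hsub).exists_lipschitzOnWith (by decide)
    (convex_Icc _ _) isCompact_Icc
  have hvc : IsCompact (v '' Icc a b) := isCompact_Icc.image_of_continuousOn
    (h.continuousOn_profile.mono hsub)
  obtain ⟨K', hK'⟩ := LocallyLipschitzOn.exists_lipschitzOnWith_of_compact hvc
    hg.locallyLipschitzOn
  have := hK'.comp hK (mapsTo_image v _)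
  refine LipschitzOnWith.absolutelyContinuousOnInterval (K := K' * K) ?_
  rw [uIcc_of_le hab]
  exact this

/-- Testing semistability with `φ = p ξ` and subtracting an exact derivative eliminates `g`. The
exact derivative is that of
`r^{n-1} p ξ² g(v) - c μ r^{n-k-1} p^{k+1} ξ²` with `μ = (n (k+1) - 2 k) / (k (k+1))`. -/
theorem energy_inequality (h : IsRadialSolution n k g v p) (hg : LocallyLipschitz g) (hk : 1 ≤ k)
    (hkn : k + 2 ≤ n) {r₁ : ℝ} (hr₁ : 0 ≤ r₁) (hr₁' : r₁ < 1) (hp : ∀ r ∈ Ioo r₁ 1, 0 < p r)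
    {ξ : ℝ → ℝ} (hξ : ContDiff ℝ 1 ξ) (hξc : HasCompactSupport ξ) (hξs : tsupport ξ ⊆ Ioo r₁ 1) :
    IntegrableOn (fun r => r ^ (n - k) * p r ^ (k + 1) * (deriv ξ r ^ 2 +
      2 * (((k : ℝ) - 1) / (k + 1)) * (ξ r * deriv ξ r / r) -
      (2 * n - k - 1) / (k + 1) * (ξ r ^ 2 / r ^ 2))) (Ioo 0 1) ∧
    0 ≤ ∫ r in Ioo (0 : ℝ) 1, r ^ (n - k) * p r ^ (k + 1) * (deriv ξ r ^ 2 +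
      2 * (((k : ℝ) - 1) / (k + 1)) * (ξ r * deriv ξ r / r) -
      (2 * n - k - 1) / (k + 1) * (ξ r ^ 2 / r ^ 2)) := by
  have hkn' : k ≤ n := by omega
  have hc := hessianConst_pos hkn'
  set c := hessianConst n k with hcdef
  obtain ⟨a, b, ha, hab, hb, hKab⟩ := exists_Icc_of_isCompact_subset_Ioo hξc hr₁' hξs
  have ha0 : 0 < a := hr₁.trans_lt ha
  have hsub : Icc a b ⊆ Ioo r₁ 1 := Icc_subset_Ioo ha hb
  have hsub' : Icc a b ⊆ Ioo 0 1 := Icc_subset_Ioo ha0 hb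
  have hpC := h.contDiffOn_slope hg.continuous hk hkn' hr₁ hp
  have hpd : ∀ r ∈ Ioo r₁ 1, HasDerivAt p (accel n k g v p r) r := fun r hr =>
    h.hasDerivAt_slope hg.continuous hk hkn' ⟨hr₁.trans_lt hr.1, hr.2⟩ (hp r hr)
  have hξd : ∀ r, HasDerivAt ξ (deriv ξ r) r := fun r =>
    (hξ.differentiable (by simp) r).hasDerivAt
  -- the test function
  have hφ : ContDiff ℝ 1 (fun r => p r * ξ r) := contDiff_mul_of_tsupport_subset isOpen_Ioo hpC hξ hξs
  have hφs : tsupport (fun r => p r * ξ r) ⊆ tsupport ξ := tsupport_mul_subset_right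
  obtain ⟨hI1, hI2⟩ := h.stable _ hφ hξc.mul_left
    (hφs.trans (hξs.trans (Ioo_subset_Ioo_left hr₁)))
  set I : ℝ → ℝ := fun r => c * (r ^ (n - k) * p r ^ (k - 1)) *
    deriv (fun r => p r * ξ r) r ^ 2 + r ^ (n - 1) * (deriv g (v r) * (p r * ξ r) ^ 2) with hI
  set Q : ℝ → ℝ := fun r => r ^ (n - k) * p r ^ (k + 1) * (deriv ξ r ^ 2 +
      2 * (((k : ℝ) - 1) / (k + 1)) * (ξ r * deriv ξ r / r) -
      (2 * n - k - 1) / (k + 1) * (ξ r ^ 2 / r ^ 2)) with hQ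
  set μ : ℝ := (n * (k + 1) - 2 * k) / (k * (k + 1)) with hμ
  set B : ℝ → ℝ := fun r => r ^ (n - 1) * p r * ξ r ^ 2 * g (v r) -
    c * μ * (r ^ (n - k - 1) * p r ^ (k + 1) * ξ r ^ 2) with hB
  have hgv := h.absolutelyContinuousOnInterval_rhs hg ha0 hab.le
  have hBac : AbsolutelyContinuousOnInterval B a b := by
    have hpC' := hpC.mono hsub
    have h1 : ContDiffOn ℝ 1 (fun r => r ^ (n - 1) * p r * ξ r ^ 2) (uIcc a b) := by
      rw [uIcc_of_le hab.le]
      exact (((contDiff_id.pow _).contDiffOn).mul hpC').mul (hξ.pow 2).contDiffOn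
    have h2 : ContDiffOn ℝ 1 (fun r => c * μ * (r ^ (n - k - 1) * p r ^ (k + 1) * ξ r ^ 2))
        (uIcc a b) := by
      rw [uIcc_of_le hab.le]
      exact contDiffOn_const.mul ((((contDiff_id.pow _).contDiffOn).mul (hpC'.pow _)).mul
        (hξ.pow 2).contDiffOn)
    exact (h1.absolutelyContinuousOnInterval.fun_mul hgv).fun_sub h2.absolutelyContinuousOnInterval
  have hout : ∀ r, r ∉ Ioo a b → ξ r = 0 := fun r hr =>
    image_eq_zero_of_notMem_tsupport fun h => hr (hKab h)
  have hB0 : ∫ r in a..b, deriv B r = 0 := by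
    rw [hBac.integral_deriv_eq_sub, hB]
    simp [hout a (by simp), hout b (by simp)]
  have hBi := hBac.intervalIntegrable_deriv
  -- the pointwise identity
  have hkey : ∀ᵐ r, r ∈ Ioc a b → c * Q r = I r - deriv B r := by
    filter_upwards [hgv.ae_differentiableAt] with r hdr hr
    have hrI : r ∈ Icc a b := Ioc_subset_Icc_self hr
    have hr1 := hsub hrI
    have hr0 : 0 < r := (hsub' hrI).1
    have hpr := hp r hr1
    have hgd := differentiableAt_of_comp_hasStrictDerivAt (h.hasStrictDerivAt_profile hr0) hpr.ne'
      (hdr (by rwa [uIcc_of_le hab.le]))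
    have hgvd : HasDerivAt (fun s => g (v s)) (deriv g (v r) * p r) r :=
      HasDerivAt.comp (h₂ := g) r hgd.hasDerivAt (h.hasDerivAt r hr0)
    have hφd := ((hpd r hr1).mul (hξd r)).deriv
    have hBd := (((((hasDerivAt_pow (n - 1) r).mul (hpd r hr1)).mul ((hξd r).pow 2)).mul hgvd).sub
      ((((hasDerivAt_pow (n - k - 1) r).mul ((hpd r hr1).pow (k + 1))).mul
        ((hξd r).pow 2)).const_mul (c * μ))).deriv
    have e0 := rhs_eq (g := g) (v := v) hk hkn' hr0 hpr
    have hBd' : deriv B r = _ := hBd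
    have hφd' : deriv (fun r => p r * ξ r) r = _ := hφd
    have n1 : ((n - 1 : ℕ) : ℝ) = n - 1 := by push_cast [show 1 ≤ n by omega]; ring
    have n2 : ((n - k - 1 : ℕ) : ℝ) = n - k - 1 := by
      rw [Nat.sub_sub]; push_cast [show k + 1 ≤ n by omega]; ring
    have hR : ∃ R, R = r ^ (n - k - 2) := ⟨_, rfl⟩
    have hs : ∃ s, s = r ^ (k - 1) := ⟨_, rfl⟩
    have hq : ∃ q, q = p r ^ (k - 1) := ⟨_, rfl⟩
    obtain ⟨R, hR⟩ := hR
    obtain ⟨s, hs⟩ := hs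
    obtain ⟨q, hq⟩ := hq
    have e1 : r ^ (n - k) = R * r ^ 2 := by rw [hR, ← pow_add]; congr 1; omega
    have e2 : r ^ (n - 1) = R * s * r ^ 2 := by rw [hR, hs, ← pow_add, ← pow_add]; congr 1; omega
    have e3 : r ^ (n - 1 - 1) = R * s * r := by
      rw [hR, hs, ← pow_add, ← pow_succ]; congr 1; omega
    have e4 : r ^ (n - k - 1) = R * r := by rw [hR, ← pow_succ]; congr 1; omega
    have e5 : r ^ (n - k - 1 - 1) = R := by rw [hR]; congr 1
    have e6 : p r ^ (k + 1) = q * p r ^ 2 := by rw [hq, ← pow_add]; congr 1; omega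
    have e7 : p r ^ (k + 1 - 1) = q * p r := by rw [hq, ← pow_succ]; congr 1; omega
    rw [← hs, ← hq, ← hcdef] at e0
    simp only [hI, hQ]
    rw [hBd', hφd']
    simp only [Pi.pow_apply, Pi.mul_apply]
    rw [e6, e7, e2, e3, e4, e5, e1, ← hq, n1, n2]
    push_cast
    generalize accel n k g v p r = A at *
    have hkr : (k : ℝ) ≠ 0 := by positivity
    have hkr1 : (k : ℝ) + 1 ≠ 0 := by positivity
    have e8 : s * g (v r) = c * q * (A + ((n : ℝ) - k) / k * (p r / r)) := e0
    have e9 : c * (R * r ^ 2 * (q * p r ^ 2) * (deriv ξ r ^ 2 +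
        2 * (((k : ℝ) - 1) / (k + 1)) * (ξ r * deriv ξ r / r) -
        (2 * n - k - 1) / (k + 1) * (ξ r ^ 2 / r ^ 2))) =
        c * (R * r ^ 2 * q) * (A * ξ r + p r * deriv ξ r) ^ 2 -
        (((n - 1) * R * r * p r * ξ r ^ 2 + R * r ^ 2 * A * ξ r ^ 2 +
          R * r ^ 2 * p r * (2 * ξ r * deriv ξ r)) *
          (c * q * (A + ((n : ℝ) - k) / k * (p r / r))) -
        c * μ * ((n - k - 1) * R * (q * p r ^ 2) * ξ r ^ 2 +
          R * r * ((k + 1) * (q * p r) * A) * ξ r ^ 2 +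
          R * r * (q * p r ^ 2) * (2 * ξ r * deriv ξ r))) := by
      rw [hμ]
      field_simp
      ring
    rw [e9, ← e8]
    ring
  have hIab : IntervalIntegrable I volume a b := by
    rw [intervalIntegrable_iff_integrableOn_Icc_of_le hab.le]
    exact hI1.mono_set hsub'
  have hQab : IntervalIntegrable Q volume a b := by
    have h1 : IntervalIntegrable (fun r => c⁻¹ * (I r - deriv B r)) volume a b :=
      (hIab.sub hBi).const_mul _
    refine h1.congr_ae ?_
    rw [Filter.EventuallyEq, ae_restrict_iff' measurableSet_uIoc, uIoc_of_le hab.le]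
    filter_upwards [hkey] with r hr hrI
    rw [← hr hrI]; field_simp
  have hzI : ∀ r ∈ Ioo (0 : ℝ) 1 \ Ioc a b, I r = 0 := by
    intro r hr
    have h1 : r ∉ tsupport ξ := fun h => hr.2 (Ioo_subset_Ioc_self (hKab h))
    have h2 : r ∉ tsupport (deriv fun r => p r * ξ r) := fun h =>
      h1 (hφs (tsupport_deriv_subset h))
    simp only [hI, image_eq_zero_of_notMem_tsupport h1, image_eq_zero_of_notMem_tsupport h2]
    ring
  have hzQ : ∀ r ∈ Ioo (0 : ℝ) 1 \ Ioc a b, Q r = 0 := by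
    intro r hr
    have h1 : r ∉ tsupport ξ := fun h => hr.2 (Ioo_subset_Ioc_self (hKab h))
    have h2 : r ∉ tsupport (deriv ξ) := fun h => h1 (tsupport_deriv_subset h)
    simp only [hQ, image_eq_zero_of_notMem_tsupport h1, image_eq_zero_of_notMem_tsupport h2]
    ring
  have hsub'' : Ioc a b ⊆ Ioo 0 1 := Ioc_subset_Icc_self.trans hsub'
  have hIint : ∫ r in Ioo (0 : ℝ) 1, I r = ∫ r in a..b, I r := by
    rw [intervalIntegral.integral_of_le hab.le]
    exact setIntegral_eq_of_subset_of_forall_sdiff_eq_zero measurableSet_Ioo hsub'' hzI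
  have hQint : ∫ r in Ioo (0 : ℝ) 1, Q r = ∫ r in a..b, Q r := by
    rw [intervalIntegral.integral_of_le hab.le]
    exact setIntegral_eq_of_subset_of_forall_sdiff_eq_zero measurableSet_Ioo hsub'' hzQ
  refine ⟨?_, ?_⟩
  · rw [intervalIntegrable_iff_integrableOn_Ioc_of_le hab.le] at hQab
    exact hQab.of_forall_sdiff_eq_zero measurableSet_Ioo hzQ
  · have h1 : c * ∫ r in a..b, Q r = (∫ r in a..b, I r) - ∫ r in a..b, deriv B r := by
      rw [← intervalIntegral.integral_sub hIab hBi, ← intervalIntegral.integral_const_mul]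
      refine intervalIntegral.integral_congr_ae ?_
      rw [uIoc_of_le hab.le]
      exact hkey
    rw [hB0, sub_zero, ← hIint] at h1
    rw [hQint]
    refine nonneg_of_mul_nonneg_right ?_ hc
    rw [h1]; exact hI2

end IsRadialSolution

end KHessian

namespace KHessian

/-! ### The test function and its cutoff error -/

variable {n k : ℕ} {g v p : ℝ → ℝ}

theorem deriv_smoothTransition_of_nonpos {x : ℝ} (hx : x ≤ 0) :
    deriv Real.smoothTransition x = 0 := by
  refine IsLocalMin.deriv_eq_zero (Filter.Eventually.of_forall fun y => ?_)
  rw [Real.smoothTransition.zero_of_nonpos hx]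
  exact Real.smoothTransition.nonneg y

theorem deriv_smoothTransition_of_one_le {x : ℝ} (hx : 1 ≤ x) :
    deriv Real.smoothTransition x = 0 := by
  refine IsLocalMax.deriv_eq_zero (Filter.Eventually.of_forall fun y => ?_)
  rw [Real.smoothTransition.one_of_one_le hx]
  exact Real.smoothTransition.le_one y

theorem exists_abs_deriv_smoothTransition_le :
    ∃ M, ∀ x, |deriv Real.smoothTransition x| ≤ M := by
  have hc : Continuous (deriv Real.smoothTransition) :=
    (Real.smoothTransition.contDiff (n := 1)).continuous_deriv le_rfl
  obtain ⟨M, hM⟩ := isCompact_Icc.exists_bound_of_continuousOn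
    (hc.continuousOn (s := Icc (0 : ℝ) 1))
  refine ⟨M, fun x => ?_⟩
  by_cases hx : x ∈ Icc (0 : ℝ) 1
  · exact hM x hx
  · have h0 : deriv Real.smoothTransition x = 0 := by
      rcases le_or_gt x 0 with h | h
      · exact deriv_smoothTransition_of_nonpos h
      · refine deriv_smoothTransition_of_one_le ?_
        by_contra hlt
        exact hx ⟨h.le, (not_le.1 hlt).le⟩
    rw [h0, abs_zero]
    exact (norm_nonneg _).trans (hM 0 (by simp))

theorem rpow_abs_le_rpow {a x : ℝ} (ha : 0 < a) (hax : a ≤ x) (hx : x ≤ 1) (e : ℝ) :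
    a ^ |e| ≤ x ^ e :=
  (Real.rpow_le_rpow ha.le hax (abs_nonneg e)).trans
    (Real.rpow_le_rpow_of_exponent_ge (ha.trans_le hax) hx (le_abs_self e))

/-- The integrand of the weighted Hardy-type inequality for
`ξ = r (ρ² + r²)^{-(1+σ)/2} χ`, in terms of the logarithmic derivative `t` of
`r (ρ² + r²)^{-(1+σ)/2}` with respect to `log r`. -/
theorem quadratic_form_test {ρ σ b Λ r χ' : ℝ} {χ : ℝ → ℝ} (hρ : 0 < ρ) (hr : 0 < r)
    (hσ : σ * (σ - 2 * b) = Λ) (hχ : HasDerivAt χ χ' r) :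
    deriv (fun r => r * (ρ ^ 2 + r ^ 2) ^ (-(1 + σ) / 2) * χ r) r ^ 2 +
      2 * b * (r * (ρ ^ 2 + r ^ 2) ^ (-(1 + σ) / 2) * χ r *
        deriv (fun r => r * (ρ ^ 2 + r ^ 2) ^ (-(1 + σ) / 2) * χ r) r / r) -
      Λ * ((r * (ρ ^ 2 + r ^ 2) ^ (-(1 + σ) / 2) * χ r) ^ 2 / r ^ 2) =
    (ρ ^ 2 + r ^ 2) ^ (-(1 + σ)) *
      (χ r ^ 2 * ((1 - (1 + σ) * (r ^ 2 / (ρ ^ 2 + r ^ 2)) + σ) *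
        (1 - (1 + σ) * (r ^ 2 / (ρ ^ 2 + r ^ 2)) - (σ - 2 * b))) +
      2 * (1 - (1 + σ) * (r ^ 2 / (ρ ^ 2 + r ^ 2)) + b) * (χ r * (r * χ')) + (r * χ') ^ 2) := by
  have hf : 0 < ρ ^ 2 + r ^ 2 := by positivity
  have hfd : HasDerivAt (fun r : ℝ => ρ ^ 2 + r ^ 2) (2 * r) r := by
    simpa using (hasDerivAt_pow 2 r).const_add (ρ ^ 2)
  have hz := hfd.rpow_const (p := -(1 + σ) / 2) (Or.inl hf.ne')
  rw [Real.rpow_sub_one hf.ne'] at hz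
  have hd := (((hasDerivAt_id r).mul hz).mul hχ).deriv
  have hd' : deriv (fun r => r * (ρ ^ 2 + r ^ 2) ^ (-(1 + σ) / 2) * χ r) r = _ := hd
  rw [hd']
  have hzz : (ρ ^ 2 + r ^ 2) ^ (-(1 + σ)) = ((ρ ^ 2 + r ^ 2) ^ (-(1 + σ) / 2)) ^ 2 := by
    rw [← Real.rpow_mul_natCast hf.le]; congr 1; push_cast; ring
  rw [hzz]
  simp only [id_eq, Pi.mul_apply]
  generalize (ρ ^ 2 + r ^ 2) ^ (-(1 + σ) / 2) = z at *
  subst hσ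
  field_simp
  ring

namespace IsRadialSolution

theorem integral_rhs_nonneg (hg0 : ∀ s, 0 ≤ g s) {a b : ℝ}
    (ha : 0 ≤ a) (hab : a ≤ b) : 0 ≤ ∫ s in a..b, s ^ (n - 1) * g (v s) :=
  intervalIntegral.integral_nonneg hab fun _ hs =>
    mul_nonneg (_root_.pow_nonneg (ha.trans hs.1) _) (hg0 _)

/-- If the slope is positive at `ρ`, it is positive on a maximal interval `(r₁, 1]` containing
`ρ`, and the right-hand side vanishes on `(0, r₁)`. -/
theorem exists_zero_radius (h : IsRadialSolution n k g v p) (hg0 : ∀ s, 0 ≤ g s) (hk : 1 ≤ k)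
    (hkn : k ≤ n) {ρ : ℝ} (hρ : 0 < ρ) (hρ1 : ρ ≤ 1) (hpρ : 0 < p ρ) :
    ∃ r₁, 0 ≤ r₁ ∧ r₁ < ρ ∧ (∀ r ∈ Ioc r₁ 1, 0 < p r) ∧
      ∫ s in (0 : ℝ)..r₁, s ^ (n - 1) * g (v s) = 0 := by
  have hc := hessianConst_pos hkn
  have hk0 : k ≠ 0 := by omega
  set J : ℝ → ℝ := fun r => ∫ s in (0 : ℝ)..r, s ^ (n - 1) * g (v s) with hJ
  have hJc : ContinuousOn J (Icc 0 ρ) := by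
    have := (h.integrable_rhs.absolutelyContinuousOnInterval_intervalIntegral
      (c := 0) (by simp)).continuousOn
    rw [uIcc_of_le zero_le_one] at this
    exact this.mono (Icc_subset_Icc_right hρ1)
  have hcl : IsCompact (Icc 0 ρ ∩ J ⁻¹' {0}) :=
    isCompact_Icc.of_isClosed_subset (hJc.preimage_isClosed_of_isClosed isClosed_Icc
      isClosed_singleton) inter_subset_left
  obtain ⟨r₁, ⟨hr₁, hr₁0⟩, hmax⟩ := hcl.exists_isGreatest ⟨0, ⟨le_rfl, hρ.le⟩, by simp [hJ]⟩
  have hpos : ∀ r ∈ Ioc (0 : ℝ) 1, 0 < p r ↔ J r ≠ 0 := by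
    intro r hr
    have hf := h.flux r hr
    have hr0 := hr.1
    have hk' : (k : ℝ) / hessianConst n k ≠ 0 := by positivity
    constructor
    · intro hp hJ0
      rw [hJ] at hJ0
      simp only at hJ0
      rw [hJ0, mul_zero] at hf
      have : 0 < r ^ (n - k) * p r ^ k := by positivity
      linarith
    · intro hJ0
      refine lt_of_le_of_ne (h.nonneg r hr0) fun hp => ?_
      rw [← hp, zero_pow hk0, mul_zero] at hf
      exact mul_ne_zero hk' hJ0 hf.symm
  have hr₁ρ : r₁ < ρ := by
    refine lt_of_le_of_ne hr₁.2 fun he => ?_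
    exact (hpos ρ ⟨hρ, hρ1⟩).1 hpρ (he ▸ hr₁0)
  refine ⟨r₁, hr₁.1, hr₁ρ, fun r hr => ?_, hr₁0⟩
  have hr0 : 0 < r := hr₁.1.trans_lt hr.1
  rw [hpos r ⟨hr0, hr.2⟩]
  intro hJ0
  rcases le_or_gt r ρ with hle | hlt
  · exact absurd (hmax ⟨⟨hr0.le, hle⟩, hJ0⟩) (not_le.2 hr.1)
  · have h1 := h.flux_mono hg0 hkn hρ hlt.le hr.2
    have h2 := h.flux r ⟨hr0, hr.2⟩
    rw [hJ] at hJ0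
    simp only at hJ0
    rw [hJ0, mul_zero] at h2
    have : 0 < ρ ^ (n - k) * p ρ ^ k := by positivity
    linarith

theorem exists_lipschitzOnWith_rhs (h : IsRadialSolution n k g v p)
    (hg : LocallyLipschitz g) {a b : ℝ} (ha : 0 < a) :
    ∃ K, LipschitzOnWith K (fun r => g (v r)) (Icc a b) := by
  have hsub : Icc a b ⊆ Ioi 0 := fun x hx => ha.trans_le hx.1
  obtain ⟨K, hK⟩ := (h.contDiffOn_profile.mono hsub).exists_lipschitzOnWith (by decide)
    (convex_Icc _ _) isCompact_Icc
  obtain ⟨K', hK'⟩ := LocallyLipschitzOn.exists_lipschitzOnWith_of_compact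
    (isCompact_Icc.image_of_continuousOn (h.continuousOn_profile.mono hsub))
    hg.locallyLipschitzOn
  exact ⟨_, hK'.comp hK (mapsTo_image v _)⟩

/-- The flux has an interior minimum at `r₁`, so its derivative vanishes there. -/
theorem rhs_eq_zero (h : IsRadialSolution n k g v p) (hg : Continuous g) (hg0 : ∀ s, 0 ≤ g s)
    {r₁ : ℝ} (hr₁ : 0 < r₁) (hr₁' : r₁ < 1) (hJ : ∫ s in (0 : ℝ)..r₁, s ^ (n - 1) * g (v s) = 0) :
    g (v r₁) = 0 := by
  have hd := h.hasDerivAt_integral hg ⟨hr₁, hr₁'.le⟩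
  have hmin : IsLocalMin (fun r => ∫ s in (0 : ℝ)..r, s ^ (n - 1) * g (v s)) r₁ := by
    filter_upwards [lt_mem_nhds hr₁] with r hr
    rw [hJ]
    exact integral_rhs_nonneg hg0 le_rfl hr.le
  exact (mul_eq_zero.1 (hmin.hasDerivAt_eq_zero hd)).resolve_left (by positivity)

/-- The energy density vanishes to second order at a positive radius up to which the flux
vanishes. -/
theorem exists_energy_le_sq (h : IsRadialSolution n k g v p) (hg : LocallyLipschitz g)
    (hg0 : ∀ s, 0 ≤ g s) (hkn : k ≤ n) {r₁ : ℝ} (hr₁ : 0 < r₁) (hr₁' : r₁ < 1)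
    (hJ : ∫ s in (0 : ℝ)..r₁, s ^ (n - 1) * g (v s) = 0) :
    ∃ C, ∀ r ∈ Icc r₁ 1, r ^ (n - k) * p r ^ (k + 1) ≤ C * (r - r₁) ^ 2 := by
  have hc := hessianConst_pos hkn
  obtain ⟨K, hK⟩ := h.exists_lipschitzOnWith_rhs hg hr₁ (b := 1)
  have hsub : Icc r₁ 1 ⊆ Ioi 0 := fun x hx => hr₁.trans_le hx.1
  obtain ⟨M, hM⟩ := isCompact_Icc.exists_bound_of_continuousOn (h.continuousOn.mono hsub)
  have hg1 := h.rhs_eq_zero hg.continuous hg0 hr₁ hr₁' hJ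
  refine ⟨k / hessianConst n k * K * M, fun r hr => ?_⟩
  have hr0 : 0 < r := hr₁.trans_le hr.1
  have hM0 : p r ≤ M := (le_abs_self _).trans (hM r hr)
  have hp := h.nonneg r hr0
  have hfl := h.flux r ⟨hr0, hr.2⟩
  have hi1 := h.intervalIntegrable_rhs (r := r₁) ⟨hr₁.le, hr₁'.le⟩
  have hi2 := h.intervalIntegrable_rhs (r := r) ⟨hr0.le, hr.2⟩
  rw [← intervalIntegral.integral_add_adjacent_intervals hi1 (hi1.symm.trans hi2), hJ, zero_add]
    at hfl
  have hle : ∫ s in r₁..r, s ^ (n - 1) * g (v s) ≤ (K * (r - r₁)) * (r - r₁) := by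
    have h1 := intervalIntegral.integral_mono_on (g := fun _ => (K : ℝ) * (r - r₁)) hr.1
      (hi1.symm.trans hi2) intervalIntegrable_const fun s hs => ?_
    · refine h1.trans ?_
      rw [intervalIntegral.integral_const, smul_eq_mul]
      exact le_of_eq (by ring)
    · have hs1 : s ≤ 1 := hs.2.trans hr.2
      have h2 := hK.dist_le_mul s ⟨hs.1, hs1⟩ r₁ ⟨le_rfl, hr₁'.le⟩
      rw [Real.dist_eq, Real.dist_eq, hg1, sub_zero, abs_of_nonneg (hg0 _),
        abs_of_nonneg (sub_nonneg.2 hs.1)] at h2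
      have hs0 : 0 ≤ s := hr₁.le.trans hs.1
      calc s ^ (n - 1) * g (v s) ≤ 1 * g (v s) :=
            mul_le_mul_of_nonneg_right (pow_le_one₀ hs0 hs1) (hg0 _)
        _ ≤ K * (s - r₁) := by rw [one_mul]; exact h2
        _ ≤ K * (r - r₁) := by gcongr; exact hs.2
  have hd0 : 0 ≤ r - r₁ := sub_nonneg.2 hr.1
  calc r ^ (n - k) * p r ^ (k + 1) = (r ^ (n - k) * p r ^ k) * p r := by ring
    _ ≤ (k / hessianConst n k * (K * (r - r₁) * (r - r₁))) * M := by
        rw [hfl]; gcongr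
    _ = _ := by ring

theorem integrableOn_cutoff_error (h : IsRadialSolution n k g v p) {r₁ ε : ℝ} (hr₁ : 0 ≤ r₁)
    (hε : 0 < ε) :
    IntegrableOn (fun r => r ^ (n - k) * p r ^ (k + 1) * (1 + r ^ 2 / ε ^ 2))
      (Ioo (r₁ + ε) (r₁ + 2 * ε)) := by
  have hp : ContinuousOn p (Icc (r₁ + ε) (r₁ + 2 * ε)) := h.continuousOn.mono fun x hx =>
    lt_of_lt_of_le (by linarith : 0 < r₁ + ε) hx.1
  have hPc : ContinuousOn (fun r => r ^ (n - k) * p r ^ (k + 1) * (1 + r ^ 2 / ε ^ 2))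
      (Icc (r₁ + ε) (r₁ + 2 * ε)) :=
    ((continuousOn_pow _).mul (hp.pow _)).mul (by fun_prop)
  exact hPc.integrableOn_Icc.mono_set Ioo_subset_Icc_self

/-- The error made by cutting off the test function on the scale `ε` near `r₁` is negligible. -/
theorem exists_small_cutoff_error (h : IsRadialSolution n k g v p) (hg : LocallyLipschitz g)
    (hg0 : ∀ s, 0 ≤ g s) (hkn : k ≤ n) {r₁ : ℝ} (hr₁ : 0 ≤ r₁) (hr₁' : r₁ < 1)
    (hJ : ∫ s in (0 : ℝ)..r₁, s ^ (n - 1) * g (v s) = 0) {δ η : ℝ} (hδ : 0 < δ) (hη : 0 < η) :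
    ∃ ε, 0 < ε ∧ ε < η ∧ r₁ + 2 * ε < 1 ∧ ∫ r in Ioo (r₁ + ε) (r₁ + 2 * ε),
      r ^ (n - k) * p r ^ (k + 1) * (1 + r ^ 2 / ε ^ 2) ≤ δ := by
  set P : ℝ → ℝ := fun r => r ^ (n - k) * p r ^ (k + 1) with hP
  have hP0 : ∀ r, 0 < r → 0 ≤ P r := fun r hr =>
    mul_nonneg (_root_.pow_nonneg hr.le _) (_root_.pow_nonneg (h.nonneg r hr) _)
  -- at the origin the finite energy suffices; at a positive `r₁` the energy density is `O(ε²)`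
  rcases hr₁.eq_or_lt with h0 | hpos
  · subst h0
    have hPi : IntervalIntegrable P volume 0 1 := by
      rw [intervalIntegrable_iff_integrableOn_Ioo_of_le zero_le_one]; exact h.energy
    have hcont := (hPi.absolutelyContinuousOnInterval_intervalIntegral
      (c := 0) (by simp)).continuousOn
    rw [uIcc_of_le zero_le_one] at hcont
    have ht := (hcont 0 (by simp)).tendsto
    rw [intervalIntegral.integral_same] at ht
    have hev := (ht.eventually (gt_mem_nhds (show (0 : ℝ) < δ / 5 by positivity)))
    rw [eventually_nhdsWithin_iff, Metric.eventually_nhds_iff] at hev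
    obtain ⟨e, he, hev⟩ := hev
    have hm : 0 < min (min (e / 4) (η / 2)) (1 / 4) := by positivity
    obtain ⟨ε, hε⟩ : ∃ ε, ε = min (min (e / 4) (η / 2)) (1 / 4) := ⟨_, rfl⟩
    rw [← hε] at hm
    have hε1 : ε ≤ e / 4 := hε ▸ (min_le_left _ _).trans (min_le_left _ _)
    have hε2 : ε ≤ η / 2 := hε ▸ (min_le_left _ _).trans (min_le_right _ _)
    have hε3 : ε ≤ 1 / 4 := hε ▸ min_le_right _ _
    refine ⟨ε, hm, by linarith, by linarith, ?_⟩
    have h5 := hev (y := 2 * ε) (by rw [Real.dist_eq, sub_zero, abs_of_pos (by linarith)]; linarith)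
      ⟨by linarith, by linarith⟩
    have hPi2 : IntegrableOn P (Ioc 0 (2 * ε)) :=
      ((intervalIntegrable_iff_integrableOn_Ioc_of_le zero_le_one).1 hPi).mono_set
        (Ioc_subset_Ioc_right (by linarith))
    have hsub : Ioo (0 + ε) (0 + 2 * ε) ⊆ Ioc 0 (2 * ε) := fun x hx =>
      ⟨by linarith [hx.1], by linarith [hx.2]⟩
    calc ∫ r in Ioo (0 + ε) (0 + 2 * ε), P r * (1 + r ^ 2 / ε ^ 2)
        ≤ ∫ r in Ioo (0 + ε) (0 + 2 * ε), 5 * P r := by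
          refine setIntegral_mono_on (h.integrableOn_cutoff_error le_rfl hm)
            ((hPi2.mono_set hsub).const_mul 5) measurableSet_Ioo fun r hr => ?_
          have hr0 : 0 < r := (hsub hr).1
          have h2 : r ^ 2 / ε ^ 2 ≤ 4 := by
            rw [div_le_iff₀ (by positivity)]
            nlinarith [(hsub hr).2]
          nlinarith [hP0 r hr0]
      _ = 5 * ∫ r in Ioo (0 + ε) (0 + 2 * ε), P r := integral_const_mul _ _
      _ ≤ 5 * ∫ r in Ioc 0 (2 * ε), P r := by
          refine mul_le_mul_of_nonneg_left (setIntegral_mono_set hPi2 ?_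
            (LE.le.eventuallyLE hsub)) (by norm_num)
          exact (ae_restrict_mem measurableSet_Ioc).mono fun x hx => hP0 x hx.1
      _ ≤ δ := by
          rw [← intervalIntegral.integral_of_le (by linarith)]
          linarith
  · obtain ⟨C, hC⟩ := h.exists_energy_le_sq hg hg0 hkn hpos hr₁' hJ
    have hm : 0 < min (min (δ / (8 * (|C| + 1))) (η / 2)) ((1 - r₁) / 4) := by
      have : 0 < 1 - r₁ := by linarith
      positivity
    obtain ⟨ε, hε⟩ : ∃ ε, ε = min (min (δ / (8 * (|C| + 1))) (η / 2)) ((1 - r₁) / 4) := ⟨_, rfl⟩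
    rw [← hε] at hm
    have hε1 : ε ≤ δ / (8 * (|C| + 1)) := hε ▸ (min_le_left _ _).trans (min_le_left _ _)
    have hε2 : ε ≤ η / 2 := hε ▸ (min_le_left _ _).trans (min_le_right _ _)
    have hε3 : ε ≤ (1 - r₁) / 4 := hε ▸ min_le_right _ _
    refine ⟨ε, hm, by linarith, by linarith, ?_⟩
    rw [le_div_iff₀ (by positivity)] at hε1
    calc ∫ r in Ioo (r₁ + ε) (r₁ + 2 * ε), P r * (1 + r ^ 2 / ε ^ 2)
        ≤ ∫ r in Ioo (r₁ + ε) (r₁ + 2 * ε), 8 * (|C| + 1) := by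
          refine setIntegral_mono_on (h.integrableOn_cutoff_error hr₁ hm)
            (integrableOn_const (by simp)) measurableSet_Ioo fun r hr => ?_
          have hr0 : 0 < r := by linarith [hr.1]
          have hr1 : r ≤ 1 := by linarith [hr.2]
          have h1 : P r ≤ (|C| + 1) * (4 * ε ^ 2) := by
            refine (hC r ⟨by linarith [hr.1], hr1⟩).trans ?_
            have hd : (r - r₁) ^ 2 ≤ 4 * ε ^ 2 := by nlinarith [hr.1, hr.2]
            have hCC : C ≤ |C| + 1 := by linarith [le_abs_self C]
            exact mul_le_mul hCC hd (sq_nonneg _) (by positivity)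
          have h2 : 1 + r ^ 2 / ε ^ 2 ≤ 2 / ε ^ 2 := by
            rw [← sub_nonneg]
            have : 2 / ε ^ 2 - (1 + r ^ 2 / ε ^ 2) = ((1 - ε ^ 2) + (1 - r ^ 2)) / ε ^ 2 := by
              field_simp; ring
            rw [this]
            have : ε ≤ 1 := by linarith
            have : 0 ≤ 1 - ε ^ 2 := by nlinarith
            have : 0 ≤ 1 - r ^ 2 := by nlinarith
            positivity
          calc P r * (1 + r ^ 2 / ε ^ 2) ≤ ((|C| + 1) * (4 * ε ^ 2)) * (2 / ε ^ 2) := by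
                gcongr
            _ = _ := by field_simp; ring
      _ = ε * (8 * (|C| + 1)) := by
          rw [setIntegral_const, smul_eq_mul, Measure.real, Real.volume_Ioo,
            ENNReal.toReal_ofReal (by linarith)]
          ring
      _ ≤ δ := hε1

end IsRadialSolution

end KHessian

namespace KHessian

variable {n k : ℕ} {g v p : ℝ → ℝ}

/-! ### The quadratic form and the pointwise estimate of the integrand -/

/-- The middle coefficient `b = (k-1)/(k+1)` of the quadratic form `t² + 2bt - Λ`. -/
noncomputable def hardyMid (k : ℕ) : ℝ := ((k : ℝ) - 1) / (k + 1)

/-- The constant coefficient `Λ = (2n-k-1)/(k+1)` of the quadratic form `t² + 2bt - Λ`. -/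
noncomputable def hardyConst (n k : ℕ) : ℝ := (2 * (n : ℝ) - k - 1) / (k + 1)

/-- The number `σ > 0` such that `-σ` is the negative root of `t² + 2bt - Λ`. -/
noncomputable def hardyRoot (n k : ℕ) : ℝ :=
  hardyMid k + √(hardyMid k ^ 2 + hardyConst n k)

theorem hardyMid_nonneg (hk : 1 ≤ k) : 0 ≤ hardyMid k := by
  have : (1 : ℝ) ≤ k := by exact_mod_cast hk
  exact div_nonneg (by linarith) (by linarith)

/-- The positive root `σ - 2b` of `t² + 2bt - Λ` exceeds `1`, that is, the form is negative at
`t = 1`, which amounts to `n > 2 k`. -/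
theorem one_lt_hardyRoot_sub (hk : 1 ≤ k) (hn : 2 * k + 8 ≤ n) :
    1 < hardyRoot n k - 2 * hardyMid k := by
  have hb := hardyMid_nonneg hk
  have hk1 : (1 : ℝ) ≤ k := by exact_mod_cast hk
  have hn1 : 2 * (k : ℝ) + 8 ≤ n := by exact_mod_cast hn
  have h1 : 1 + 2 * hardyMid k < hardyConst n k := by
    rw [hardyMid, hardyConst, ← sub_pos]
    have : (2 * (n : ℝ) - k - 1) / (k + 1) - (1 + 2 * ((k - 1) / (k + 1))) =
      (2 * n - 4 * k) / (k + 1) := by field_simp; ring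
    rw [this]
    exact div_pos (by linarith) (by linarith)
  have h2 : 1 + hardyMid k < √(hardyMid k ^ 2 + hardyConst n k) := by
    refine Real.lt_sqrt_of_sq_lt ?_
    nlinarith
  rw [hardyRoot]
  linarith

/-- The product of the roots of `t² + 2bt - Λ`. -/
theorem hardyRoot_mul (hk : 1 ≤ k) (hn : 2 * k + 8 ≤ n) :
    hardyRoot n k * (hardyRoot n k - 2 * hardyMid k) = hardyConst n k := by
  have hk1 : (1 : ℝ) ≤ k := by exact_mod_cast hk
  have hn1 : 2 * (k : ℝ) + 8 ≤ n := by exact_mod_cast hn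
  have h0 : 0 ≤ hardyMid k ^ 2 + hardyConst n k := by
    have : 0 ≤ hardyConst n k := div_nonneg (by linarith) (by linarith)
    positivity
  rw [hardyRoot]
  linear_combination Real.sq_sqrt h0

/-- The exponent `(2σ - n + k + 1) / (k + 1)` in terms of `expBase`. -/
theorem hardy_exponent (hk : 1 ≤ k) :
    (2 * hardyRoot n k - n + k + 1) / (k + 1) =
      (expBase n k + (k : ℝ) ^ 2 + 4 * k - 1) / ((k : ℝ) + 1) ^ 2 := by
  have hk1 : (1 : ℝ) ≤ k := by exact_mod_cast hk
  have h1 : hardyMid k ^ 2 + hardyConst n k =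
      (2 * ((k : ℝ) + 1) * n - 4 * k) / ((k : ℝ) + 1) ^ 2 := by
    rw [hardyMid, hardyConst]; field_simp; ring
  rw [hardyRoot, h1, Real.sqrt_div' _ (by positivity), Real.sqrt_sq (by positivity), hardyMid,
    expBase]
  field_simp
  ring

/-- With `t = 1 - (1 + σ) τ ∈ [-σ, 1]` the coefficient of `χ²` is nonpositive, and the cross term is
absorbed by completing the square; what remains is controlled by the cutoff. -/
theorem quadratic_form_le {σ b τ χ y : ℝ} (hb : 0 ≤ b) (hσ : 1 < σ - 2 * b) (hτ : 0 ≤ τ)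
    (hτ1 : τ ≤ 1) :
    χ ^ 2 * ((1 - (1 + σ) * τ + σ) * (1 - (1 + σ) * τ - (σ - 2 * b))) +
      2 * (1 - (1 + σ) * τ + b) * (χ * y) + y ^ 2 ≤ (1 + σ) ^ 2 * χ ^ 2 + 2 * y ^ 2 := by
  have hσ0 : 0 < 1 + σ := by linarith
  set t := 1 - (1 + σ) * τ with ht
  have ht1 : t ≤ 1 := by nlinarith
  have ht2 : -σ ≤ t := by nlinarith
  have h1 : (t + σ) * (t - (σ - 2 * b)) ≤ 0 :=
    mul_nonpos_of_nonneg_of_nonpos (by linarith) (by linarith)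
  have h2 : (t + b) ^ 2 ≤ (1 + σ) ^ 2 := sq_le_sq' (by linarith) (by linarith)
  nlinarith [sq_nonneg ((t + b) * χ - y), sq_nonneg χ, mul_nonneg (sq_nonneg χ) (sub_nonneg.2 h2),
    mul_nonneg (sq_nonneg χ) (neg_nonneg.2 h1)]

/-- The cutoff that vanishes on `(-∞, r₁ + ε]` and on `[3/4, ∞)` and is `1` on
`[r₁ + 2 ε, 1/2]`. -/
noncomputable def radialCutoff (r₁ ε r : ℝ) : ℝ :=
  Real.smoothTransition (3 - 4 * r) * Real.smoothTransition ((r - (r₁ + ε)) / ε)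

theorem contDiff_radialCutoff (r₁ ε : ℝ) : ContDiff ℝ 1 (radialCutoff r₁ ε) := by
  unfold radialCutoff
  have h := Real.smoothTransition.contDiff (n := 1)
  exact (h.comp (by fun_prop)).mul (h.comp (by fun_prop))

theorem hasDerivAt_radialCutoff (r₁ ε r : ℝ) : HasDerivAt (radialCutoff r₁ ε)
    (deriv Real.smoothTransition (3 - 4 * r) * (-4) *
      Real.smoothTransition ((r - (r₁ + ε)) / ε) + Real.smoothTransition (3 - 4 * r) *
      (deriv Real.smoothTransition ((r - (r₁ + ε)) / ε) * (1 / ε))) r := by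
  have h : ∀ x, HasDerivAt Real.smoothTransition (deriv Real.smoothTransition x) x := fun x =>
    ((Real.smoothTransition.contDiff (n := 1)).differentiable (by simp) x).hasDerivAt
  have h1 : HasDerivAt (fun r : ℝ => 3 - 4 * r) (-4) r := by
    simpa using ((hasDerivAt_id r).const_mul 4).const_sub 3
  have h2 : HasDerivAt (fun r : ℝ => (r - (r₁ + ε)) / ε) (1 / ε) r := by
    simpa using ((hasDerivAt_id r).sub_const (r₁ + ε)).div_const ε
  exact ((h _).comp r h1).mul ((h _).comp r h2)

theorem radialCutoff_eq_zero {r₁ ε r : ℝ} (hε : 0 < ε) (hr : r ∉ Icc (r₁ + ε) (3 / 4)) :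
    radialCutoff r₁ ε r = 0 := by
  rw [mem_Icc, not_and_or, not_le, not_le] at hr
  rcases hr with h | h
  · rw [radialCutoff, Real.smoothTransition.zero_of_nonpos (x := (r - (r₁ + ε)) / ε)
      (div_nonpos_of_nonpos_of_nonneg (by linarith) hε.le), mul_zero]
  · rw [radialCutoff, Real.smoothTransition.zero_of_nonpos (x := 3 - 4 * r) (by linarith),
      zero_mul]

/-- The pointwise estimate of the integrand tested with
`ξ = r (ρ² + r²)^{-(1+σ)/2} χ`: it is negative on `(ρ, 2ρ)`, and positive at most where the
cutoff `χ` is not constant. -/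
theorem test_integrand_le {σ b r₁ ε ρ r M : ℝ} (hb : 0 ≤ b) (hσ : 1 < σ - 2 * b)
    (hM : ∀ x, |deriv Real.smoothTransition x| ≤ M) (hr₁ : 0 ≤ r₁) (hε : 0 < ε)
    (hρε : r₁ + 2 * ε < ρ) (hρ : ρ ≤ 1 / 4) (hr : r ∈ Ioo (0 : ℝ) 1) :
    (ρ ^ 2 + r ^ 2) ^ (-(1 + σ)) *
      (radialCutoff r₁ ε r ^ 2 * ((1 - (1 + σ) * (r ^ 2 / (ρ ^ 2 + r ^ 2)) + σ) *
        (1 - (1 + σ) * (r ^ 2 / (ρ ^ 2 + r ^ 2)) - (σ - 2 * b))) +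
      2 * (1 - (1 + σ) * (r ^ 2 / (ρ ^ 2 + r ^ 2)) + b) *
        (radialCutoff r₁ ε r * (r * deriv (radialCutoff r₁ ε) r)) +
        (r * deriv (radialCutoff r₁ ε) r) ^ 2) ≤
    (Ioo (1 / 2 : ℝ) 1).indicator
        (fun _ => (1 / 4 : ℝ) ^ (-(1 + σ)) * ((1 + σ) ^ 2 + 32 * M ^ 2)) r +
      (Ioo (r₁ + ε) (r₁ + 2 * ε)).indicator
        (fun r => (ρ ^ 2) ^ (-(1 + σ)) * ((1 + σ) ^ 2 + 2 * M ^ 2) * (1 + r ^ 2 / ε ^ 2)) r -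
      (Ioo ρ (2 * ρ)).indicator (fun _ => (ρ ^ 2) ^ (-(1 + σ)) *
        ((5 : ℝ) ^ (-(1 + σ)) * ((1 + σ) / 5 * (σ - 2 * b - 1)))) r := by
  obtain ⟨hr0, hr1⟩ := hr
  have hρ0 : 0 < ρ := by linarith
  have hσ0 : 0 < 1 + σ := by linarith
  have hf : 0 < ρ ^ 2 + r ^ 2 := by positivity
  have hτ0 : 0 ≤ r ^ 2 / (ρ ^ 2 + r ^ 2) := by positivity
  have hτ1 : r ^ 2 / (ρ ^ 2 + r ^ 2) ≤ 1 := by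
    rw [div_le_one hf]; nlinarith
  have hM' : ∀ x, deriv Real.smoothTransition x ^ 2 ≤ M ^ 2 := fun x => by
    rw [← sq_abs]; exact pow_le_pow_left₀ (abs_nonneg _) (hM x) 2
  have hz0 : 0 ≤ (ρ ^ 2 + r ^ 2) ^ (-(1 + σ)) := by positivity
  have hχd := (hasDerivAt_radialCutoff r₁ ε r).deriv
  have hform := fun χ y => quadratic_form_le (χ := χ) (y := y) hb hσ hτ0 hτ1
  have hST : ∀ x, Real.smoothTransition x ^ 2 ≤ 1 := fun x =>
    pow_le_one₀ (Real.smoothTransition.nonneg x) (Real.smoothTransition.le_one x)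
  rcases le_or_gt r (r₁ + ε) with c1 | c1
  -- the cutoff vanishes near `r`
  · have ha : (r - (r₁ + ε)) / ε ≤ 0 := div_nonpos_of_nonpos_of_nonneg (by linarith) hε.le
    rw [Real.smoothTransition.zero_of_nonpos ha, deriv_smoothTransition_of_nonpos ha] at hχd
    rw [hχd, radialCutoff, Real.smoothTransition.zero_of_nonpos ha,
      indicator_of_notMem (by simp only [mem_Ioo, not_and_or, not_lt]; left; linarith),
      indicator_of_notMem (by simp only [mem_Ioo, not_and_or, not_lt]; left; linarith),
      indicator_of_notMem (by simp only [mem_Ioo, not_and_or, not_lt]; left; linarith)]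
    simp
  · rcases lt_or_ge r (r₁ + 2 * ε) with c2 | c2
    -- the inner transition layer
    · have ha : 1 ≤ 3 - 4 * r := by linarith
      rw [Real.smoothTransition.one_of_one_le ha, deriv_smoothTransition_of_one_le ha] at hχd
      rw [hχd, radialCutoff, Real.smoothTransition.one_of_one_le ha,
        indicator_of_notMem (by simp only [mem_Ioo, not_and_or, not_lt]; left; linarith),
        indicator_of_mem (by exact ⟨c1, c2⟩),
        indicator_of_notMem (by simp only [mem_Ioo, not_and_or, not_lt]; left; linarith)]
      simp only [zero_mul, one_mul, zero_add, sub_zero]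
      set x := (r - (r₁ + ε)) / ε
      have hz : (ρ ^ 2 + r ^ 2) ^ (-(1 + σ)) ≤ (ρ ^ 2) ^ (-(1 + σ)) :=
        Real.rpow_le_rpow_of_nonpos (by positivity) (by nlinarith) (by linarith)
      have h1 := hform (Real.smoothTransition x) (r * (deriv Real.smoothTransition x * (1 / ε)))
      rw [mul_assoc ((ρ ^ 2) ^ (-(1 + σ)))]
      refine (mul_le_mul_of_nonneg_left h1 hz0).trans (mul_le_mul hz ?_ (by positivity)
        (by positivity))
      have e : (r * (deriv Real.smoothTransition x * (1 / ε))) ^ 2 =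
          deriv Real.smoothTransition x ^ 2 * (r ^ 2 / ε ^ 2) := by field_simp
      rw [e]
      have h2 : deriv Real.smoothTransition x ^ 2 * (r ^ 2 / ε ^ 2) ≤ M ^ 2 * (r ^ 2 / ε ^ 2) :=
        mul_le_mul_of_nonneg_right (hM' x) (by positivity)
      have h3 : (1 + σ) ^ 2 * Real.smoothTransition x ^ 2 ≤ (1 + σ) ^ 2 * 1 :=
        mul_le_mul_of_nonneg_left (hST x) (by positivity)
      have h4 : 0 ≤ (1 + σ) ^ 2 * (r ^ 2 / ε ^ 2) := by positivity
      nlinarith [sq_nonneg M]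
    · have ha : 1 ≤ (r - (r₁ + ε)) / ε := by rw [le_div_iff₀ hε]; linarith
      rw [Real.smoothTransition.one_of_one_le ha, deriv_smoothTransition_of_one_le ha] at hχd
      rw [hχd, radialCutoff, Real.smoothTransition.one_of_one_le ha]
      rw [indicator_of_notMem (s := Ioo (r₁ + ε) (r₁ + 2 * ε))
        (by simp only [mem_Ioo, not_and_or, not_lt]; right; exact c2)]
      rcases le_or_gt r (1 / 2) with c3 | c3
      -- the cutoff is `1`, and the form is `(t + σ) (t - (σ - 2 b)) ≤ 0`
      · have hb1 : 1 ≤ 3 - 4 * r := by linarith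
        rw [Real.smoothTransition.one_of_one_le hb1, deriv_smoothTransition_of_one_le hb1,
          indicator_of_notMem (s := Ioo (1 / 2 : ℝ) 1)
            (by simp only [mem_Ioo, not_and_or, not_lt]; left; exact c3)]
        simp only [zero_mul, one_mul, mul_zero, add_zero, one_pow, zero_sub]
        have e1 : 1 - (1 + σ) * (r ^ 2 / (ρ ^ 2 + r ^ 2)) + σ =
            (1 + σ) * (ρ ^ 2 / (ρ ^ 2 + r ^ 2)) := by field_simp; ring
        have e2 : 1 - (1 + σ) * (r ^ 2 / (ρ ^ 2 + r ^ 2)) - (σ - 2 * b) ≤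
            -(σ - 2 * b - 1) := by nlinarith
        have e3 : 0 ≤ 1 - (1 + σ) * (r ^ 2 / (ρ ^ 2 + r ^ 2)) + σ := by rw [e1]; positivity
        by_cases hm : r ∈ Ioo ρ (2 * ρ)
        -- for `r < 2 ρ` the factor `t + σ` is at least `(1 + σ) / 5`
        · rw [indicator_of_mem hm]
          have e4 : (1 + σ) / 5 ≤ 1 - (1 + σ) * (r ^ 2 / (ρ ^ 2 + r ^ 2)) + σ := by
            rw [e1, div_eq_mul_inv]
            refine mul_le_mul_of_nonneg_left ?_ hσ0.le
            rw [le_div_iff₀ hf]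
            nlinarith [hm.1, hm.2]
          have hz : (ρ ^ 2) ^ (-(1 + σ)) * (5 : ℝ) ^ (-(1 + σ)) ≤ (ρ ^ 2 + r ^ 2) ^ (-(1 + σ)) := by
            rw [← Real.mul_rpow (by positivity) (by norm_num)]
            exact Real.rpow_le_rpow_of_nonpos hf (by nlinarith [hm.1, hm.2]) (by linarith)
          have h5 : (1 + σ) / 5 * (σ - 2 * b - 1) ≤
              (1 - (1 + σ) * (r ^ 2 / (ρ ^ 2 + r ^ 2)) + σ) *
                -(1 - (1 + σ) * (r ^ 2 / (ρ ^ 2 + r ^ 2)) - (σ - 2 * b)) :=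
            mul_le_mul e4 (by linarith) (by linarith) e3
          have h6 : (ρ ^ 2) ^ (-(1 + σ)) * (5 : ℝ) ^ (-(1 + σ)) * ((1 + σ) / 5 * (σ - 2 * b - 1)) ≤
              _ := mul_le_mul hz h5 (mul_nonneg (by positivity) (by linarith)) hz0
          linarith
        · rw [indicator_of_notMem hm]
          have : (1 - (1 + σ) * (r ^ 2 / (ρ ^ 2 + r ^ 2)) + σ) *
              (1 - (1 + σ) * (r ^ 2 / (ρ ^ 2 + r ^ 2)) - (σ - 2 * b)) ≤ 0 :=
            mul_nonpos_of_nonneg_of_nonpos e3 (by linarith)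
          have := mul_nonpos_of_nonneg_of_nonpos hz0 this
          simpa using this
      -- the outer transition layer
      · rw [indicator_of_mem (show r ∈ Ioo (1 / 2 : ℝ) 1 from ⟨c3, hr1⟩),
          indicator_of_notMem (by simp only [mem_Ioo, not_and_or, not_lt]; right; linarith)]
        simp only [zero_mul, mul_one, mul_zero, add_zero, sub_zero]
        set x := 3 - 4 * r
        have hz : (ρ ^ 2 + r ^ 2) ^ (-(1 + σ)) ≤ (1 / 4 : ℝ) ^ (-(1 + σ)) :=
          Real.rpow_le_rpow_of_nonpos (by norm_num) (by nlinarith) (by linarith)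
        have h1 := hform (Real.smoothTransition x) (r * (deriv Real.smoothTransition x * -4))
        refine (mul_le_mul_of_nonneg_left h1 hz0).trans (mul_le_mul hz ?_ (by positivity)
          (by positivity))
        have e : (r * (deriv Real.smoothTransition x * -4)) ^ 2 =
            r ^ 2 * (16 * deriv Real.smoothTransition x ^ 2) := by ring
        rw [e]
        have h2 : r ^ 2 * (16 * deriv Real.smoothTransition x ^ 2) ≤ 1 * (16 * M ^ 2) :=
          mul_le_mul (by nlinarith) (by linarith [hM' x]) (by positivity) (by norm_num)
        have h3 : (1 + σ) ^ 2 * Real.smoothTransition x ^ 2 ≤ (1 + σ) ^ 2 * 1 :=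
          mul_le_mul_of_nonneg_left (hST x) (by positivity)
        linarith

end KHessian

namespace KHessian

variable {n k : ℕ} {g v p : ℝ → ℝ}

/-! ### The pointwise bound of the slope -/

theorem isTestFunction_radial {r₁ ε ρ e : ℝ} (hε : 0 < ε) (hρ : 0 < ρ) :
    ContDiff ℝ 1 (fun r => r * (ρ ^ 2 + r ^ 2) ^ e * radialCutoff r₁ ε r) ∧
    HasCompactSupport (fun r => r * (ρ ^ 2 + r ^ 2) ^ e * radialCutoff r₁ ε r) ∧
    tsupport (fun r => r * (ρ ^ 2 + r ^ 2) ^ e * radialCutoff r₁ ε r) ⊆ Ioo r₁ 1 := by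
  have hs : tsupport (fun r => r * (ρ ^ 2 + r ^ 2) ^ e * radialCutoff r₁ ε r) ⊆
      Icc (r₁ + ε) (3 / 4) := by
    refine closure_minimal (fun r hr => ?_) isClosed_Icc
    by_contra hn
    exact hr (by simp only [radialCutoff_eq_zero hε hn, mul_zero])
  refine ⟨?_, isCompact_Icc.of_isClosed_subset (isClosed_tsupport _) hs,
    hs.trans (Icc_subset_Ioo (by linarith) (by norm_num))⟩
  refine (contDiff_id.mul (ContDiff.rpow_const_of_ne (by fun_prop) fun r => ?_)).mul
    (contDiff_radialCutoff r₁ ε)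
  positivity

namespace IsRadialSolution

/-- The weighted Hardy-type inequality with the concrete test function, before the cutoff scale
`ε` is sent to zero. -/
theorem integral_le_of_cutoff (h : IsRadialSolution n k g v p) (hg : LocallyLipschitz g)
    (hk : 1 ≤ k) (hn : 2 * k + 8 ≤ n) {M : ℝ} (hM : ∀ x, |deriv Real.smoothTransition x| ≤ M)
    {r₁ ε ρ : ℝ} (hr₁ : 0 ≤ r₁) (hε : 0 < ε) (hρε : r₁ + 2 * ε < ρ) (hρ : ρ ≤ 1 / 4)
    (hp : ∀ r ∈ Ioc r₁ 1, 0 < p r) :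
    (ρ ^ 2) ^ (-(1 + hardyRoot n k)) * ((5 : ℝ) ^ (-(1 + hardyRoot n k)) *
      ((1 + hardyRoot n k) / 5 * (hardyRoot n k - 2 * hardyMid k - 1))) *
      ∫ r in Ioo ρ (2 * ρ), r ^ (n - k) * p r ^ (k + 1) ≤
    (1 / 4 : ℝ) ^ (-(1 + hardyRoot n k)) * ((1 + hardyRoot n k) ^ 2 + 32 * M ^ 2) *
      (∫ r in Ioo (1 / 2 : ℝ) 1, r ^ (n - k) * p r ^ (k + 1)) +
    (ρ ^ 2) ^ (-(1 + hardyRoot n k)) * ((1 + hardyRoot n k) ^ 2 + 2 * M ^ 2) *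
      ∫ r in Ioo (r₁ + ε) (r₁ + 2 * ε), r ^ (n - k) * p r ^ (k + 1) * (1 + r ^ 2 / ε ^ 2) := by
  have hρ0 : 0 < ρ := by linarith
  set σ := hardyRoot n k with hσdef
  set b := hardyMid k with hbdef
  have hσ1 := one_lt_hardyRoot_sub hk hn
  have hσm := hardyRoot_mul hk hn
  have hb0 := hardyMid_nonneg hk
  obtain ⟨t1, t2, t3⟩ := isTestFunction_radial (r₁ := r₁) (e := -(1 + σ) / 2) hε hρ0
  obtain ⟨hQ1, hQ2⟩ := h.energy_inequality hg hk (by omega) hr₁ (by linarith)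
    (fun r hr => hp r ⟨hr.1, hr.2.le⟩) t1 t2 t3
  set P : ℝ → ℝ := fun r => r ^ (n - k) * p r ^ (k + 1) with hP
  set c₁ := (ρ ^ 2) ^ (-(1 + σ)) * ((5 : ℝ) ^ (-(1 + σ)) * ((1 + σ) / 5 * (σ - 2 * b - 1)))
  set c₂ := (1 / 4 : ℝ) ^ (-(1 + σ)) * ((1 + σ) ^ 2 + 32 * M ^ 2)
  set c₃ := (ρ ^ 2) ^ (-(1 + σ)) * ((1 + σ) ^ 2 + 2 * M ^ 2)
  have s1 : Ioo ρ (2 * ρ) ⊆ Ioo 0 1 := Ioo_subset_Ioo hρ0.le (by linarith)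
  have s2 : Ioo (1 / 2 : ℝ) 1 ⊆ Ioo 0 1 := Ioo_subset_Ioo (by norm_num) le_rfl
  have s3 : Ioo (r₁ + ε) (r₁ + 2 * ε) ⊆ Ioo 0 1 := Ioo_subset_Ioo (by linarith) (by linarith)
  set U₁ : ℝ → ℝ := (Ioo ρ (2 * ρ)).indicator fun r => P r * c₁ with hU₁
  set U₂ : ℝ → ℝ := (Ioo (1 / 2 : ℝ) 1).indicator fun r => P r * c₂ with hU₂
  set U₃ : ℝ → ℝ := (Ioo (r₁ + ε) (r₁ + 2 * ε)).indicator
    fun r => P r * (c₃ * (1 + r ^ 2 / ε ^ 2)) with hU₃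
  have i1 : IntegrableOn U₁ (Ioo 0 1) :=
    (h.energy.mul_const c₁).indicator measurableSet_Ioo
  have i2 : IntegrableOn U₂ (Ioo 0 1) :=
    (h.energy.mul_const c₂).indicator measurableSet_Ioo
  have i3 : IntegrableOn U₃ (Ioo 0 1) := by
    rw [integrableOn_indicator_iff measurableSet_Ioo, inter_eq_self_of_subset_left s3]
    have e3 : (fun r => P r * (c₃ * (1 + r ^ 2 / ε ^ 2))) =
        fun r => c₃ * (P r * (1 + r ^ 2 / ε ^ 2)) := by ext; ring
    rw [e3]
    exact (h.integrableOn_cutoff_error hr₁ hε).const_mul c₃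
  have hmono := setIntegral_mono_on hQ1 ((i2.add i3).sub i1) measurableSet_Ioo fun r hr => ?_
  · have hI : ∫ r in Ioo (0 : ℝ) 1, (U₂ + U₃ - U₁) r =
        c₂ * (∫ r in Ioo (1 / 2 : ℝ) 1, P r) +
        c₃ * (∫ r in Ioo (r₁ + ε) (r₁ + 2 * ε), P r * (1 + r ^ 2 / ε ^ 2)) -
        c₁ * ∫ r in Ioo ρ (2 * ρ), P r := by
      have e3 : (fun r => P r * (c₃ * (1 + r ^ 2 / ε ^ 2))) =
          fun r => c₃ * (P r * (1 + r ^ 2 / ε ^ 2)) := by ext; ring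
      rw [integral_sub' (i2.add i3) i1, integral_add' i2 i3, hU₁, hU₂, hU₃,
        setIntegral_indicator measurableSet_Ioo, setIntegral_indicator measurableSet_Ioo,
        setIntegral_indicator measurableSet_Ioo, inter_eq_self_of_subset_right s1,
        inter_eq_self_of_subset_right s2, inter_eq_self_of_subset_right s3, e3, integral_mul_const,
        integral_mul_const, integral_const_mul, mul_comm c₂, mul_comm c₁]
    have := hQ2.trans (hmono.trans_eq hI)
    linarith
  · have hP0 : 0 ≤ P r := mul_nonneg (_root_.pow_nonneg hr.1.le _)
      (_root_.pow_nonneg (h.nonneg r hr.1) _)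
    have hχ := ((contDiff_radialCutoff r₁ ε).differentiable (by simp) r).hasDerivAt
    have hform := quadratic_form_test (ρ := ρ) hρ0 hr.1 hσm hχ
    have hle := mul_le_mul_of_nonneg_left (test_integrand_le hb0 hσ1 hM hr₁ hε hρε hρ hr) hP0
    have hind : ∀ (s : Set ℝ) (c : ℝ → ℝ), P r * s.indicator c r =
        s.indicator (fun r => P r * c r) r := fun s c => by
      by_cases hs : r ∈ s <;> simp [hs]
    have e : P r * ((Ioo (1 / 2 : ℝ) 1).indicator (fun _ => c₂) r +
        (Ioo (r₁ + ε) (r₁ + 2 * ε)).indicator (fun r => c₃ * (1 + r ^ 2 / ε ^ 2)) r -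
        (Ioo ρ (2 * ρ)).indicator (fun _ => c₁) r) =
        (U₂ + U₃ - U₁) r := by
      rw [mul_sub, mul_add, hind, hind, hind]
      rfl
    rw [← e]
    refine le_trans (le_of_eq ?_) hle
    rw [← hform]
    simp only [hP, hσdef, hardyMid, hardyConst]

theorem energy_density_nonneg (h : IsRadialSolution n k g v p) {r : ℝ} (hr : 0 < r) :
    0 ≤ r ^ (n - k) * p r ^ (k + 1) :=
  mul_nonneg (_root_.pow_nonneg hr.le _) (_root_.pow_nonneg (h.nonneg r hr) _)

/-- The energy of an interval controls the slope at its left end, by the Harnack inequality. -/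
theorem le_integral_energy (h : IsRadialSolution n k g v p) (hg0 : ∀ s, 0 ≤ g s) (hk : 1 ≤ k)
    (hkn : k ≤ n) {θ ρ a b : ℝ} (hθ : 0 ≤ θ) (hθ1 : θ ≤ 1) (hρ : 0 < ρ) (hρa : ρ ≤ a)
    (hab : a ≤ b) (hb : b ≤ 1) (hθb : θ * b ≤ ρ) :
    (b - a) * (a ^ (n - k) * (θ ^ (n - k) * p ρ) ^ (k + 1)) ≤
      ∫ r in Ioo a b, r ^ (n - k) * p r ^ (k + 1) := by
  have ha : 0 < a := hρ.trans_le hρa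
  have hpρ := h.nonneg ρ hρ
  have h1 : ∫ _ in Ioo a b, a ^ (n - k) * (θ ^ (n - k) * p ρ) ^ (k + 1) =
      (b - a) * (a ^ (n - k) * (θ ^ (n - k) * p ρ) ^ (k + 1)) := by
    rw [setIntegral_const, smul_eq_mul, Measure.real, Real.volume_Ioo,
      ENNReal.toReal_ofReal (by linarith)]
  rw [← h1]
  refine setIntegral_mono_on (integrableOn_const (by simp))
    (h.energy.mono_set (Ioo_subset_Ioo ha.le hb)) measurableSet_Ioo fun r hr => ?_
  have h2 := h.harnack hg0 hk hkn hθ hθ1 hρ (hρa.trans hr.1.le) (hr.2.le.trans hb)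
    ((mul_le_mul_of_nonneg_left hr.2.le hθ).trans hθb)
  have := h.nonneg r (ha.trans hr.1)
  have hr0 := ha.trans hr.1
  have := hr.1.le
  gcongr

end IsRadialSolution

/-- The sharp-exponent bound of the slope in terms of the energy in `(1/2, 1)`. -/
theorem exists_slope_pow_le (hk : 1 ≤ k) (hn : 2 * k + 8 ≤ n) :
    ∃ C, 0 ≤ C ∧ ∀ g v p : ℝ → ℝ, IsRadialSolution n k g v p → LocallyLipschitz g →
      (∀ s, 0 ≤ g s) → ∀ ρ ∈ Ioc (0 : ℝ) (1 / 2), p ρ ^ (k + 1) ≤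
        C * ρ ^ (2 * hardyRoot n k - n + k + 1) *
          ∫ r in Ioo (1 / 2 : ℝ) 1, r ^ (n - k) * p r ^ (k + 1) := by
  obtain ⟨M, hM⟩ := exists_abs_deriv_smoothTransition_le
  have hkn : k ≤ n := by omega
  set σ := hardyRoot n k with hσdef
  set b := hardyMid k with hbdef
  have hσ1 : 1 < σ - 2 * b := one_lt_hardyRoot_sub hk hn
  have hb0 : 0 ≤ b := hardyMid_nonneg hk
  have hσ0 : 0 < 1 + σ := by linarith
  set E : ℝ := 2 * σ - n + k + 1 with hE
  set c₁ : ℝ := (5 : ℝ) ^ (-(1 + σ)) * ((1 + σ) / 5 * (σ - 2 * b - 1)) with hc₁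
  set c₂ : ℝ := (1 / 4 : ℝ) ^ (-(1 + σ)) * ((1 + σ) ^ 2 + 32 * M ^ 2) with hc₂
  set c₃ : ℝ := (1 + σ) ^ 2 + 2 * M ^ 2 with hc₃
  have hc₁0 : 0 < c₁ := by
    have : 0 < σ - 2 * b - 1 := by linarith
    positivity
  have hc₂0 : 0 < c₂ := by positivity
  have hc₃0 : 0 < c₃ := by positivity
  set d : ℝ := ((1 / 2 : ℝ) ^ (n - k)) ^ (k + 1) with hd
  have hd0 : 0 < d := by positivity
  set D : ℝ := (1 / 2 : ℝ) * ((1 / 2 : ℝ) ^ (n - k) * ((1 / 4 : ℝ) ^ (n - k)) ^ (k + 1)) *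
    (1 / 4 : ℝ) ^ |E| with hD
  have hD0 : 0 < D := by positivity
  refine ⟨c₂ / (c₁ * d) + 1 / D, by positivity, fun g v p h hg hg0 ρ hρ => ?_⟩
  have hρ0 := hρ.1
  set X := ∫ r in Ioo (1 / 2 : ℝ) 1, r ^ (n - k) * p r ^ (k + 1) with hX
  have hX0 : 0 ≤ X := setIntegral_nonneg measurableSet_Ioo fun r hr =>
    h.energy_density_nonneg (by linarith [hr.1])
  have hpρ := h.nonneg ρ hρ.1
  -- for `ρ ≤ 1/4` the tested inequality bounds the energy of `(ρ, 2ρ)`; for `1/4 < ρ` the Harnack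
  -- inequality bounds `p ρ` by the energy of `(1/2, 1)` directly
  rcases le_or_gt ρ (1 / 4) with hρ4 | hρ4
  · rcases hpρ.eq_or_lt with hp0 | hp0
    · rw [← hp0, zero_pow (by omega)]; positivity
    obtain ⟨r₁, hr₁, hr₁ρ, hpos, hJ⟩ := h.exists_zero_radius hg0 hk hkn hρ0 (by linarith) hp0
    set A := (ρ ^ 2) ^ (-(1 + σ)) with hA
    have hA0 : 0 < A := by positivity
    have hmain : A * c₁ * ∫ r in Ioo ρ (2 * ρ), r ^ (n - k) * p r ^ (k + 1) ≤ c₂ * X := by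
      refine le_of_forall_pos_le_add fun δ hδ => ?_
      obtain ⟨ε, hε, hεη, -, hεδ⟩ := h.exists_small_cutoff_error hg hg0 hkn hr₁ (by linarith) hJ
        (δ := δ / (A * c₃)) (η := (ρ - r₁) / 2) (by positivity) (by linarith)
      have h1 := h.integral_le_of_cutoff hg hk hn hM hr₁ hε (ρ := ρ) (by linarith) hρ4 hpos
      refine h1.trans ?_
      have h2 := mul_le_mul_of_nonneg_left hεδ (show 0 ≤ A * c₃ by positivity)
      rw [mul_div_cancel₀ _ (show A * c₃ ≠ 0 by positivity)] at h2
      exact add_le_add le_rfl h2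
    have h3 := h.le_integral_energy hg0 hk hkn (θ := 1 / 2) (ρ := ρ) (a := ρ) (b := 2 * ρ)
      (by norm_num) (by norm_num) hρ0 le_rfl (by linarith) (by linarith) (by linarith)
    have h4 : A * c₁ * ((2 * ρ - ρ) * (ρ ^ (n - k) * ((1 / 2 : ℝ) ^ (n - k) * p ρ) ^ (k + 1))) ≤
        c₂ * X := (mul_le_mul_of_nonneg_left h3 (by positivity)).trans hmain
    -- this identity of powers of `ρ` determines the exponent `E`
    have e1 : A * ρ * ρ ^ (n - k) * ρ ^ E = 1 := by
      have : A = ρ ^ (-2 * (1 + σ)) := by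
        rw [hA, ← Real.rpow_natCast_mul hρ0.le]; congr 1; push_cast; ring
      rw [this]
      nth_rewrite 2 [← Real.rpow_one ρ]
      rw [← Real.rpow_natCast ρ (n - k), ← Real.rpow_add hρ0, ← Real.rpow_add hρ0,
        ← Real.rpow_add hρ0, hE]
      push_cast [hkn]
      rw [← Real.rpow_zero ρ]; congr 1; ring
    have hρE : 0 < ρ ^ E := by positivity
    have h5 : (c₁ * d) * p ρ ^ (k + 1) ≤ c₂ * X * ρ ^ E := by
      calc _ = A * c₁ * ((2 * ρ - ρ) * (ρ ^ (n - k) *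
            ((1 / 2 : ℝ) ^ (n - k) * p ρ) ^ (k + 1))) * ρ ^ E := by
            rw [mul_pow, ← hd]
            linear_combination (-c₁ * d * p ρ ^ (k + 1)) * e1
        _ ≤ _ := mul_le_mul_of_nonneg_right h4 hρE.le
    have h6 : p ρ ^ (k + 1) ≤ c₂ / (c₁ * d) * ρ ^ E * X := by
      rw [← sub_nonneg]
      have e : c₂ / (c₁ * d) * ρ ^ E * X - p ρ ^ (k + 1) =
        (c₂ * X * ρ ^ E - (c₁ * d) * p ρ ^ (k + 1)) / (c₁ * d) := by field_simp
      rw [e]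
      exact div_nonneg (by linarith) (by positivity)
    refine h6.trans ?_
    gcongr
    linarith [show 0 < 1 / D by positivity]
  · have h3 := h.le_integral_energy hg0 hk hkn (θ := 1 / 4) (ρ := ρ) (a := 1 / 2) (b := 1)
      (by norm_num) (by norm_num) hρ0 hρ.2 (by norm_num) le_rfl (by linarith)
    have h4 := rpow_abs_le_rpow (a := 1 / 4) (by norm_num) hρ4.le (by linarith [hρ.2]) E
    have h5 : D * p ρ ^ (k + 1) ≤ ρ ^ E * X := by
      calc D * p ρ ^ (k + 1) = (1 / 4 : ℝ) ^ |E| * ((1 - 1 / 2) * ((1 / 2) ^ (n - k) *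
            ((1 / 4) ^ (n - k) * p ρ) ^ (k + 1))) := by
            rw [hD, mul_pow]; ring
        _ ≤ _ := mul_le_mul h4 h3 (by positivity) (by positivity)
    have h6 : p ρ ^ (k + 1) ≤ 1 / D * ρ ^ E * X := by
      rw [one_div, mul_assoc, ← div_eq_inv_mul, le_div_iff₀ hD0]
      linarith
    refine h6.trans ?_
    gcongr
    linarith [show 0 < c₂ / (c₁ * d) by positivity]

/-- The sharp-exponent bound of the slope. -/
theorem exists_slope_le (hk : 1 ≤ k) (hn : 2 * k + 8 ≤ n) :
    ∃ C, 0 ≤ C ∧ ∀ g v p : ℝ → ℝ, IsRadialSolution n k g v p → LocallyLipschitz g →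
      (∀ s, 0 ≤ g s) → ∀ ρ ∈ Ioc (0 : ℝ) (1 / 2), p ρ ≤
        C * (∫ r in Ioo (1 / 2 : ℝ) 1, r ^ (n - k) * p r ^ (k + 1)) ^ (1 / ((k : ℝ) + 1)) *
          ρ ^ ((expBase n k + (k : ℝ) ^ 2 + 4 * k - 1) / ((k : ℝ) + 1) ^ 2) := by
  obtain ⟨C, hC0, hC⟩ := exists_slope_pow_le hk hn
  refine ⟨C ^ (1 / ((k : ℝ) + 1)), by positivity, fun g v p h hg hg0 ρ hρ => ?_⟩
  have h1 := hC g v p h hg hg0 ρ hρ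
  set X := ∫ r in Ioo (1 / 2 : ℝ) 1, r ^ (n - k) * p r ^ (k + 1) with hX
  have hX0 : 0 ≤ X := setIntegral_nonneg measurableSet_Ioo fun r hr =>
    h.energy_density_nonneg (by linarith [hr.1])
  have hpρ := h.nonneg ρ hρ.1
  have hρ0 := hρ.1
  have h2 := Real.rpow_le_rpow (by positivity) h1 (show (0 : ℝ) ≤ 1 / ((k : ℝ) + 1) by positivity)
  have e1 : (p ρ ^ (k + 1)) ^ (1 / ((k : ℝ) + 1)) = p ρ := by
    have := Real.pow_rpow_inv_natCast hpρ (n := k + 1) (by omega)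
    rw [one_div]; push_cast at this; exact this
  rw [e1, Real.mul_rpow (by positivity) hX0, Real.mul_rpow hC0 (by positivity),
    ← Real.rpow_mul hρ0.le, ← div_eq_mul_one_div, hardy_exponent hk] at h2
  linarith

end KHessian

namespace KHessian

/-! ### Nonincreasing right-hand sides -/

variable {n k : ℕ} {g v p : ℝ → ℝ}

namespace IsRadialSolution

theorem monotoneOn_profile (h : IsRadialSolution n k g v p) : MonotoneOn v (Ioi 0) :=
  monotoneOn_of_deriv_nonneg (convex_Ioi 0) h.continuousOn_profile
    (fun r hr => by
      rw [interior_Ioi] at hr; exact (h.hasDerivAt r hr).differentiableAt.differentiableWithinAt)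
    fun r hr => by
      rw [interior_Ioi] at hr; rw [(h.hasDerivAt r hr).deriv]; exact h.nonneg r hr

/-- For nonincreasing `g` the slope either vanishes identically or is positive everywhere: once
the right-hand side vanishes at some radius, it vanishes from there on. -/
theorem slope_eq_zero_or_pos (h : IsRadialSolution n k g v p) (hg : Continuous g)
    (hg0 : ∀ s, 0 ≤ g s) (hk : 1 ≤ k) (hkn : k ≤ n) (ha : Antitone g) :
    (∀ r ∈ Ioc (0 : ℝ) 1, p r = 0) ∨ ∀ r ∈ Ioc (0 : ℝ) 1, 0 < p r := by
  by_cases hz : ∀ r ∈ Ioc (0 : ℝ) 1, p r = 0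
  · exact Or.inl hz
  push Not at hz
  obtain ⟨ρ, hρ, hpρ⟩ := hz
  right
  have hpρ' : 0 < p ρ := lt_of_le_of_ne (h.nonneg ρ hρ.1) (Ne.symm hpρ)
  obtain ⟨r₁, hr₁, hr₁ρ, hpos, hJ⟩ := h.exists_zero_radius hg0 hk hkn hρ.1 hρ.2 hpρ'
  rcases hr₁.eq_or_lt with h0 | h0
  · subst h0; exact hpos
  exfalso
  have hg1 := h.rhs_eq_zero hg hg0 h0 (hr₁ρ.trans_le hρ.2) hJ
  have hz : ∀ s ∈ Icc r₁ ρ, g (v s) = 0 := fun s hs => by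
    refine le_antisymm ?_ (hg0 _)
    rw [← hg1]
    exact ha (h.monotoneOn_profile h0 (h0.trans_le hs.1) hs.1)
  have hfl := h.flux ρ hρ
  have hi1 := h.intervalIntegrable_rhs (r := r₁) ⟨hr₁, (hr₁ρ.trans_le hρ.2).le⟩
  have hi2 := h.intervalIntegrable_rhs (r := ρ) ⟨hρ.1.le, hρ.2⟩
  have h2 : ∫ s in r₁..ρ, s ^ (n - 1) * g (v s) = ∫ s in r₁..ρ, 0 :=
    intervalIntegral.integral_congr fun s hs => by
      rw [uIcc_of_le hr₁ρ.le] at hs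
      simp only [hz s hs, mul_zero]
  rw [← intervalIntegral.integral_add_adjacent_intervals hi1 (hi1.symm.trans hi2), hJ, h2] at hfl
  simp only [intervalIntegral.integral_zero, add_zero, mul_zero] at hfl
  have hρ0 := hρ.1
  have : 0 < ρ ^ (n - k) * p ρ ^ k := by positivity
  linarith

/-- For nonincreasing `g`, the flux through the sphere of radius `r` is at least what it would be
if `g(v)` were constantly equal to its value at `r`. -/
theorem rhs_mul_le_integral (h : IsRadialSolution n k g v p) (ha : Antitone g)
    (hn : 2 ≤ n) {r : ℝ} (hr : r ∈ Ioc (0 : ℝ) 1) :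
    g (v r) * (r ^ n / n) ≤ ∫ s in (0 : ℝ)..r, s ^ (n - 1) * g (v s) := by
  have e : ∫ s in (0 : ℝ)..r, s ^ (n - 1) * g (v r) = g (v r) * (r ^ n / n) := by
    rw [intervalIntegral.integral_mul_const, integral_pow, Nat.sub_add_cancel (by omega),
      zero_pow (by omega), sub_zero, mul_comm]
    push_cast [show 1 ≤ n by omega]
    ring
  rw [← e]
  refine intervalIntegral.integral_mono_on hr.1.le (Continuous.intervalIntegrable (by fun_prop) _ _)
    (h.intervalIntegrable_rhs ⟨hr.1.le, hr.2⟩) fun s hs => ?_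
  rcases hs.1.eq_or_lt with h0 | h0
  · rw [← h0, zero_pow (by omega), zero_mul, zero_mul]
  · exact mul_le_mul_of_nonneg_left (ha (h.monotoneOn_profile h0 hr.1 hs.2)) (by positivity)

/-- For nonincreasing `g`, the quotient `p(r) / r` is nonincreasing. -/
theorem mul_slope_le_mul_slope (h : IsRadialSolution n k g v p)
    (hk : 1 ≤ k) (hkn : k + 2 ≤ n) (ha : Antitone g) {s t : ℝ} (hs : 0 < s) (hst : s ≤ t)
    (ht : t ≤ 1) : s * p t ≤ t * p s := by
  have ht0 : 0 < t := hs.trans_le hst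
  have hc := hessianConst_pos (n := n) (k := k) (by omega)
  have hi1 := h.intervalIntegrable_rhs (r := s) ⟨hs.le, hst.trans ht⟩
  have hi2 := h.intervalIntegrable_rhs (r := t) ⟨ht0.le, ht⟩
  have h1 := h.rhs_mul_le_integral ha (by omega) ⟨hs, hst.trans ht⟩
  have hn0 : (0 : ℝ) < n := by exact_mod_cast (show 0 < n by omega)
  have h2 : ∫ x in s..t, x ^ (n - 1) * g (v x) ≤ g (v s) * ((t ^ n - s ^ n) / n) := by
    have e : ∫ x in s..t, x ^ (n - 1) * g (v s) = g (v s) * ((t ^ n - s ^ n) / n) := by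
      rw [intervalIntegral.integral_mul_const, integral_pow, Nat.sub_add_cancel (by omega),
        mul_comm]
      push_cast [show 1 ≤ n by omega]
      ring
    rw [← e]
    refine intervalIntegral.integral_mono_on hst (hi1.symm.trans hi2)
      (Continuous.intervalIntegrable (by fun_prop) _ _) fun x hx => ?_
    have hx0 : 0 < x := hs.trans_le hx.1
    exact mul_le_mul_of_nonneg_left (ha (h.monotoneOn_profile hs hx0 hx.1)) (by positivity)
  set J₁ := ∫ x in (0 : ℝ)..s, x ^ (n - 1) * g (v x)
  have h3 : (∫ x in (0 : ℝ)..t, x ^ (n - 1) * g (v x)) =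
      J₁ + ∫ x in s..t, x ^ (n - 1) * g (v x) :=
    (intervalIntegral.integral_add_adjacent_intervals hi1 (hi1.symm.trans hi2)).symm
  have hsn : 0 < s ^ n := by positivity
  have hd : 0 ≤ t ^ n - s ^ n := sub_nonneg.2 (pow_le_pow_left₀ hs.le hst n)
  have h4 : (∫ x in (0 : ℝ)..t, x ^ (n - 1) * g (v x)) * s ^ n ≤ J₁ * t ^ n := by
    have h5 := mul_le_mul_of_nonneg_right h1 hd
    have h6 := mul_le_mul_of_nonneg_right h2 hsn.le
    rw [h3]
    have e : g (v s) * (s ^ n / n) * (t ^ n - s ^ n) =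
      g (v s) * ((t ^ n - s ^ n) / n) * s ^ n := by ring
    linarith
  have h7 : t ^ (n - k) * p t ^ k * s ^ n ≤ s ^ (n - k) * p s ^ k * t ^ n := by
    rw [h.flux t ⟨ht0, ht⟩, h.flux s ⟨hs, hst.trans ht⟩, mul_assoc, mul_assoc]
    exact mul_le_mul_of_nonneg_left h4 (by positivity)
  have e1 : ∀ x : ℝ, x ^ n = x ^ (n - k) * x ^ k := fun x => by
    rw [← pow_add]; congr 1; omega
  rw [e1 s, e1 t] at h7
  have h8 : (s ^ (n - k) * t ^ (n - k)) * (s * p t) ^ k ≤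
      (s ^ (n - k) * t ^ (n - k)) * (t * p s) ^ k := by
    rw [mul_pow, mul_pow]; linarith
  exact le_of_pow_le_pow_left₀ (by omega) (mul_nonneg ht0.le (h.nonneg s hs))
    (le_of_mul_le_mul_left h8 (by positivity))

/-- Here `g(v(r))` is controlled by its mean over the ball of radius `r`, that is, by the flux. -/
theorem rhs_le (h : IsRadialSolution n k g v p) (hk : 1 ≤ k) (hkn : k + 2 ≤ n) (ha : Antitone g)
    {r : ℝ} (hr : r ∈ Ioc (0 : ℝ) 1) :
    g (v r) ≤ n * hessianConst n k / k * (p r / r) ^ k := by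
  have hr0 := hr.1
  have hc := hessianConst_pos (n := n) (k := k) (by omega)
  have hn0 : (0 : ℝ) < n := by exact_mod_cast (show 0 < n by omega)
  have hk0 : (0 : ℝ) < k := by exact_mod_cast hk
  have h1 := h.rhs_mul_le_integral ha (by omega) hr
  have h2 := h.flux r hr
  have e1 : r ^ n = r ^ (n - k) * r ^ k := by rw [← pow_add]; congr 1; omega
  have e2 : (∫ s in (0 : ℝ)..r, s ^ (n - 1) * g (v s)) =
      hessianConst n k / k * (r ^ (n - k) * p r ^ k) := by
    rw [h2]; field_simp
  rw [e1, e2] at h1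
  have hR : 0 < r ^ (n - k) * r ^ k / n := by positivity
  refine le_of_mul_le_mul_right (h1.trans_eq ?_) hR
  rw [div_pow]
  field_simp

/-- The second derivative is a difference of two nonnegative quantities, each at most `n p / r`: for
the first one this is `rhs_le`. -/
theorem abs_accel_le (h : IsRadialSolution n k g v p) (hg0 : ∀ s, 0 ≤ g s) (hk : 1 ≤ k)
    (hkn : k + 2 ≤ n) (ha : Antitone g) {r : ℝ} (hr : r ∈ Ioc (0 : ℝ) 1) (hp : 0 < p r) :
    |accel n k g v p r| ≤ n * (p r / r) := by
  have hr0 := hr.1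
  have hc := hessianConst_pos (n := n) (k := k) (by omega)
  have hk1 : (1 : ℝ) ≤ k := by exact_mod_cast hk
  have hnk : (k : ℝ) + 2 ≤ n := by exact_mod_cast hkn
  have hq : 0 < p r / r := by positivity
  have h1 := h.rhs_le hk hkn ha hr
  have h2 : r ^ (k - 1) * g (v r) / (hessianConst n k * p r ^ (k - 1)) ≤ n / k * (p r / r) := by
    rw [div_le_iff₀ (by positivity)]
    calc r ^ (k - 1) * g (v r) ≤ r ^ (k - 1) * (n * hessianConst n k / k * (p r / r) ^ k) := by
          gcongr
      _ = _ := by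
          rw [← pow_sub_one_mul_self hk (p r / r), div_pow]; field_simp
  have h3 : 0 ≤ r ^ (k - 1) * g (v r) / (hessianConst n k * p r ^ (k - 1)) := by
    have := hg0 (v r); positivity
  have h4 : (n : ℝ) / k ≤ n := div_le_self (by linarith) hk1
  have h5 : ((n : ℝ) - k) / k ≤ n / k := by gcongr; linarith
  have h6 : 0 ≤ ((n : ℝ) - k) / k := div_nonneg (by linarith) (by linarith)
  rw [accel, abs_le]
  constructor <;> nlinarith

theorem derivWithin_profile (h : IsRadialSolution n k g v p) {r : ℝ} (hr : r ∈ Ioc (0 : ℝ) 1) :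
    radialDeriv 1 v r = p r := by
  rw [radialDeriv, iteratedDerivWithin_one]
  exact (h.hasDerivAt r hr.1).hasDerivWithinAt.derivWithin (uniqueDiffOn_Ioc 0 1 r hr)

/-- On `[1/2, 1]` all slopes are comparable: `p / r` is nonincreasing, which bounds them from above
by `2 p(1/2)`, and the Harnack inequality bounds them from below. -/
theorem slope_le_minSlope (h : IsRadialSolution n k g v p) (hg0 : ∀ s, 0 ≤ g s)
    (hk : 1 ≤ k) (hkn : k + 2 ≤ n) (ha : Antitone g) {t : ℝ} (ht : t ∈ Icc (1 / 2 : ℝ) 1) :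
    p t ≤ 2 ^ (n + 1) * minSlope v := by
  have h1 : p t ≤ 2 * p (1 / 2) := by
    have := h.mul_slope_le_mul_slope hk hkn ha (by norm_num) ht.1 ht.2
    have := h.nonneg (1 / 2) (by norm_num)
    nlinarith [ht.2]
  have h2 : p t / 2 ^ (n + 1) ≤ minSlope v := by
    refine le_csInf ⟨_, mem_image_of_mem _ ⟨le_rfl, by norm_num⟩⟩ ?_
    rintro _ ⟨s, hs, rfl⟩
    rw [h.derivWithin_profile ⟨by linarith [hs.1], hs.2⟩]
    have h3 := h.harnack hg0 hk (by omega) (θ := 1 / 2) (ρ := 1 / 2) (by norm_num) (by norm_num)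
      (by norm_num) hs.1 hs.2 (by linarith [hs.2])
    have h4 : (1 / 2 : ℝ) ^ n ≤ (1 / 2 : ℝ) ^ (n - k) :=
      pow_le_pow_of_le_one (by norm_num) (by norm_num) (by omega)
    have h5 : (1 / 2 : ℝ) ^ n * p (1 / 2) ≤ p s :=
      (mul_le_mul_of_nonneg_right h4 (h.nonneg _ (by norm_num))).trans h3
    rw [div_le_iff₀ (by positivity)]
    have h6 : (1 / 2 : ℝ) ^ n * 2 ^ n = 1 := by rw [← mul_pow]; norm_num
    calc p t ≤ 2 * p (1 / 2) := h1
      _ = ((1 / 2 : ℝ) ^ n * p (1 / 2)) * 2 ^ (n + 1) := by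
          rw [pow_succ]; linear_combination (-2 * p (1 / 2)) * h6
      _ ≤ _ := mul_le_mul_of_nonneg_right h5 (by positivity)
  rw [div_le_iff₀ (by positivity)] at h2
  linarith

theorem minSlope_nonneg (h : IsRadialSolution n k g v p) : 0 ≤ minSlope v := by
  refine le_csInf ⟨_, mem_image_of_mem _ ⟨le_rfl, by norm_num⟩⟩ ?_
  rintro _ ⟨s, hs, rfl⟩
  have hs0 : 0 < s := by linarith [hs.1]
  rw [h.derivWithin_profile ⟨hs0, hs.2⟩]
  exact h.nonneg s hs0

end IsRadialSolution

/-- The sharp-exponent bound of the slope on the whole of `(0, 1]`, for nonincreasing `g`. -/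
theorem exists_slope_le_minSlope (hk : 1 ≤ k) (hn : 2 * k + 8 ≤ n) :
    ∃ C, 0 ≤ C ∧ ∀ g v p : ℝ → ℝ, IsRadialSolution n k g v p → LocallyLipschitz g →
      (∀ s, 0 ≤ g s) → Antitone g → ∀ ρ ∈ Ioc (0 : ℝ) 1, p ρ ≤ C * minSlope v *
          ρ ^ ((expBase n k + (k : ℝ) ^ 2 + 4 * k - 1) / ((k : ℝ) + 1) ^ 2) := by
  obtain ⟨C, hC0, hC⟩ := exists_slope_le hk hn
  set e := (expBase n k + (k : ℝ) ^ 2 + 4 * k - 1) / ((k : ℝ) + 1) ^ 2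
  refine ⟨C * 2 ^ (n + 1) + 2 ^ (n + 1) / (1 / 2) ^ |e|, by positivity,
    fun g v p h hg hg0 ha ρ hρ => ?_⟩
  have hm := h.minSlope_nonneg
  have hρ0 := hρ.1
  have hρe : 0 < ρ ^ e := by positivity
  rcases le_or_gt ρ (1 / 2) with hle | hlt
  · refine (hC g v p h hg hg0 ρ ⟨hρ0, hle⟩).trans ?_
    set X := ∫ r in Ioo (1 / 2 : ℝ) 1, r ^ (n - k) * p r ^ (k + 1) with hX
    have hX0 : 0 ≤ X := setIntegral_nonneg measurableSet_Ioo fun r hr =>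
      h.energy_density_nonneg (by linarith [hr.1])
    have hX1 : X ≤ (2 ^ (n + 1) * minSlope v) ^ (k + 1) := by
      have h1 : X ≤ ∫ r in Ioo (1 / 2 : ℝ) 1, (2 ^ (n + 1) * minSlope v) ^ (k + 1) := by
        refine setIntegral_mono_on (h.energy.mono_set (Ioo_subset_Ioo (by norm_num) le_rfl))
          (integrableOn_const (by simp)) measurableSet_Ioo fun r hr => ?_
        have hr0 : 0 < r := by linarith [hr.1]
        have hpr := h.nonneg r hr0
        have h2 := h.slope_le_minSlope hg0 hk (by omega) ha ⟨hr.1.le, hr.2.le⟩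
        calc r ^ (n - k) * p r ^ (k + 1) ≤ 1 * p r ^ (k + 1) := by
              gcongr; exact pow_le_one₀ hr0.le hr.2.le
          _ ≤ _ := by rw [one_mul]; gcongr
      rw [setIntegral_const, smul_eq_mul, Measure.real, Real.volume_Ioo,
        ENNReal.toReal_ofReal (by norm_num)] at h1
      have : 0 ≤ (2 ^ (n + 1) * minSlope v) ^ (k + 1) := by positivity
      linarith
    have hX2 : X ^ (1 / ((k : ℝ) + 1)) ≤ 2 ^ (n + 1) * minSlope v := by
      have h3 := Real.rpow_le_rpow hX0 hX1 (show (0 : ℝ) ≤ 1 / ((k : ℝ) + 1) by positivity)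
      have h4 := Real.pow_rpow_inv_natCast (x := 2 ^ (n + 1) * minSlope v) (by positivity)
        (n := k + 1) (by omega)
      push_cast at h4
      rwa [one_div, h4, ← one_div] at h3
    calc C * X ^ (1 / ((k : ℝ) + 1)) * ρ ^ e ≤ C * (2 ^ (n + 1) * minSlope v) * ρ ^ e := by
          gcongr
      _ = (C * 2 ^ (n + 1)) * minSlope v * ρ ^ e := by ring
      _ ≤ _ := by
          gcongr
          linarith [show (0 : ℝ) ≤ 2 ^ (n + 1) / (1 / 2) ^ |e| by positivity]
  · have h1 := h.slope_le_minSlope hg0 hk (by omega) ha ⟨hlt.le, hρ.2⟩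
    have h2 := rpow_abs_le_rpow (a := 1 / 2) (by norm_num) hlt.le hρ.2 e
    have h3 : (1 : ℝ) ≤ ρ ^ e / (1 / 2) ^ |e| := by
      rw [le_div_iff₀ (by positivity)]; linarith
    calc p ρ ≤ 2 ^ (n + 1) * minSlope v * 1 := by linarith
      _ ≤ 2 ^ (n + 1) * minSlope v * (ρ ^ e / (1 / 2) ^ |e|) := by gcongr
      _ = 2 ^ (n + 1) / (1 / 2) ^ |e| * minSlope v * ρ ^ e := by ring
      _ ≤ _ := by
          gcongr
          linarith [show (0 : ℝ) ≤ C * 2 ^ (n + 1) by positivity]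

end KHessian

namespace KHessian

/-! ### Second and third derivatives -/

variable {n k : ℕ} {g v p : ℝ → ℝ}

/-- A convex function on the line is differentiable off a countable set: it is differentiable
wherever its right derivative is continuous. -/
theorem countable_not_differentiableAt_of_convexOn (hc : ConvexOn ℝ univ g) :
    {x | ¬ DifferentiableAt ℝ g x}.Countable := by
  have hR : Monotone fun x => derivWithin g (Ioi x) x := by
    have := hc.monotoneOn_rightDeriv
    rw [interior_univ] at this
    exact monotoneOn_univ.1 this
  refine hR.countable_not_continuousAt.mono ?_
  intro x hx
  rw [mem_ofPred_eq] at hx ⊢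
  intro hcont
  refine hx ?_
  have hmem : ∀ y : ℝ, y ∈ interior (univ : Set ℝ) := fun y => by simp
  have h1 := hc.leftDeriv_le_rightDeriv_of_mem_interior (hmem x)
  have h2 : derivWithin g (Ioi x) x ≤ derivWithin g (Iio x) x := by
    have ht : Filter.Tendsto (fun y => derivWithin g (Ioi y) y) (nhdsWithin x (Iio x))
        (nhds (derivWithin g (Ioi x) x)) := hcont.tendsto.mono_left nhdsWithin_le_nhds
    refine le_of_tendsto ht ?_
    filter_upwards [self_mem_nhdsWithin] with y hy
    exact (hc.rightDeriv_le_slope_of_mem_interior (hmem y) (mem_univ x) hy).trans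
      (hc.slope_le_leftDeriv_of_mem_interior (mem_univ y) (hmem x) hy)
  have d1 := hc.hasDerivWithinAt_rightDeriv_of_mem_interior (hmem x)
  have d2 := hc.hasDerivWithinAt_leftDeriv_of_mem_interior (hmem x)
  rw [le_antisymm h1 h2] at d2
  exact ((d2.Iic_of_Iio).union (d1.Ici_of_Ioi)).hasDerivAt (by simp) |>.differentiableAt

namespace IsRadialSolution

theorem contDiffOn_one (h : IsRadialSolution n k g v p) : ContDiffOn ℝ 1 v (Ioc 0 1) :=
  h.contDiffOn_profile.mono Ioc_subset_Ioi_self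

theorem radialDeriv_two (h : IsRadialSolution n k g v p) {r : ℝ} (hr : r ∈ Ioc (0 : ℝ) 1) :
    radialDeriv 2 v r = derivWithin p (Ioc 0 1) r := by
  rw [radialDeriv, iteratedDerivWithin_succ]
  exact derivWithin_congr (fun s hs => h.derivWithin_profile hs) (h.derivWithin_profile hr)

theorem radialDeriv_three {F : ℝ → ℝ} (hF : EqOn (radialDeriv 2 v) F (Ioc 0 1)) {r : ℝ}
    (hr : r ∈ Ioc (0 : ℝ) 1) : radialDeriv 3 v r = derivWithin F (Ioc 0 1) r := by
  rw [radialDeriv, iteratedDerivWithin_succ]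
  exact derivWithin_congr hF (hF hr)

theorem contDiffOn_two (h : IsRadialSolution n k g v p)
    (hp : ContDiffOn ℝ 1 p (Ioc 0 1)) : ContDiffOn ℝ 2 v (Ioc 0 1) := by
  rw [show (2 : WithTop ℕ∞) = 1 + 1 from rfl, contDiffOn_succ_iff_derivWithin
    (uniqueDiffOn_Ioc 0 1)]
  refine ⟨h.contDiffOn_one.differentiableOn (by simp), by simp, hp.congr fun r hr => ?_⟩
  rw [← h.derivWithin_profile hr, radialDeriv, iteratedDerivWithin_one]

theorem radialDeriv_two_of_pos (h : IsRadialSolution n k g v p) (hg : Continuous g) (hk : 1 ≤ k)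
    (hkn : k ≤ n) (hpos : ∀ r ∈ Ioc (0 : ℝ) 1, 0 < p r) :
    EqOn (radialDeriv 2 v) (accel n k g v p) (Ioc 0 1) := fun r hr => by
  rw [h.radialDeriv_two hr]
  exact (h.hasDerivWithinAt_slope hg hk hkn hr (hpos r hr)).derivWithin (uniqueDiffOn_Ioc 0 1 r hr)

theorem radialDeriv_two_of_zero (h : IsRadialSolution n k g v p)
    (hz : ∀ r ∈ Ioc (0 : ℝ) 1, p r = 0) : EqOn (radialDeriv 2 v) (fun _ => 0) (Ioc 0 1) :=
  fun r hr => by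
    rw [h.radialDeriv_two hr, derivWithin_congr (f := fun _ => (0 : ℝ)) hz (hz r hr)]
    simp

theorem contDiffOn_two_and_abs_le (h : IsRadialSolution n k g v p) (hg : Continuous g)
    (hg0 : ∀ s, 0 ≤ g s) (hk : 1 ≤ k) (hkn : k + 2 ≤ n) (ha : Antitone g) :
    ContDiffOn ℝ 2 v (Ioc 0 1) ∧
      ∀ r ∈ Ioc (0 : ℝ) 1, |radialDeriv 2 v r| ≤ n * (p r / r) := by
  have hkn' : k ≤ n := by omega
  rcases h.slope_eq_zero_or_pos hg hg0 hk hkn' ha with hz | hpos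
  · refine ⟨h.contDiffOn_two (contDiffOn_const.congr hz), fun r hr => ?_⟩
    rw [h.radialDeriv_two_of_zero hz hr, hz r hr]
    simp
  · have hd : ∀ r ∈ Ioc (0 : ℝ) 1, HasDerivWithinAt p (accel n k g v p r) (Ioc 0 1) r :=
      fun r hr => h.hasDerivWithinAt_slope hg hk hkn' hr (hpos r hr)
    refine ⟨h.contDiffOn_two ?_, fun r hr => ?_⟩
    · rw [contDiffOn_one_iff_derivWithin (uniqueDiffOn_Ioc 0 1)]
      refine ⟨fun r hr => (hd r hr).differentiableWithinAt,
        ContinuousOn.congr (f := accel n k g v p) (fun r hr => (h.continuousAt_accel hg hkn'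
          hr.1 (hpos r hr)).continuousWithinAt) fun r hr => ?_⟩
      exact (hd r hr).derivWithin (uniqueDiffOn_Ioc 0 1 r hr)
    · rw [h.radialDeriv_two_of_pos hg hk hkn' hpos hr]
      exact h.abs_accel_le hg0 hk hkn ha hr (hpos r hr)

theorem strictMonoOn_profile (h : IsRadialSolution n k g v p)
    (hpos : ∀ r ∈ Ioc (0 : ℝ) 1, 0 < p r) : StrictMonoOn v (Ioc 0 1) :=
  strictMonoOn_of_deriv_pos (convex_Ioc 0 1)
    (h.continuousOn_profile.mono Ioc_subset_Ioi_self) fun r hr => by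
      rw [interior_Ioc] at hr
      rw [(h.hasDerivAt r hr.1).deriv]
      exact hpos r ⟨hr.1, hr.2.le⟩

/-- Over the dyadic interval `[r/2, r]` the profile grows by at least `r p(r) / 4`. -/
theorem le_profile_sub (h : IsRadialSolution n k g v p) (hk : 1 ≤ k) (hkn : k + 2 ≤ n)
    (ha : Antitone g) {r : ℝ} (hr : r ∈ Ioc (0 : ℝ) 1) :
    r * p r / 4 ≤ v r - v (r / 2) := by
  have hr0 := hr.1
  obtain ⟨s, hs, he⟩ := exists_hasDerivAt_eq_slope v p (show r / 2 < r by linarith)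
    (h.continuousOn_profile.mono fun x hx => (half_pos hr0).trans_le hx.1)
    fun x hx => h.hasDerivAt x ((half_pos hr0).trans hx.1)
  have hs0 : 0 < s := (half_pos hr0).trans hs.1
  have h1 := h.mul_slope_le_mul_slope hk hkn ha hs0 hs.2.le hr.2
  have h2 := h.nonneg r hr0
  have h3 : p r / 2 ≤ p s := by
    have h4 : r * (p r / 2) ≤ r * p s := by nlinarith [hs.1]
    exact le_of_mul_le_mul_left h4 hr0
  rw [eq_div_iff (by linarith)] at he
  nlinarith

/-- For convex nonincreasing `g`, a one-sided derivative of `g(v)` is controlled by the secant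
slope of `g` over `[v(r/2), v(r)]`. -/
theorem exists_abs_deriv_rhs_le (hk : 1 ≤ k) (hkn : k + 2 ≤ n) :
    ∃ C, 0 ≤ C ∧ ∀ g v p : ℝ → ℝ, IsRadialSolution n k g v p → (∀ s, 0 ≤ g s) → Antitone g →
      ConvexOn ℝ univ g → (∀ r ∈ Ioc (0 : ℝ) 1, 0 < p r) → ∀ r ∈ Ioc (0 : ℝ) 1, ∀ d,
      HasDerivWithinAt (fun s => g (v s)) d (Ioc 0 1) r → |d| ≤ C * ((p r / r) ^ k / r) := by
  have hc := hessianConst_pos (n := n) (k := k) (by omega)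
  refine ⟨4 * (n * hessianConst n k / k * (2 * 2 ^ (n - k)) ^ k), by positivity,
    fun g v p h hg0 ha hcv hpos r hr d hd => ?_⟩
  have hr0 := hr.1
  have hpr := hpos r hr
  have hmem : v r ∈ interior (univ : Set ℝ) := by simp
  have hsm := h.strictMonoOn_profile hpos
  have hL := hcv.hasDerivWithinAt_leftDeriv_of_mem_interior hmem
  -- the left derivative of `g` is the one to use: it exists everywhere, and `v` approaches `v r`
  -- from below
  set L := derivWithin g (Iio (v r)) (v r) with hLdef
  have hmaps : MapsTo v (Ioo 0 r) (Iio (v r)) := fun s hs =>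
    hsm ⟨hs.1, hs.2.le.trans hr.2⟩ hr hs.2
  have h1 : HasDerivWithinAt (fun s => g (v s)) (L * p r) (Ioo 0 r) r :=
    HasDerivWithinAt.comp (h₂ := g) r hL (h.hasDerivAt r hr0).hasDerivWithinAt hmaps
  have h2 : HasDerivWithinAt (fun s => g (v s)) d (Ioo 0 r) r :=
    hd.mono fun s hs => ⟨hs.1, hs.2.le.trans hr.2⟩
  have h1' := h1.mono_of_mem_nhdsWithin (Ioo_mem_nhdsLT hr0)
  have h2' := h2.mono_of_mem_nhdsWithin (Ioo_mem_nhdsLT hr0)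
  have hdL : d = L * p r := (uniqueDiffWithinAt_Iio r).eq_deriv _ h2' h1'
  have hr2 : r / 2 ∈ Ioc (0 : ℝ) 1 := ⟨half_pos hr0, by linarith [hr.2]⟩
  have hvlt : v (r / 2) < v r := hsm hr2 hr (by linarith)
  have hsl := hcv.slope_le_leftDeriv_of_mem_interior (mem_univ (v (r / 2))) hmem hvlt
  rw [slope_def_field, ← hLdef] at hsl
  have hL0 : L ≤ 0 := (ha.antitoneOn _).derivWithin_nonpos
  have hdiff := h.le_profile_sub hk hkn ha hr
  have hdiff0 : 0 < r * p r / 4 := by positivity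
  have hG : g (v (r / 2)) ≤ n * hessianConst n k / k * (2 * 2 ^ (n - k)) ^ k * (p r / r) ^ k := by
    have h3 := h.rhs_le hk hkn ha hr2
    have h4 := h.harnack hg0 hk (by omega) (θ := 1 / 2) (ρ := r / 2) (r := r) (by norm_num)
      (by norm_num) (by linarith) (by linarith) hr.2 (by linarith)
    have h5 : p (r / 2) / (r / 2) ≤ 2 * 2 ^ (n - k) * (p r / r) := by
      rw [div_le_iff₀ (by linarith)]
      have h6 : (1 / 2 : ℝ) ^ (n - k) * 2 ^ (n - k) = 1 := by rw [← mul_pow]; norm_num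
      have h7 := mul_le_mul_of_nonneg_right h4 (show (0 : ℝ) ≤ 2 ^ (n - k) by positivity)
      have e : 2 * 2 ^ (n - k) * (p r / r) * (r / 2) = p r * 2 ^ (n - k) := by field_simp
      rw [e]
      calc p (r / 2) = (1 / 2) ^ (n - k) * p (r / 2) * 2 ^ (n - k) := by
            linear_combination (-p (r / 2)) * h6
        _ ≤ _ := h7
    have h8 : 0 ≤ p (r / 2) / (r / 2) := div_nonneg (h.nonneg _ hr2.1) hr2.1.le
    calc g (v (r / 2)) ≤ n * hessianConst n k / k * (p (r / 2) / (r / 2)) ^ k := h3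
      _ ≤ n * hessianConst n k / k * (2 * 2 ^ (n - k) * (p r / r)) ^ k := by gcongr
      _ = _ := by rw [mul_pow (2 * 2 ^ (n - k) : ℝ)]; ring
  have hLle : -L ≤ g (v (r / 2)) / (r * p r / 4) := by
    calc -L ≤ -((g (v r) - g (v (r / 2))) / (v r - v (r / 2))) := neg_le_neg hsl
      _ = (g (v (r / 2)) - g (v r)) / (v r - v (r / 2)) := by rw [← neg_div, neg_sub]
      _ ≤ g (v (r / 2)) / (v r - v (r / 2)) :=
          div_le_div_of_nonneg_right (by linarith [hg0 (v r)]) (by linarith)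
      _ ≤ _ := by
          have := hg0 (v (r / 2))
          gcongr
  rw [hdL, abs_mul, abs_of_nonpos hL0, abs_of_pos hpr]
  calc -L * p r ≤ g (v (r / 2)) / (r * p r / 4) * p r := by gcongr
    _ = 4 * g (v (r / 2)) / r := by field_simp
    _ ≤ 4 * (n * hessianConst n k / k * (2 * 2 ^ (n - k)) ^ k * (p r / r) ^ k) / r := by gcongr
    _ = _ := by ring

/-- The derivative of the slope in terms of the quotient `p / r` and `g(v)`. -/
theorem accel_eq {r : ℝ} :
    accel n k g v p r =
      ((p r / r) ^ (k - 1))⁻¹ * g (v r) / hessianConst n k - ((n : ℝ) - k) / k * (p r / r) := by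
  rw [accel, div_pow, inv_div, div_mul_eq_mul_div (r ^ (k - 1)), div_div, mul_comm (p r ^ (k - 1))]

theorem hasDerivWithinAt_quotient (h : IsRadialSolution n k g v p) (hg : Continuous g)
    (hk : 1 ≤ k) (hkn : k ≤ n) {r : ℝ} (hr : r ∈ Ioc (0 : ℝ) 1) (hp : 0 < p r) :
    HasDerivWithinAt (fun s => p s / s) ((accel n k g v p r - p r / r) / r) (Ioc 0 1) r := by
  have hr0 := hr.1
  refine ((h.hasDerivWithinAt_slope hg hk hkn hr hp).div (hasDerivWithinAt_id r _)
    hr0.ne').congr_deriv ?_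
  simp only [id]
  field_simp

theorem hasDerivWithinAt_accel (h : IsRadialSolution n k g v p) (hg : Continuous g)
    (hk : 1 ≤ k) (hkn : k ≤ n) {r d : ℝ} (hr : r ∈ Ioc (0 : ℝ) 1) (hp : 0 < p r)
    (hd : HasDerivWithinAt (fun s => g (v s)) d (Ioc 0 1) r) :
    HasDerivWithinAt (accel n k g v p)
      ((d - ((k : ℝ) - 1) * ((accel n k g v p r - p r / r) / r) / (p r / r) * g (v r)) /
        ((p r / r) ^ (k - 1) * hessianConst n k) -
        ((n : ℝ) - k) / k * ((accel n k g v p r - p r / r) / r)) (Ioc 0 1) r := by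
  have hr0 := hr.1
  have hc := hessianConst_pos hkn
  have hq := h.hasDerivWithinAt_quotient hg hk hkn hr hp
  have hq0 : 0 < p r / r := by positivity
  have h1 := (((hq.pow (k - 1)).inv (pow_ne_zero _ hq0.ne')).mul hd).div_const
    (hessianConst n k) |>.sub (hq.const_mul (((n : ℝ) - k) / k))
  have hkc : ((k - 1 : ℕ) : ℝ) = k - 1 := by push_cast [hk]; ring
  have hy : ((k - 1 : ℕ) : ℝ) * (p r / r) ^ (k - 1 - 1) =
      ((k : ℝ) - 1) * ((p r / r) ^ (k - 1) / (p r / r)) := by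
    rcases Nat.eq_zero_or_pos (k - 1) with h0 | h0
    · have : (k : ℝ) - 1 = 0 := by rw [← hkc, h0]; simp
      rw [this, h0]; simp
    · rw [hkc, ← pow_sub_one_mul_self h0 (p r / r)]
      field_simp
  have h2 := h1.congr_of_eventuallyEq (f₁ := accel n k g v p)
    (Filter.Eventually.of_forall fun s => accel_eq) accel_eq
  refine h2.congr_deriv ?_
  simp only [Pi.pow_apply, Pi.inv_apply]
  rw [hy]
  generalize (accel n k g v p r - p r / r) / r = A
  generalize p r / r = q at *
  field_simp
  ring

/-- The estimate of the derivative of `accel`, in which `q` stands for `p / r`, `A` for the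
derivative of `q`, `G` for `g(v)` and `d` for the derivative of `g(v)`. -/
theorem abs_deriv_accel_le {c q A d G r C₀ C₁ ν n' k' : ℝ} (k : ℕ) (hk : 1 ≤ k) (hc : 0 < c)
    (hq : 0 < q) (hr : 0 < r) (hG0 : 0 ≤ G) (hG : G ≤ C₀ * q ^ k) (hd : |d| ≤ C₁ * (q ^ k / r))
    (hA : |A| ≤ (n' + 1) * q / r) (hν : 0 ≤ ν) (hk' : 0 ≤ k') :
    |(d - k' * A / q * G) / (q ^ (k - 1) * c) - ν * A| ≤
      ((C₁ + k' * (n' + 1) * C₀) / c + ν * (n' + 1)) * (q / r) := by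
  have hQ : 0 < q ^ (k - 1) := by positivity
  rw [← pow_sub_one_mul_self hk q] at hG hd
  generalize q ^ (k - 1) = Q at *
  have h1 : |d - k' * A / q * G| ≤ (C₁ + k' * (n' + 1) * C₀) * (Q * q / r) := by
    have h2 : |k' * A / q * G| ≤ k' * ((n' + 1) * q / r) / q * (C₀ * (Q * q)) := by
      rw [abs_mul, abs_div, abs_mul, abs_of_nonneg hk', abs_of_pos hq, abs_of_nonneg hG0]
      have hnn : 0 ≤ (n' + 1) * q / r := (abs_nonneg A).trans hA
      gcongr
    calc |d - k' * A / q * G| ≤ |d| + |k' * A / q * G| := abs_sub _ _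
      _ ≤ C₁ * (Q * q / r) + k' * ((n' + 1) * q / r) / q * (C₀ * (Q * q)) := add_le_add hd h2
      _ = _ := by field_simp
  calc _ ≤ |(d - k' * A / q * G) / (Q * c)| + |ν * A| := abs_sub _ _
    _ = |d - k' * A / q * G| / (Q * c) + ν * |A| := by
        rw [abs_div, abs_mul ν, abs_of_nonneg hν, abs_of_pos (show 0 < Q * c by positivity)]
    _ ≤ (C₁ + k' * (n' + 1) * C₀) * (Q * q / r) / (Q * c) + ν * ((n' + 1) * q / r) := by gcongr
    _ = _ := by field_simp

/-- A third derivative can exist only where `g(v)` is differentiable, because `g(v)` is the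
product of `(p / r) ^ (k - 1)` with a linear combination of `accel` and `p / r`. -/
theorem differentiableWithinAt_rhs_of_accel (h : IsRadialSolution n k g v p) (hg : Continuous g)
    (hk : 1 ≤ k) (hkn : k ≤ n) (hpos : ∀ r ∈ Ioc (0 : ℝ) 1, 0 < p r) {r : ℝ}
    (hr : r ∈ Ioc (0 : ℝ) 1)
    (hd : DifferentiableWithinAt ℝ (accel n k g v p) (Ioc 0 1) r) :
    DifferentiableWithinAt ℝ (fun s => g (v s)) (Ioc 0 1) r := by
  have hc := hessianConst_pos hkn
  have hq := (h.hasDerivWithinAt_quotient hg hk hkn hr (hpos r hr)).differentiableWithinAt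
  have h1 := ((hd.add (hq.const_mul (((n : ℝ) - k) / k))).mul (hq.pow (k - 1))).const_mul
    (hessianConst n k)
  have heq : ∀ s ∈ Ioc (0 : ℝ) 1, g (v s) = hessianConst n k *
      ((accel n k g v p s + ((n : ℝ) - k) / k * (p s / s)) * (p s / s) ^ (k - 1)) := by
    intro s hs
    have hs0 := hs.1
    have hps := hpos s hs
    rw [accel_eq, sub_add_cancel]
    field_simp
  exact h1.congr heq (heq r hr)

end IsRadialSolution

/-- The third derivative exists wherever `g` is differentiable at `v(r)`. Unless the slope vanishes
identically, `v` is injective, so the exceptional radii inject into the countable set of points at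
which the convex `g` is not differentiable. -/
theorem exists_abs_third_deriv_le (hk : 1 ≤ k) (hkn : k + 2 ≤ n) :
    ∃ C, 0 ≤ C ∧ ∀ g v p : ℝ → ℝ, IsRadialSolution n k g v p → Continuous g →
      (∀ s, 0 ≤ g s) → Antitone g → ConvexOn ℝ univ g →
      {r ∈ Ioc (0 : ℝ) 1 | ¬ DifferentiableWithinAt ℝ (radialDeriv 2 v) (Ioc 0 1) r}.Countable ∧
      (∀ r ∈ Ioc (0 : ℝ) 1, DifferentiableAt ℝ g (v r) →
        DifferentiableWithinAt ℝ (radialDeriv 2 v) (Ioc 0 1) r) ∧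
      ∀ r ∈ Ioc (0 : ℝ) 1, DifferentiableWithinAt ℝ (radialDeriv 2 v) (Ioc 0 1) r →
        |radialDeriv 3 v r| ≤ C * (p r / r / r) := by
  have hkn' : k ≤ n := by omega
  have hc := hessianConst_pos hkn'
  have hk1 : (1 : ℝ) ≤ k := by exact_mod_cast hk
  have hnk : (k : ℝ) + 2 ≤ n := by exact_mod_cast hkn
  obtain ⟨C₁, hC₁0, hC₁⟩ := IsRadialSolution.exists_abs_deriv_rhs_le hk hkn
  have hν : 0 ≤ ((n : ℝ) - k) / k := div_nonneg (by linarith) (by linarith)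
  have hk' : (0 : ℝ) ≤ (k : ℝ) - 1 := by linarith
  refine ⟨(C₁ + ((k : ℝ) - 1) * (n + 1) * (n * hessianConst n k / k)) / hessianConst n k +
    ((n : ℝ) - k) / k * (n + 1), by positivity, fun g v p h hg hg0 ha hcv => ?_⟩
  rcases h.slope_eq_zero_or_pos hg hg0 hk hkn' ha with hz | hpos
  · have heq := h.radialDeriv_two_of_zero hz
    have hd : ∀ r ∈ Ioc (0 : ℝ) 1, DifferentiableWithinAt ℝ (radialDeriv 2 v) (Ioc 0 1) r :=
      fun r hr => (differentiableWithinAt_const (0 : ℝ)).congr heq (heq hr)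
    refine ⟨?_, fun r hr _ => hd r hr, fun r hr _ => ?_⟩
    · convert countable_empty using 1
      ext r
      simp only [mem_ofPred_eq, mem_empty_iff_false, iff_false, not_and, not_not]
      exact hd r
    · rw [IsRadialSolution.radialDeriv_three heq hr, hz r hr]
      simp
  · have heq := h.radialDeriv_two_of_pos hg hk hkn' hpos
    have hsuff : ∀ r ∈ Ioc (0 : ℝ) 1, DifferentiableAt ℝ g (v r) →
        DifferentiableWithinAt ℝ (radialDeriv 2 v) (Ioc 0 1) r := by
      intro r hr hgd
      have h1 : HasDerivWithinAt (fun s => g (v s)) _ (Ioc 0 1) r :=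
        (HasDerivAt.comp (h₂ := g) r hgd.hasDerivAt (h.hasDerivAt r hr.1)).hasDerivWithinAt
      exact (h.hasDerivWithinAt_accel hg hk hkn' hr (hpos r hr) h1).differentiableWithinAt.congr
        heq (heq hr)
    refine ⟨?_, hsuff, fun r hr hd => ?_⟩
    · have h1 : ((Ioc (0 : ℝ) 1) ∩ v ⁻¹' {x | ¬ DifferentiableAt ℝ g x}).Countable := by
        refine MapsTo.countable_of_injOn (f := v) (t := {x | ¬ DifferentiableAt ℝ g x})
          (fun r hr => hr.2) ((h.strictMonoOn_profile hpos).injOn.mono inter_subset_left)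
          (countable_not_differentiableAt_of_convexOn hcv)
      refine h1.mono ?_
      intro r hr
      rw [mem_ofPred_eq] at hr
      exact ⟨hr.1, fun hgd => hr.2 (hsuff r hr.1 hgd)⟩
    · have hr0 := hr.1
      have hpr := hpos r hr
      have hd' : DifferentiableWithinAt ℝ (accel n k g v p) (Ioc 0 1) r :=
        hd.congr (fun s hs => (heq hs).symm) (heq hr).symm
      have hG := (h.differentiableWithinAt_rhs_of_accel hg hk hkn' hpos hr hd').hasDerivWithinAt
      rw [IsRadialSolution.radialDeriv_three heq hr,
        (h.hasDerivWithinAt_accel hg hk hkn' hr hpr hG).derivWithin (uniqueDiffOn_Ioc 0 1 r hr)]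
      have hA := h.abs_accel_le hg0 hk hkn ha hr hpr
      have hq0 : 0 < p r / r := by positivity
      refine IsRadialSolution.abs_deriv_accel_le k hk hc hq0 hr0 (hg0 _) (h.rhs_le hk hkn ha hr)
        (hC₁ g v p h hg0 ha hcv hpos r hr _ hG) ?_ hν hk'
      rw [abs_div, abs_of_pos hr0]
      gcongr
      calc |accel n k g v p r - p r / r| ≤ |accel n k g v p r| + |p r / r| := abs_sub _ _
        _ ≤ n * (p r / r) + p r / r := by rw [abs_of_pos hq0]; gcongr
        _ = _ := by ring

end KHessian

namespace KHessian

variable {n k : ℕ} {g v p : ℝ → ℝ}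

/-! ### Return to the ball -/

/-- The weights `|x|^{1-k}` and `r^{n-1}` combine to `r^{n-k}`. -/
theorem annulusGradNorm_eq [NeZero n] (hk : 1 ≤ k) (hkn : k ≤ n)
    {G : EuclideanSpace ℝ (Fin n) → EuclideanSpace ℝ (Fin n)}
    (hp : ∀ r, 0 < r → 0 ≤ p r)
    (hG : ∀ᵐ x ∂(volume.restrict (unitBall n)), ‖G x‖ = |p ‖x‖|) :
    annulusGradNorm k G = sphereArea n ^ (1 / ((k : ℝ) + 1)) *
      (∫ r in Ioo (1 / 2 : ℝ) 1, r ^ (n - k) * p r ^ (k + 1)) ^ (1 / ((k : ℝ) + 1)) := by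
  have hX0 : 0 ≤ ∫ r in Ioo (1 / 2 : ℝ) 1, r ^ (n - k) * p r ^ (k + 1) :=
    setIntegral_nonneg measurableSet_Ioo fun r hr => by
      have hr0 : 0 < r := by linarith [hr.1]
      have := hp r hr0
      positivity
  rw [annulusGradNorm, ← Real.mul_rpow (sphereArea_pos (n := n)).le hX0]
  congr 1
  rw [Set.sdiff_eq, ← setIntegral_indicator Metric.isClosed_closedBall.measurableSet.compl,
    setIntegral_of_unitBall_ae_eq (f := (Ioi (1 / 2 : ℝ)).indicator
      fun r => r ^ (1 - (k : ℝ)) * p r ^ (k + 1))]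
  · congr 1
    have e : (fun r : ℝ => r ^ (n - 1) * (Ioi (1 / 2 : ℝ)).indicator
        (fun r => r ^ (1 - (k : ℝ)) * p r ^ (k + 1)) r) = (Ioi (1 / 2 : ℝ)).indicator
        fun r => r ^ (n - 1) * (r ^ (1 - (k : ℝ)) * p r ^ (k + 1)) := by
      ext r
      by_cases hr : r ∈ Ioi (1 / 2 : ℝ)
      · rw [indicator_of_mem hr, indicator_of_mem hr]
      · rw [indicator_of_notMem hr, indicator_of_notMem hr, mul_zero]
    have e2 : Ioo (0 : ℝ) 1 ∩ Ioi (1 / 2) = Ioo (1 / 2) 1 := by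
      ext r
      simp only [mem_inter_iff, mem_Ioo, mem_Ioi]
      exact ⟨fun h => ⟨h.2, h.1.2⟩, fun h => ⟨⟨by linarith [h.1], h.2⟩, h.1⟩⟩
    rw [e, setIntegral_indicator measurableSet_Ioi, e2]
    refine setIntegral_congr_fun measurableSet_Ioo fun r hr => ?_
    have hr0 : 0 < r := by linarith [hr.1]
    rw [← mul_assoc, ← Real.rpow_natCast r (n - 1), ← Real.rpow_add hr0,
      ← Real.rpow_natCast r (n - k)]
    congr 2
    push_cast [hkn, show 1 ≤ n by omega]
    ring
  · filter_upwards [hG] with x hx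
    by_cases h : 1 / 2 < ‖x‖
    · have h0 : 0 < ‖x‖ := by linarith
      rw [indicator_of_mem (by simpa using h), indicator_of_mem (by exact h), hx,
        abs_of_nonneg (hp _ h0)]
    · rw [indicator_of_notMem (by simpa using h), indicator_of_notMem (by exact h)]

end KHessian

theorem theorem1p8 (n k : ℕ) (hk : 1 ≤ k) (hn : 2 * k + 8 ≤ n) :
    ∃ D D' : ℝ, ∀ (g : ℝ → ℝ) (u : EuclideanSpace ℝ (Fin n) → ℝ)
      (G : EuclideanSpace ℝ (Fin n) → EuclideanSpace ℝ (Fin n))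
      (H : EuclideanSpace ℝ (Fin n) → Matrix (Fin n) (Fin n) ℝ),
      LocallyLipschitz g →
      KHessian.MemWeightedSobolev k u G →
      KHessian.HasWeakHessian (KHessian.unitBall n \ {0}) G H →
      KHessian.IsRadial u →
      KHessian.IsWeakSolution k g u G H →
      KHessian.IsSemistable k g u H →
      (∀ s : ℝ, 0 ≤ g s) →
      ∃ v : ℝ → ℝ,
        (∀ᵐ x ∂(volume.restrict (KHessian.unitBall n)), u x = v ‖x‖) ∧
        ContDiffOn ℝ 1 v (Ioc 0 1) ∧
        (∀ r ∈ Ioc (0 : ℝ) (1 / 2), KHessian.radialDeriv 1 v r ≤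
          D * KHessian.annulusGradNorm k G *
            r ^ ((KHessian.expBase n k + (k : ℝ) ^ 2 + 4 * k - 1) / ((k : ℝ) + 1) ^ 2)) ∧
        (Antitone g →
          ContDiffOn ℝ 2 v (Ioc 0 1) ∧
          ∀ i ∈ ({1, 2} : Set ℕ), ∀ r ∈ Ioc (0 : ℝ) 1, |KHessian.radialDeriv i v r| ≤
            D' * KHessian.minSlope v *
              r ^ ((KHessian.expBase n k + (2 - (i : ℝ)) * (k : ℝ) ^ 2
                + 2 * (3 - (i : ℝ)) * k - i) / ((k : ℝ) + 1) ^ 2)) ∧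
        (Antitone g → ConvexOn ℝ univ g →
          {r ∈ Ioc (0 : ℝ) 1 |
            ¬ DifferentiableWithinAt ℝ (KHessian.radialDeriv 2 v) (Ioc 0 1) r}.Countable ∧
          (∀ r ∈ Ioc (0 : ℝ) 1, DifferentiableAt ℝ g (v r) →
            DifferentiableWithinAt ℝ (KHessian.radialDeriv 2 v) (Ioc 0 1) r) ∧
          ∀ r ∈ Ioc (0 : ℝ) 1,
            DifferentiableWithinAt ℝ (KHessian.radialDeriv 2 v) (Ioc 0 1) r →
            |KHessian.radialDeriv 3 v r| ≤
              D' * KHessian.minSlope v *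
                r ^ ((KHessian.expBase n k - (k : ℝ) ^ 2 - 3) / ((k : ℝ) + 1) ^ 2)) := by
  have hkn : k ≤ n := by omega
  have : NeZero n := ⟨by omega⟩
  obtain ⟨C, hC0, hC⟩ := KHessian.exists_slope_le hk hn
  obtain ⟨C₁, hC₁0, hC₁⟩ := KHessian.exists_slope_le_minSlope hk hn
  obtain ⟨C₂, hC₂0, hC₂⟩ := KHessian.exists_abs_third_deriv_le (n := n) hk (by omega)
  have hA := KHessian.sphereArea_pos (n := n)
  refine ⟨C / KHessian.sphereArea n ^ (1 / ((k : ℝ) + 1)), (1 + n + C₂) * C₁,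
    fun g u G H hg hmem hH hrad hsol hst hg0 => ?_⟩
  obtain ⟨v₀, p₀, hprof, huv, hGp⟩ :=
    KHessian.exists_isRadialProfile hk hkn hmem.2.1 hH hrad hsol hst
  obtain ⟨v, p, h, hv, hp⟩ := hprof.exists_isRadialSolution hg hg0 hk hkn
  set e : ℝ := (KHessian.expBase n k + (k : ℝ) ^ 2 + 4 * k - 1) / ((k : ℝ) + 1) ^ 2 with he
  have hm := h.minSlope_nonneg
  have hu' : ∀ᵐ x ∂(volume.restrict (KHessian.unitBall n)), u x = v ‖x‖ := by
    have h1 : ∀ᵐ x ∂(volume.restrict (KHessian.unitBall n)), v₀ ‖x‖ = v ‖x‖ :=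
      KHessian.ae_norm_of_ae (P := fun r => v₀ r = v r)
        ((ae_restrict_mem measurableSet_Ioo).mono fun r hr => hv hr)
    filter_upwards [huv, h1] with x hx hx1
    rw [hx, hx1]
  have hG' : ∀ᵐ x ∂(volume.restrict (KHessian.unitBall n)), ‖G x‖ = |p ‖x‖| := by
    have h1 : ∀ᵐ x ∂(volume.restrict (KHessian.unitBall n)), p₀ ‖x‖ = p ‖x‖ :=
      KHessian.ae_norm_of_ae (P := fun r => p₀ r = p r)
        ((ae_restrict_mem measurableSet_Ioo).mono fun r hr => hp hr)
    filter_upwards [hGp, h1] with x hx hx1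
    rw [hx, hx1]
  -- each further derivative costs one power of the radius
  have hdiv : ∀ r : ℝ, 0 < r → ∀ a : ℝ, r ^ a / r = r ^ (a - 1) := fun r hr a =>
    (Real.rpow_sub_one hr.ne' a).symm
  have he1 : e - 1 = (KHessian.expBase n k + 2 * k - 2) / ((k : ℝ) + 1) ^ 2 := by
    rw [he]; field_simp; ring
  have he2 : e - 1 - 1 = (KHessian.expBase n k - (k : ℝ) ^ 2 - 3) / ((k : ℝ) + 1) ^ 2 := by
    rw [he]; field_simp; ring
  refine ⟨v, hu', h.contDiffOn_one, fun r hr => ?_, fun ha => ?_, fun ha hcv => ?_⟩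
  · rw [h.derivWithin_profile ⟨hr.1, by linarith [hr.2]⟩,
      KHessian.annulusGradNorm_eq hk hkn h.nonneg hG', ← mul_assoc,
      div_mul_cancel₀ _ (by positivity)]
    exact hC g v p h hg hg0 r hr
  · obtain ⟨hc2, hb2⟩ := h.contDiffOn_two_and_abs_le hg.continuous hg0 hk (by omega) ha
    refine ⟨hc2, fun i hi r hr => ?_⟩
    have hr0 := hr.1
    have hbd := hC₁ g v p h hg hg0 ha r hr
    simp only [mem_insert_iff, mem_singleton_iff] at hi
    rcases hi with rfl | rfl
    · rw [h.derivWithin_profile hr, abs_of_nonneg (h.nonneg r hr0)]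
      have e1 : (KHessian.expBase n k + (2 - ((1 : ℕ) : ℝ)) * (k : ℝ) ^ 2 +
          2 * (3 - ((1 : ℕ) : ℝ)) * k - ((1 : ℕ) : ℝ)) / ((k : ℝ) + 1) ^ 2 = e := by
        rw [he]; push_cast; ring
      rw [e1]
      refine hbd.trans ?_
      gcongr
      exact le_mul_of_one_le_left hC₁0 (by linarith [show (0 : ℝ) ≤ n by positivity])
    · have e1 : (KHessian.expBase n k + (2 - ((2 : ℕ) : ℝ)) * (k : ℝ) ^ 2 +
          2 * (3 - ((2 : ℕ) : ℝ)) * k - ((2 : ℕ) : ℝ)) / ((k : ℝ) + 1) ^ 2 = e - 1 := by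
        rw [he1]; push_cast; ring
      rw [e1, ← hdiv r hr0]
      calc _ ≤ n * (p r / r) := hb2 r hr
        _ ≤ n * (C₁ * KHessian.minSlope v * r ^ e / r) := by gcongr
        _ = n * C₁ * KHessian.minSlope v * (r ^ e / r) := by ring
        _ ≤ _ := by gcongr; linarith
  · obtain ⟨h1, h2, h3⟩ := hC₂ g v p h hg.continuous hg0 ha hcv
    refine ⟨h1, h2, fun r hr hd => ?_⟩
    have hr0 := hr.1
    have hbd := hC₁ g v p h hg hg0 ha r hr
    rw [← he2, ← hdiv r hr0, ← hdiv r hr0]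
    calc _ ≤ C₂ * (p r / r / r) := h3 r hr hd
      _ ≤ C₂ * (C₁ * KHessian.minSlope v * r ^ e / r / r) := by gcongr
      _ = C₂ * C₁ * KHessian.minSlope v * (r ^ e / r / r) := by ring
      _ ≤ _ := by
          gcongr
          linarith [show (0 : ℝ) ≤ n by positivity]
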